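/- Conventions. Let $B$ be a unital $C^*$-algebra. A quasitrace on $B$ is a function $\tau:B\to\mathbb C$ such that (i) $\tau(x^*x)=\tau(xx^*)\ge 0$ for all $x\in B$; (ii) $\tau(a+ib)=\tau(a)+i\tau(b)$ for all selfadjoint $a,b\in B$; (iii) $\tau$ is linear on every abelian $C^*$-subalgebra of $B$; (iv) there is a function $\tau_2:M_2(B)\to\mathbb C$ satisfying (i), (ii), (iii) with $\tau(x)=\tau_2(x\otimes e_{11})$ for all $x\in B$. It is normalized if $\tau(1)=1$, faithful if $\tau(x^*x)=0$ implies $x=0$, and normal if every set $P$ of pairwise orthogonal projections of $B$ has a least upper bound $\bigvee P$ in the projection lattice and $\tau(\bigvee P)=\sum_{p\in P}\tau(p)$. An $AW^*$-algebra is a unital $C^*$-algebra in which the right annihilator $\{x\mid sx=0\text{ for all }s\in S\}$ of every subset $S$ has the form $pB$ for a projection $p$; it is finite if $v^*v=1$ implies $vv^*=1$. Proposition 4.2. Let $(A_n)_{n=1}^\infty$ be a sequence of unital $C^*$-algebras with normalized quasitraces $\tau_n$, and let $\mathfrak U$ be a free ultrafilter on $\mathbb N$. Let $\ell^\infty\{A_n\}$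 be the $C^*$-algebra of all sequences $x=(x_n)_{n=1}^\infty$ with $x_n\in A_n$ and $\sup_n\|x_n\|<\infty$, and let $$\mathfrak J_{\mathfrak U}=\{x\in\ell^\infty\{A_n\}\mid \lim_{\mathfrak U}\tau_n(x_n^*x_n)=0\}.$$ Then $\mathfrak J_{\mathfrak U}$ is a norm-closed two-sided ideal in $\ell^\infty\{A_n\}$, and the quotient $C^*$-algebra $\ell^\infty\{A_n\}/\mathfrak J_{\mathfrak U}$ is a finite $AW^*$-algebra. Moreover, for every $x\in\ell^\infty\{A_n\}$ the limit $$\tau_{\mathfrak U}([x])=\lim_{\mathfrak U}\tau_n(x_n)$$ exists and depends only on the class $[x]$ of $x$ in the quotient, and $\tau_{\mathfrak U}$ is a faithful normal quasitrace on $\ell^\infty\{A_n\}/\mathfrak J_{\mathfrak U}$. -/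

import Mathlib

open scoped ENNReal ComplexOrder Topology

/-! ### The C⋆-algebra of bounded sequences -/

/-- `ℓ^∞{A_i}`, the bounded families in a family of unital C⋆-algebras (Mathlib's `lp A ∞`, with
pointwise operations and the supremum norm), is a unital C⋆-algebra. -/
noncomputable instance lpInftyCStarAlgebra {ι : Type*} (A : ι → Type*)
    [∀ i, CStarAlgebra (A i)] [∀ i, Nontrivial (A i)] : CStarAlgebra (lp A ∞) where

/-! ### The quotient of a unital C⋆-algebra by a closed two-sided ideal -/

namespace CStarQuotient

section

variable {A : Type*} [CStarAlgebra A]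

/-- For `i ∈ A` and `ε > 0` there is a selfadjoint contraction `f` with `‖i * f‖ ≤ ε` and
`1 - f ∈ A * i`. -/
theorem exists_cutoff (i : A) {ε : ℝ} (hε : 0 < ε) :
    ∃ f c : A, star f = f ∧ ‖f‖ ≤ 1 ∧ ‖i * f‖ ≤ ε ∧ 1 - f = c * i := by
  set a : A := star i * i with ha
  have hsa : IsSelfAdjoint a := IsSelfAdjoint.star_mul_self i
  have hpos : ∀ t ∈ spectrum ℝ a, 0 ≤ t := spectrum_star_mul_self_nonneg
  set δ : ℝ := ε ^ 2 with hδ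
  have hδ0 : 0 < δ := by positivity
  have hne : ∀ t ∈ spectrum ℝ a, t + δ ≠ 0 := fun t ht => by
    have := hpos t ht
    positivity
  have hinv : ContinuousOn (fun t : ℝ => (t + δ)⁻¹) (spectrum ℝ a) :=
    ContinuousOn.inv₀ (by fun_prop) hne
  have hF : ContinuousOn (fun t : ℝ => δ * (t + δ)⁻¹) (spectrum ℝ a) :=
    continuousOn_const.mul hinv
  refine ⟨cfc (fun t : ℝ => δ * (t + δ)⁻¹) a, cfc (fun t : ℝ => (t + δ)⁻¹) a * star i,
    ?_, ?_, ?_, ?_⟩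
  · exact (cfc_predicate (p := IsSelfAdjoint) (fun t : ℝ => δ * (t + δ)⁻¹) a)
  · refine norm_cfc_le zero_le_one fun t ht => ?_
    have h0 := hpos t ht
    rw [Real.norm_of_nonneg (by positivity), ← div_eq_mul_inv, div_le_one (by positivity)]
    linarith
  · have hstar : star (cfc (fun t : ℝ => δ * (t + δ)⁻¹) a) = cfc (fun t : ℝ => δ * (t + δ)⁻¹) a :=
      cfc_predicate (p := IsSelfAdjoint) (fun t : ℝ => δ * (t + δ)⁻¹) a
    have key : star (i * cfc (fun t : ℝ => δ * (t + δ)⁻¹) a)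
        * (i * cfc (fun t : ℝ => δ * (t + δ)⁻¹) a)
        = cfc (fun t : ℝ => (δ * (t + δ)⁻¹) * t * (δ * (t + δ)⁻¹)) a := by
      rw [cfc_mul (fun t : ℝ => (δ * (t + δ)⁻¹) * t) (fun t : ℝ => δ * (t + δ)⁻¹) a
        (hF.mul continuousOn_id) hF, cfc_mul (fun t : ℝ => δ * (t + δ)⁻¹) (fun t : ℝ => t) a hF
        continuousOn_id, cfc_id' ℝ a, star_mul, hstar, ha]
      simp only [mul_assoc]
    have hsq : ‖i * cfc (fun t : ℝ => δ * (t + δ)⁻¹) a‖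
        * ‖i * cfc (fun t : ℝ => δ * (t + δ)⁻¹) a‖ ≤ ε * ε := by
      rw [← CStarRing.norm_star_mul_self, key]
      refine norm_cfc_le (by positivity) fun t ht => ?_
      have h0 := hpos t ht
      rw [Real.norm_of_nonneg (by positivity)]
      have h1 : t * (t + δ)⁻¹ ≤ 1 := by
        rw [← div_eq_mul_inv, div_le_one (by positivity)]
        linarith
      have h2 : δ * (t + δ)⁻¹ ≤ 1 := by
        rw [← div_eq_mul_inv, div_le_one (by positivity)]
        linarith
      calc (δ * (t + δ)⁻¹) * t * (δ * (t + δ)⁻¹)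
          = δ * ((t * (t + δ)⁻¹) * (δ * (t + δ)⁻¹)) := by ring
        _ ≤ δ * (1 * 1) := by gcongr
        _ = ε * ε := by rw [hδ]; ring
    nlinarith [norm_nonneg (i * cfc (fun t : ℝ => δ * (t + δ)⁻¹) a)]
  · rw [mul_assoc, ← ha]
    have h1 : cfc (fun t : ℝ => (t + δ)⁻¹) a * a = cfc (fun t : ℝ => (t + δ)⁻¹ * t) a := by
      rw [cfc_mul (fun t : ℝ => (t + δ)⁻¹) (fun t : ℝ => t) a hinv continuousOn_id, cfc_id' ℝ a]
    rw [h1, ← cfc_const_one ℝ a, ← cfc_sub (fun _ : ℝ => (1 : ℝ)) _ a continuousOn_const hF]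
    refine cfc_congr fun t ht => ?_
    have := hne t ht
    field_simp
    ring

variable (J : Ideal A) [J.IsTwoSided] [hJ : IsClosed (J : Set A)]

/-- A closed two-sided ideal of a C⋆-algebra is closed under the involution. -/
theorem star_mem {x : A} (hx : x ∈ J) : star x ∈ J := by
  have : star x ∈ closure (J : Set A) := by
    refine Metric.mem_closure_iff.2 fun ε hε => ?_
    obtain ⟨f, c, hf, -, hxf, hc⟩ := exists_cutoff x (half_pos hε)
    refine ⟨(1 - f) * star x, ?_, ?_⟩
    · rw [hc]
      exact J.mul_mem_right _ (J.mul_mem_left _ hx)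
    · rw [dist_eq_norm]
      have : star x - (1 - f) * star x = star (x * f) := by
        rw [star_mul, hf]; noncomm_ring
      rw [this, norm_star]
      linarith
  rwa [hJ.closure_eq] at this

/-- The involution of `A ⧸ J` induced by that of `A`. -/
instance instStar : Star (A ⧸ J) where
  star := Quotient.map' star fun x y h => by
    rw [Submodule.quotientRel_def] at h ⊢
    rw [← star_sub]
    exact star_mem J h

theorem star_mk (x : A) :
    star (Ideal.Quotient.mk J x) = Ideal.Quotient.mk J (star x) := rfl

instance instStarRing : StarRing (A ⧸ J) where
  star_involutive x := by
    obtain ⟨x, rfl⟩ := Ideal.Quotient.mk_surjective x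
    rw [star_mk, star_mk, star_star]
  star_mul x y := by
    obtain ⟨x, rfl⟩ := Ideal.Quotient.mk_surjective x
    obtain ⟨y, rfl⟩ := Ideal.Quotient.mk_surjective y
    rw [← map_mul, star_mk, star_mk, star_mk, ← map_mul, star_mul]
  star_add x y := by
    obtain ⟨x, rfl⟩ := Ideal.Quotient.mk_surjective x
    obtain ⟨y, rfl⟩ := Ideal.Quotient.mk_surjective y
    rw [← map_add, star_mk, star_mk, star_mk, ← map_add, star_add]

theorem norm_mk_le (x : A) : ‖Ideal.Quotient.mk J x‖ ≤ ‖x‖ :=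
  Submodule.Quotient.norm_mk_le J x

theorem exists_rep (x : A ⧸ J) {ε : ℝ} (hε : 0 < ε) :
    ∃ a : A, Ideal.Quotient.mk J a = x ∧ ‖a‖ < ‖x‖ + ε :=
  Submodule.Quotient.norm_mk_lt x hε

noncomputable instance instNormedRing : NormedRing (A ⧸ J) where
  __ := Ideal.Quotient.ring J
  __ := Submodule.Quotient.normedAddCommGroup J
  norm_mul_le x y := by
    have key : ∀ ε > 0, ‖x * y‖ ≤ (‖x‖ + ε) * (‖y‖ + ε) := fun ε hε => by
      obtain ⟨a, rfl, ha⟩ := exists_rep J x hε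
      obtain ⟨b, rfl, hb⟩ := exists_rep J y hε
      rw [← map_mul]
      refine (norm_mk_le J (a * b)).trans ((norm_mul_le a b).trans ?_)
      gcongr
    have hlim : Filter.Tendsto (fun ε : ℝ => (‖x‖ + ε) * (‖y‖ + ε)) (𝓝[>] 0)
        (𝓝 ((‖x‖ + 0) * (‖y‖ + 0))) :=
      (Continuous.tendsto (by fun_prop) 0).mono_left nhdsWithin_le_nhds
    simpa using ge_of_tendsto hlim (Filter.eventually_of_mem self_mem_nhdsWithin key)

noncomputable instance instNormedAlgebra : NormedAlgebra ℂ (A ⧸ J) where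
  __ := (Ideal.Quotient.algebra ℂ : Algebra ℂ (A ⧸ J))
  norm_smul_le := (Submodule.Quotient.normedSpace J ℂ).norm_smul_le

/-- The C⋆-identity for the quotient norm. -/
theorem norm_mul_self_le (x : A ⧸ J) : ‖x‖ * ‖x‖ ≤ ‖star x * x‖ := by
  obtain ⟨a, rfl⟩ := Ideal.Quotient.mk_surjective x
  refine le_of_forall_pos_le_add fun ε hε => ?_
  obtain ⟨b, hb, hbn⟩ := exists_rep J (star (Ideal.Quotient.mk J a) * Ideal.Quotient.mk J a)
    (half_pos hε)
  have hi : b - star a * a ∈ J := by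
    rw [← Ideal.Quotient.eq, hb, map_mul, star_mk]
  obtain ⟨f, c, hf, hf1, hif, hc⟩ := exists_cutoff (b - star a * a) (half_pos hε)
  have hmk : Ideal.Quotient.mk J (a * f) = Ideal.Quotient.mk J a := by
    rw [Ideal.Quotient.eq]
    have : a * f - a = -(a * c) * (b - star a * a) := by
      rw [neg_mul, mul_assoc, ← hc]; noncomm_ring
    rw [this]
    exact J.mul_mem_left _ hi
  have h1 : ‖Ideal.Quotient.mk J a‖ ≤ ‖a * f‖ := hmk ▸ norm_mk_le J (a * f)
  calc ‖Ideal.Quotient.mk J a‖ * ‖Ideal.Quotient.mk J a‖ ≤ ‖a * f‖ * ‖a * f‖ := by gcongr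
    _ = ‖f * b * f - f * ((b - star a * a) * f)‖ := by
        rw [← CStarRing.norm_star_mul_self, star_mul, hf]
        congr 1
        noncomm_ring
    _ ≤ ‖f * b * f‖ + ‖f * ((b - star a * a) * f)‖ := norm_sub_le _ _
    _ ≤ 1 * ‖b‖ * 1 + 1 * (ε / 2) := by
        refine add_le_add ?_ ?_
        · refine (norm_mul_le _ _).trans ?_
          gcongr
          refine (norm_mul_le _ _).trans ?_
          gcongr
        · refine (norm_mul_le _ _).trans ?_
          gcongr
    _ ≤ ‖star (Ideal.Quotient.mk J a) * Ideal.Quotient.mk J a‖ + ε := by linarith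

/-- The quotient of a unital C⋆-algebra by a closed two-sided ideal, with Mathlib's quotient ring
and algebra structure, the quotient norm and the induced involution, is a unital C⋆-algebra. -/
noncomputable instance instCStarAlgebra : CStarAlgebra (A ⧸ J) where
  toCompleteSpace := Submodule.Quotient.completeSpace J
  norm_mul_self_le := norm_mul_self_le J
  star_smul r x := by
    obtain ⟨x, rfl⟩ := Ideal.Quotient.mk_surjective x
    change star (Ideal.Quotient.mk J (r • x)) = star r • Ideal.Quotient.mk J (star x)
    rw [star_mk, star_smul]
    rfl

end

end CStarQuotient

/-! ### Quasitraces -/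

/-- Conditions (i), (ii), (iii) of a quasitrace on a C⋆-algebra `B` (only the topological star
algebra structure of `B` enters):
(i) `τ (x⋆x) = τ (xx⋆) ≥ 0` for all `x` (in particular this number is real);
(ii) `τ (a + ib) = τ a + i τ b` for selfadjoint `a`, `b`;
(iii) `τ` is linear on every abelian C⋆-subalgebra, that is, on every norm-closed, commutative,
selfadjoint (not necessarily unital) subalgebra. -/
structure IsOneQuasitrace {B : Type*} [Ring B] [StarRing B] [Algebra ℂ B] [TopologicalSpace B]
    (τ : B → ℂ) : Prop where
  tracial : ∀ x : B, τ (star x * x) = τ (x * star x)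
  nonneg : ∀ x : B, 0 ≤ τ (star x * x)
  map_add_I_smul : ∀ a b : B, IsSelfAdjoint a → IsSelfAdjoint b →
    τ (a + Complex.I • b) = τ a + Complex.I * τ b
  linear : ∀ C : NonUnitalStarSubalgebra ℂ B, IsClosed (C : Set B) →
    (∀ x ∈ C, ∀ y ∈ C, x * y = y * x) →
      (∀ x ∈ C, ∀ y ∈ C, τ (x + y) = τ x + τ y) ∧ ∀ (r : ℂ), ∀ x ∈ C, τ (r • x) = r * τ x

/-- A quasitrace on a unital C⋆-algebra `B` (a `2`-quasitrace): a function satisfying (i), (ii),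
(iii) such that there is a function `τ₂` on `M₂(B)`, also satisfying (i), (ii), (iii), with
`τ x = τ₂ (x ⊗ e₁₁)` for all `x`. -/
structure IsQuasitrace {B : Type*} [CStarAlgebra B] (τ : B → ℂ) : Prop
    extends IsOneQuasitrace τ where
  exists_matrix : ∃ τ₂ : CStarMatrix (Fin 2) (Fin 2) B → ℂ, IsOneQuasitrace τ₂ ∧
    ∀ x : B, τ x = τ₂ (CStarMatrix.ofMatrix !![x, 0; 0, 0])

/-- A quasitrace `τ` is faithful if `τ (x⋆x) = 0` only for `x = 0`. -/
def IsFaithfulQuasitrace {B : Type*} [CStarAlgebra B] (τ : B → ℂ) : Prop :=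
  ∀ x : B, τ (star x * x) = 0 → x = 0

/-- `p` is the least upper bound of the set `P` of projections in the lattice of projections, which
is ordered by `q ≤ p ↔ q p = q`. -/
structure IsProjectionLUB {B : Type*} [CStarAlgebra B] (P : Set B) (p : B) : Prop where
  isStarProjection : IsStarProjection p
  upper : ∀ q ∈ P, q * p = q
  least : ∀ r : B, IsStarProjection r → (∀ q ∈ P, q * r = q) → p * r = p

/-- A quasitrace is normal if every set `P` of pairwise orthogonal projections has a least upper
bound `⋁ P` in the lattice of projections and `τ (⋁ P) = ∑_{q ∈ P} τ q`. -/
def IsNormalQuasitrace {B : Type*} [CStarAlgebra B] (τ : B → ℂ) : Prop :=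
  ∀ P : Set B, (∀ q ∈ P, IsStarProjection q) → (P.Pairwise fun q r => q * r = 0) →
    ∃ p : B, IsProjectionLUB P p ∧ HasSum (fun q : P => τ q) (τ p)

/-! ### Finite AW⋆-algebras -/

/-- A unital C⋆-algebra is an AW⋆-algebra if it is a Baer ⋆-ring: the right annihilator of every
subset `S` is of the form `pB` for a projection `p`. -/
def IsAWStarAlgebra (B : Type*) [CStarAlgebra B] : Prop :=
  ∀ S : Set B, ∃ p : B, IsStarProjection p ∧
    {x : B | ∀ s ∈ S, s * x = 0} = {x : B | ∃ y : B, x = p * y}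

/-- A unital C⋆-algebra is finite if the unit is not Murray-von Neumann equivalent to a proper
subprojection, that is, if every isometry in it is unitary. -/
def IsFiniteCStarAlgebra (B : Type*) [CStarAlgebra B] : Prop :=
  ∀ v : B, star v * v = 1 → v * star v = 1

/-! Let `E` be the algebra of bounded sequences, `ρ` the limit of the `τ n` along the ultrafilter
and `N x = ρ (x⋆x)`. Quasitraces with bounded value at the unit are uniformly bounded on
norm-bounded sets and `*`-homomorphisms preserve commutation, so `ρ` is again a quasitrace, as are
the limits of the functions on matrices.

A quasitrace is additive only on commuting elements, so order and sums need work. Monotonicity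
(`re_mono`) follows by cutting an element into ramps and comparing ramps of `a` with shifted ramps
of `b` (`re_sq_le`, `re_ramp_le`). Traciality on two-by-two matrices gives `ρ (a + b) ≤ (1 + t) ρ a
+ (1 + t⁻¹) ρ b` for positive `a`, `b` (`re_add_le`). Hence the null elements form a closed
two-sided ideal, and `ρ` is constant on its cosets (`eq_of_null`).

The main obstacle is linearity on abelian subalgebras of the quotient, since commuting elements need
not lift to commuting elements. Orthogonal positive elements can still be treated by cutoffs, so the
push-forward is additive on them (`isPositiveQuasitrace_infLift`). A diagonal argument shows that
norm-bounded sets are complete for `N` (`exists_limit_of_cauchy`), which produces support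
projections in the quotient (`IsCompleteSqNorm.hasSupports`). Commuting positive elements are then
norm limits of combinations of commuting projections, where additivity reduces to orthogonal pieces
(`add_of_sum_projections`). The same argument runs on two-by-two matrices. There only a
one-quasitrace is at hand and constancy on cosets is not available, so the push-forward is an
infimum over lifts.

Completeness also gives limits of increasing sums of orthogonal projections, hence normality
(`isNormalQuasitrace`); with supports and Zorn's lemma this yields the annihilator projections.
Faithfulness and traciality give finiteness. -/

/-! ### One-quasitraces: additivity on commuting elements and monotonicity -/

namespace IsOneQuasitrace

section

variable {B : Type*} [CStarAlgebra B] {τ : B → ℂ}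

/-- A quasitrace is linear on commutative selfadjoint sets. -/
theorem linear_of_commuting (hτ : IsOneQuasitrace τ) {S : Set B} (hS : ∀ x ∈ S, star x ∈ S)
    (hcomm : ∀ x ∈ S, ∀ y ∈ S, x * y = y * x) :
    (∀ x ∈ S, ∀ y ∈ S, τ (x + y) = τ x + τ y) ∧ ∀ r : ℂ, ∀ x ∈ S, τ (r • x) = r * τ x := by
  -- The double commutant of `S` is norm-closed and selfadjoint, and it is commutative because `S`
  -- lies in its own commutant. Condition (iii) applies to it.
  set C := NonUnitalStarSubalgebra.centralizer ℂ (Set.centralizer S) with hC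
  have hstar : star (Set.centralizer S) = Set.centralizer S := by
    rw [Set.star_centralizer]
    congr 1
    ext x
    rw [Set.mem_star]
    exact ⟨fun hx => star_star x ▸ hS _ hx, fun hx => hS _ hx⟩
  have hCcoe : (C : Set B) = Set.centralizer (Set.centralizer S) := by
    rw [hC, NonUnitalStarSubalgebra.coe_centralizer, hstar, Set.union_self]
  have hsub : (C : Set B) ⊆ Set.centralizer S := by
    rw [hCcoe]
    refine Set.centralizer_subset fun x hx y hy => hcomm y hy x hx
  have hmem : ∀ x ∈ S, x ∈ C := fun x hx => by
    change x ∈ (C : Set B)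
    rw [hCcoe]
    exact Set.subset_centralizer_centralizer hx
  have hlin := hτ.linear C (by rw [hCcoe]; exact Set.isClosed_centralizer _) fun x hx y hy => by
    have hx' := hsub hx
    have hy' : y ∈ (C : Set B) := hy
    rw [hCcoe] at hy'
    exact hy' x hx'
  exact ⟨fun x hx y hy => hlin.1 x (hmem x hx) y (hmem y hy), fun r x hx => hlin.2 r x (hmem x hx)⟩

theorem linear_of_commute (hτ : IsOneQuasitrace τ) {a b : B} (ha : IsSelfAdjoint a)
    (hb : IsSelfAdjoint b) (hab : Commute a b) :
    τ (a + b) = τ a + τ b ∧ ∀ r : ℂ, τ (r • a) = r * τ a := by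
  have h := hτ.linear_of_commuting (S := {a, b})
    (by
      rintro x (rfl | rfl)
      · exact Or.inl ha.star_eq
      · exact Or.inr hb.star_eq)
    (by
      rintro x (rfl | rfl) y (rfl | rfl)
      exacts [rfl, hab.eq, hab.eq.symm, rfl])
  exact ⟨h.1 a (by simp) b (by simp), fun r => h.2 r a (by simp)⟩

theorem add_of_commute (hτ : IsOneQuasitrace τ) {a b : B} (ha : IsSelfAdjoint a)
    (hb : IsSelfAdjoint b) (hab : Commute a b) : τ (a + b) = τ a + τ b :=
  (hτ.linear_of_commute ha hb hab).1

theorem map_smul (hτ : IsOneQuasitrace τ) {a : B} (ha : IsSelfAdjoint a) (r : ℂ) :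
    τ (r • a) = r * τ a :=
  (hτ.linear_of_commute ha ha (Commute.refl a)).2 r

theorem map_real_smul (hτ : IsOneQuasitrace τ) {a : B} (ha : IsSelfAdjoint a) (r : ℝ) :
    τ (r • a) = r * τ a := by
  rw [← hτ.map_smul ha, Complex.coe_smul]

theorem map_zero (hτ : IsOneQuasitrace τ) : τ 0 = 0 := by
  simpa using hτ.map_smul (IsSelfAdjoint.zero B) 0

theorem sub_of_commute (hτ : IsOneQuasitrace τ) {a b : B} (ha : IsSelfAdjoint a)
    (hb : IsSelfAdjoint b) (hab : Commute a b) : τ (a - b) = τ a - τ b := by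
  have := hτ.add_of_commute (ha.sub hb) hb (hab.sub_left (Commute.refl b))
  rw [sub_add_cancel] at this
  rw [this]; ring

theorem map_sum_of_commute (hτ : IsOneQuasitrace τ) {ι : Type*} (s : Finset ι) (f : ι → B)
    (hf : ∀ i ∈ s, IsSelfAdjoint (f i)) (hc : ∀ i ∈ s, ∀ j ∈ s, Commute (f i) (f j)) :
    τ (∑ i ∈ s, f i) = ∑ i ∈ s, τ (f i) := by
  classical
  induction s using Finset.induction_on with
  | empty => simp [hτ.map_zero]
  | insert i s his ih =>
    rw [Finset.sum_insert his, Finset.sum_insert his, hτ.add_of_commute (hf i (by simp)) ?_ ?_,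
      ih (fun j hj => hf j (by simp [hj])) (fun j hj k hk => hc j (by simp [hj]) k (by simp [hk]))]
    · exact isSelfAdjoint_sum s fun j hj => hf j (by simp [hj])
    · exact Commute.sum_right s f _ fun j hj => hc i (by simp) j (by simp [hj])

/-- Adding a scalar. -/
theorem add_algebraMap (hτ : IsOneQuasitrace τ) {a : B} (ha : IsSelfAdjoint a) (r : ℝ) :
    τ (a + algebraMap ℝ B r) = τ a + r * τ 1 := by
  rw [hτ.add_of_commute ha (IsSelfAdjoint.algebraMap B (IsSelfAdjoint.all r))
    (Algebra.commutes r a).symm, Algebra.algebraMap_eq_smul_one,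
    hτ.map_real_smul (IsSelfAdjoint.one B)]

theorem re_star_mul_self_nonneg (hτ : IsOneQuasitrace τ) (x : B) : 0 ≤ (τ (star x * x)).re :=
  (Complex.nonneg_iff.1 (hτ.nonneg x)).1

end

section

variable {B : Type*} [CStarAlgebra B] [PartialOrder B] [StarOrderedRing B] {τ : B → ℂ}

theorem nonneg_of_nonneg (hτ : IsOneQuasitrace τ) {a : B} (ha : 0 ≤ a) : 0 ≤ τ a := by
  obtain ⟨x, rfl⟩ := CStarAlgebra.nonneg_iff_eq_star_mul_self.1 ha
  exact hτ.nonneg x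

theorem re_nonneg (hτ : IsOneQuasitrace τ) {a : B} (ha : 0 ≤ a) : 0 ≤ (τ a).re :=
  (Complex.nonneg_iff.1 (hτ.nonneg_of_nonneg ha)).1

theorem im_eq_zero (hτ : IsOneQuasitrace τ) {a : B} (ha : IsSelfAdjoint a) : (τ a).im = 0 := by
  have h : a⁺ - a⁻ = a := CFC.posPart_sub_negPart a ha
  have hc : Commute (a⁺) (a⁻) := by
    rw [commute_iff_eq, CFC.posPart_mul_negPart, CFC.negPart_mul_posPart]
  rw [← h, hτ.sub_of_commute (CFC.posPart_nonneg a).isSelfAdjoint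
    (CFC.negPart_nonneg a).isSelfAdjoint hc, Complex.sub_im,
    ← (Complex.nonneg_iff.1 (hτ.nonneg_of_nonneg (CFC.posPart_nonneg a))).2,
    ← (Complex.nonneg_iff.1 (hτ.nonneg_of_nonneg (CFC.negPart_nonneg a))).2, sub_zero]

theorem eq_re (hτ : IsOneQuasitrace τ) {a : B} (ha : IsSelfAdjoint a) :
    τ a = ((τ a).re : ℂ) := by
  apply Complex.ext <;> simp [hτ.im_eq_zero ha]

theorem re_le_of_commute (hτ : IsOneQuasitrace τ) {a b : B} (ha : IsSelfAdjoint a)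
    (hb : IsSelfAdjoint b) (hab : Commute a b) (h : a ≤ b) : (τ a).re ≤ (τ b).re := by
  have := hτ.re_nonneg (sub_nonneg.2 h)
  rw [hτ.sub_of_commute hb ha hab.symm, Complex.sub_re] at this
  linarith

end

end IsOneQuasitrace

/-! ### Comparison of positive elements -/

section Comparison

variable {B : Type*} [CStarAlgebra B] [PartialOrder B] [StarOrderedRing B]

/-- The function `t ↦ (max t ε) ^ (-1/2)`. -/
noncomputable def cutInvSqrt (ε t : ℝ) : ℝ := (√(max t ε))⁻¹

theorem continuous_cutInvSqrt {ε : ℝ} (hε : 0 < ε) : Continuous (cutInvSqrt ε) := by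
  unfold cutInvSqrt
  refine Continuous.inv₀ (by fun_prop) fun t => ?_
  have : 0 < max t ε := lt_max_of_lt_right hε
  positivity

theorem cutInvSqrt_of_le {ε t : ℝ} (h : ε ≤ t) : cutInvSqrt ε t = (√t)⁻¹ := by
  rw [cutInvSqrt, max_eq_left h]

theorem mul_cutInvSqrt_nonneg {ε t : ℝ} (ht : 0 ≤ t) : 0 ≤ t * cutInvSqrt ε t := by
  unfold cutInvSqrt; positivity

theorem mul_cutInvSqrt_le {ε t : ℝ} (hε : 0 < ε) (ht : 0 ≤ t) :
    t * cutInvSqrt ε t ≤ √t := by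
  have h0 : 0 < max t ε := lt_max_of_lt_right hε
  rw [cutInvSqrt, ← div_eq_mul_inv, div_le_iff₀ (by positivity)]
  calc t = √t * √t := (Real.mul_self_sqrt ht).symm
    _ ≤ √t * √(max t ε) := by gcongr; exact le_max_left _ _

/-- For `t ≥ δ` the two cut functions agree; for `t ≤ δ` both products lie in `[0, √δ]`. -/
theorem abs_mul_cutInvSqrt_sub_le {ε ε' δ t : ℝ} (hε : 0 < ε) (hε' : 0 < ε') (h : ε ≤ δ)
    (h' : ε' ≤ δ) (ht : 0 ≤ t) :
    |t * (cutInvSqrt ε t - cutInvSqrt ε' t)| ≤ √δ := by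
  rcases le_total δ t with hδ | hδ
  · rw [cutInvSqrt_of_le (h.trans hδ), cutInvSqrt_of_le (h'.trans hδ)]
    simp
  · have h1 := mul_cutInvSqrt_nonneg (ε := ε) ht
    have h2 := mul_cutInvSqrt_nonneg (ε := ε') ht
    have h3 := mul_cutInvSqrt_le hε ht
    have h4 := mul_cutInvSqrt_le hε' ht
    have h5 : √t ≤ √δ := Real.sqrt_le_sqrt hδ
    rw [mul_sub, abs_le]
    constructor <;> linarith

/-- Norm estimate for `e * f (z z⋆) * z` when `e² ≤ K z z⋆`. -/
theorem norm_mul_cfc_mul_sq_le {e z : B} (he : IsSelfAdjoint e) {K : ℝ} (hK : 0 ≤ K)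
    (hle : e * e ≤ K • (z * star z)) {f : ℝ → ℝ} (hf : Continuous f) {c : ℝ}
    (hfc : ∀ t, 0 ≤ t → |t * f t| ≤ c) :
    ‖e * cfc f (z * star z) * z‖ ^ 2 ≤ K * c ^ 2 := by
  set y := z * star z with hy
  have hysa : IsSelfAdjoint y := IsSelfAdjoint.mul_star_self z
  have hy0 : 0 ≤ y := mul_star_self_nonneg z
  have hspec : ∀ t ∈ spectrum ℝ y, 0 ≤ t := fun t ht => spectrum_nonneg_of_nonneg hy0 ht
  set r := cfc f y with hr
  have hrsa : IsSelfAdjoint r := IsSelfAdjoint.cfc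
  set s := cfc Real.sqrt y with hs
  have hssa : IsSelfAdjoint s := IsSelfAdjoint.cfc
  have hss : s * s = y := by
    rw [hs, ← cfc_mul Real.sqrt Real.sqrt y]
    conv_rhs => rw [← cfc_id' ℝ y]
    exact cfc_congr fun t ht => Real.mul_self_sqrt (hspec t ht)
  have h1 : ‖e * r * z‖ ^ 2 = ‖star (r * z) * (e * e) * (r * z)‖ := by
    rw [sq, ← CStarRing.norm_star_mul_self]
    congr 1
    simp only [star_mul, he.star_eq, hrsa.star_eq, mul_assoc]
  have h2 : star (r * z) * (e * e) * (r * z) ≤ star (r * z) * (K • y) * (r * z) :=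
    star_left_conjugate_le_conjugate hle _
  have h3 : 0 ≤ star (r * z) * (e * e) * (r * z) := by
    apply star_left_conjugate_nonneg
    conv_rhs => rw [← he.star_eq]
    simpa [he.star_eq] using mul_star_self_nonneg e
  have h4 : star (r * z) * (K • y) * (r * z) = K • (star (s * r * z) * (s * r * z)) := by
    rw [mul_smul_comm, smul_mul_assoc]
    congr 1
    rw [← hss]
    simp only [star_mul, hssa.star_eq, hrsa.star_eq, mul_assoc]
  -- The element `s r z (s r z)⋆ = s r y r s` is the function `(t f(t))²` of `y`.
  have h5 : ‖s * r * z‖ ^ 2 = ‖cfc (fun t => √t * f t * t * (√t * f t)) y‖ := by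
    rw [sq, ← CStarRing.norm_self_mul_star]
    have e1 : s * r * z * star (s * r * z) = s * r * y * (r * s) := by
      simp only [star_mul, hssa.star_eq, hrsa.star_eq, mul_assoc, hy]
    have e2 : r * s = s * r := (cfc_commute_cfc f Real.sqrt y).eq
    rw [e1, e2, hs, hr]
    rw [cfc_mul (fun t => √t * f t * t) (fun t => √t * f t) y (by fun_prop) (by fun_prop),
      cfc_mul (fun t => √t * f t) (fun t => t) y (by fun_prop) (by fun_prop), cfc_id' ℝ y,
      cfc_mul (fun t => √t) f y (by fun_prop) (by fun_prop)]
  have h6 : ‖s * r * z‖ ^ 2 ≤ c ^ 2 := by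
    rw [h5]
    refine norm_cfc_le (by positivity) fun t ht => ?_
    have ht0 := hspec t ht
    have : √t * f t * t * (√t * f t) = (t * f t) ^ 2 := by
      have := Real.mul_self_sqrt ht0
      calc _ = (√t * √t) * t * f t ^ 2 := by ring
        _ = _ := by rw [this]; ring
    rw [this, Real.norm_of_nonneg (by positivity), ← sq_abs]
    have := hfc t ht0
    gcongr
  calc ‖e * r * z‖ ^ 2 ≤ ‖K • (star (s * r * z) * (s * r * z))‖ := by
        rw [h1, ← h4]
        exact CStarAlgebra.norm_le_norm_of_nonneg_of_le h3 h2
    _ = K * ‖s * r * z‖ ^ 2 := by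
        rw [norm_smul, CStarRing.norm_star_mul_self, Real.norm_of_nonneg hK, sq]
    _ ≤ K * c ^ 2 := by gcongr

/-- If `e² ≤ K z z⋆`, then `e² = t t⋆` for some `t` in the closed left ideal generated by `z`:
every `g` with `z g = z` satisfies `t g = t`. -/
theorem exists_mul_star_eq_sq {e z : B} (he : IsSelfAdjoint e) {K : ℝ} (hK : 0 ≤ K)
    (hle : e * e ≤ K • (z * star z)) :
    ∃ t : B, t * star t = e * e ∧ ∀ g, z * g = z → t * g = t := by
  set y := z * star z with hy
  have hysa : IsSelfAdjoint y := IsSelfAdjoint.mul_star_self z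
  have hy0 : 0 ≤ y := mul_star_self_nonneg z
  have hspec : ∀ t ∈ spectrum ℝ y, 0 ≤ t := fun t ht => spectrum_nonneg_of_nonneg hy0 ht
  set ε : ℕ → ℝ := fun n => 1 / ((n : ℝ) + 1) with hε
  have hε0 : ∀ n, 0 < ε n := fun n => Nat.one_div_pos_of_nat
  have hεm : ∀ {n m}, n ≤ m → ε m ≤ ε n := fun h => Nat.one_div_le_one_div h
  have hεt : Filter.Tendsto ε Filter.atTop (𝓝 0) := tendsto_one_div_add_atTop_nhds_zero_nat
  -- These approximate the formal expression `e y^(-1/2) z`, for which `t t⋆ = e y^(-1/2) y y^(-1/2)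
  -- e = e²`. The bound `e² ≤ K y` is what makes the limit exist.
  set t : ℕ → B := fun n => e * cfc (cutInvSqrt (ε n)) y * z with ht
  have hdist : ∀ n m k : ℕ, k ≤ n → k ≤ m → dist (t n) (t m) ≤ √K * √(ε k) := by
    intro n m k hn hm
    have hcont := (continuous_cutInvSqrt (hε0 n)).sub (continuous_cutInvSqrt (hε0 m))
    have e1 : t n - t m = e * cfc (fun x => cutInvSqrt (ε n) x - cutInvSqrt (ε m) x) y * z := by
      rw [cfc_sub _ _ y (continuous_cutInvSqrt (hε0 n)).continuousOn
        (continuous_cutInvSqrt (hε0 m)).continuousOn]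
      simp only [ht, mul_sub, sub_mul]
    have := norm_mul_cfc_mul_sq_le he hK hle hcont fun x hx =>
      abs_mul_cutInvSqrt_sub_le (hε0 n) (hε0 m) (hεm hn) (hεm hm) hx
    rw [dist_eq_norm, e1]
    refine abs_le_of_sq_le_sq' (this.trans_eq ?_) (by positivity) |>.2
    rw [mul_pow, Real.sq_sqrt hK]
  have hlim0 : Filter.Tendsto (fun k => √K * √(ε k)) Filter.atTop (𝓝 0) := by
    have : Filter.Tendsto (fun k => √(ε k)) Filter.atTop (𝓝 0) := by
      simpa [Function.comp_def] using (Real.continuous_sqrt.tendsto 0).comp hεt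
    simpa using this.const_mul (√K)
  have hcau : CauchySeq t := by
    refine cauchySeq_of_le_tendsto_0 (fun k => √K * √(ε k)) (fun n m k => hdist n m k) hlim0
  obtain ⟨T, hT⟩ := cauchySeq_tendsto_of_complete hcau
  refine ⟨T, ?_, fun g hg => ?_⟩
  · have h1 : Filter.Tendsto (fun n => t n * star (t n)) Filter.atTop (𝓝 (T * star T)) :=
      hT.mul (hT.star)
    refine tendsto_nhds_unique h1 ?_
    have hk : ∀ n, ContinuousOn (fun x => 1 - cutInvSqrt (ε n) x * x * cutInvSqrt (ε n) x)
        (spectrum ℝ y) := fun n => by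
      have := continuous_cutInvSqrt (hε0 n)
      fun_prop
    have h2 : ∀ n, t n * star (t n) = e * e
        - (e * cfc (fun x => 1 - cutInvSqrt (ε n) x * x * cutInvSqrt (ε n) x) y) * e := by
      intro n
      have hc := continuous_cutInvSqrt (hε0 n)
      have hrsa : IsSelfAdjoint (cfc (cutInvSqrt (ε n)) y) := IsSelfAdjoint.cfc
      rw [cfc_sub (fun _ => (1 : ℝ)) (fun x => cutInvSqrt (ε n) x * x * cutInvSqrt (ε n) x) y
        (by fun_prop) (by fun_prop), cfc_const_one ℝ y,
        cfc_mul (fun x => cutInvSqrt (ε n) x * x) (fun x => cutInvSqrt (ε n) x) y (by fun_prop)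
        (by fun_prop), cfc_mul (fun x => cutInvSqrt (ε n) x) (fun x => x) y (by fun_prop)
        (by fun_prop), cfc_id' ℝ y]
      simp only [ht, star_mul, he.star_eq, hrsa.star_eq]
      rw [show cfc (fun x => cutInvSqrt (ε n) x) y = cfc (cutInvSqrt (ε n)) y from rfl, hy]
      noncomm_ring
    -- The defect function `k` takes values in `[0, 1]` on the spectrum and vanishes from `ε n` on,
    -- so `x k(x)² ≤ ε n`; with `e² ≤ K y` this makes `e k(y)` small.
    have h3 : ∀ n, ‖e * cfc (fun x => 1 - cutInvSqrt (ε n) x * x * cutInvSqrt (ε n) x) y‖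
        ≤ √K * √(ε n) := by
      intro n
      set k : ℝ → ℝ := fun x => 1 - cutInvSqrt (ε n) x * x * cutInvSqrt (ε n) x with hkdef
      have hk01 : ∀ x, 0 ≤ x → 0 ≤ k x ∧ k x ≤ 1 ∧ (ε n ≤ x → k x = 0) := by
        intro x hx
        have h0 : 0 < max x (ε n) := lt_max_of_lt_right (hε0 n)
        have e1 : k x = 1 - x / max x (ε n) := by
          have : cutInvSqrt (ε n) x * cutInvSqrt (ε n) x = (max x (ε n))⁻¹ := by
            rw [cutInvSqrt, ← mul_inv, Real.mul_self_sqrt h0.le]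
          simp only [hkdef]
          rw [mul_right_comm, this]
          ring
        refine ⟨?_, ?_, fun h => ?_⟩
        · rw [e1, sub_nonneg, div_le_one h0]; exact le_max_left _ _
        · rw [e1]; have : 0 ≤ x / max x (ε n) := by positivity
          linarith
        · rw [e1, max_eq_left h, div_self (by linarith [hε0 n]), sub_self]
      have hksa : IsSelfAdjoint (cfc k y) := IsSelfAdjoint.cfc
      have e1 : ‖e * cfc k y‖ ^ 2 = ‖star (cfc k y) * (e * e) * cfc k y‖ := by
        rw [sq, ← CStarRing.norm_star_mul_self]
        congr 1
        simp only [star_mul, he.star_eq, hksa.star_eq, mul_assoc]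
      have e2 : star (cfc k y) * (e * e) * cfc k y ≤ star (cfc k y) * (K • y) * cfc k y :=
        star_left_conjugate_le_conjugate hle _
      have e3 : 0 ≤ star (cfc k y) * (e * e) * cfc k y := by
        apply star_left_conjugate_nonneg
        simpa [he.star_eq] using mul_star_self_nonneg e
      have e4 : star (cfc k y) * (K • y) * cfc k y = K • cfc (fun x => k x * x * k x) y := by
        rw [cfc_mul (fun x => k x * x) k y ((hk n).mul continuousOn_id) (hk n),
          cfc_mul k (fun x => x) y (hk n) continuousOn_id, cfc_id' ℝ y, hksa.star_eq,
          mul_smul_comm, smul_mul_assoc]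
      have e5 : ‖cfc (fun x => k x * x * k x) y‖ ≤ ε n := by
        refine norm_cfc_le (hε0 n).le fun x hx => ?_
        have hx0 := hspec x hx
        obtain ⟨k0, k1, k2⟩ := hk01 x hx0
        rw [Real.norm_of_nonneg (by positivity)]
        rcases le_total (ε n) x with h | h
        · rw [k2 h]; simpa using (hε0 n).le
        · calc k x * x * k x ≤ 1 * x * 1 := by gcongr
            _ ≤ ε n := by simpa using h
      refine abs_le_of_sq_le_sq' ?_ (by positivity) |>.2
      rw [mul_pow, Real.sq_sqrt hK, Real.sq_sqrt (hε0 n).le, e1]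
      refine (CStarAlgebra.norm_le_norm_of_nonneg_of_le e3 e2).trans ?_
      rw [e4, norm_smul, Real.norm_of_nonneg hK]
      gcongr
    have h4 : Filter.Tendsto
        (fun n => e * cfc (fun x => 1 - cutInvSqrt (ε n) x * x * cutInvSqrt (ε n) x) y)
        Filter.atTop (𝓝 0) := squeeze_zero_norm h3 hlim0
    simp_rw [h2]
    simpa using (tendsto_const_nhds (x := e * e)).sub (h4.mul_const e)
  · refine tendsto_nhds_unique (hT.mul_const g) ?_
    simpa only [ht, mul_assoc, hg] using hT

/-- Comparison: if `e² ≤ K z z⋆` with `‖e‖ ≤ 1` and `g ≥ 0` is a right unit for `z`,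
then `τ (e²) ≤ τ g`. -/
theorem IsOneQuasitrace.re_sq_le {τ : B → ℂ} (hτ : IsOneQuasitrace τ) {e z g : B}
    (he : IsSelfAdjoint e) (he1 : ‖e‖ ≤ 1) {K : ℝ} (hK : 0 ≤ K)
    (hle : e * e ≤ K • (z * star z)) (hg : 0 ≤ g) (hzg : z * g = z) :
    (τ (e * e)).re ≤ (τ g).re := by
  obtain ⟨t, ht, htg⟩ := exists_mul_star_eq_sq he hK hle
  have h1 := htg g hzg
  have hgsa : star g = g := hg.isSelfAdjoint
  -- Traciality replaces `e² = t t⋆` by `w = t⋆ t`. The latter commutes with `g` and satisfies `g -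
  -- w = g (1 - w) ≥ 0`, so monotonicity for commuting elements suffices.
  set w := star t * t with hw
  have hw0 : 0 ≤ w := star_mul_self_nonneg t
  have hwg : w * g = w := by rw [hw, mul_assoc, h1]
  have hgw : g * w = w := by
    have := congrArg star hwg
    rwa [star_mul, hgsa, hw0.isSelfAdjoint.star_eq] at this
  have hw1 : w ≤ 1 := by
    rw [← CStarAlgebra.norm_le_one_iff_of_nonneg w hw0, hw, CStarRing.norm_star_mul_self,
      ← CStarRing.norm_self_mul_star, ht]
    calc ‖e * e‖ ≤ ‖e‖ * ‖e‖ := norm_mul_le _ _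
      _ ≤ 1 * 1 := by gcongr
      _ = 1 := one_mul 1
  have hcomm : Commute w g := hwg.trans hgw.symm
  have hle' : w ≤ g := by
    rw [← sub_nonneg]
    have : g - w = g * (1 - w) := by rw [mul_sub, mul_one, hgw]
    rw [this]
    exact Commute.mul_nonneg hg (sub_nonneg.2 hw1) ((Commute.one_right g).sub_right hcomm.symm)
  rw [← ht, ← hτ.tracial t]
  exact hτ.re_le_of_commute hw0.isSelfAdjoint hg.isSelfAdjoint hcomm hle'

end Comparison

/-! ### Monotonicity and norm continuity of quasitraces -/

section Monotone

/-- The ramp function `s ↦ min (max s 0) 1`. -/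
noncomputable def ramp (s : ℝ) : ℝ := max 0 (min 1 s)

@[fun_prop]
theorem continuous_ramp : Continuous ramp := by unfold ramp; fun_prop

theorem ramp_nonneg (s : ℝ) : 0 ≤ ramp s := le_max_left _ _

theorem ramp_le_one (s : ℝ) : ramp s ≤ 1 := max_le zero_le_one (min_le_left _ _)

theorem ramp_of_nonpos {s : ℝ} (h : s ≤ 0) : ramp s = 0 :=
  max_eq_left ((min_le_right _ _).trans h)

theorem ramp_of_one_le {s : ℝ} (h : 1 ≤ s) : ramp s = 1 := by
  rw [ramp, min_eq_left h, max_eq_right zero_le_one]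

theorem ramp_of_mem {s : ℝ} (h : 0 ≤ s) (h' : s ≤ 1) : ramp s = s := by
  rw [ramp, min_eq_right h', max_eq_right h]

/-- Staircase decomposition: the `i`-th ramp records the part of `s` between `i` and `i + 1`. -/
theorem sum_ramp {s : ℝ} (hs : 0 ≤ s) (m : ℕ) :
    ∑ i ∈ Finset.range m, ramp (s - i) = min s m := by
  induction m with
  | zero => simp [hs]
  | succ m ih =>
    rw [Finset.sum_range_succ, ih]
    push_cast
    rcases le_total s m with h | h
    · rw [ramp_of_nonpos (by linarith), min_eq_left h, min_eq_left (by linarith), add_zero]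
    · rcases le_total s (m + 1) with h' | h'
      · rw [ramp_of_mem (by linarith) (by linarith), min_eq_right h, min_eq_left h']
        ring
      · rw [ramp_of_one_le (by linarith), min_eq_right h, min_eq_right h']

theorem cfc_mul_mul {B : Type*} [CStarAlgebra B] {f g h : ℝ → ℝ} (hf : Continuous f)
    (hg : Continuous g) (hh : Continuous h) (a : B) :
    cfc (fun t => f t * g t * h t) a = cfc f a * cfc g a * cfc h a := by
  rw [cfc_mul (fun t => f t * g t) h a (hf.mul hg).continuousOn hh.continuousOn,
    cfc_mul f g a hf.continuousOn hg.continuousOn]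

theorem cfc_id_sub_const {B : Type*} [CStarAlgebra B] {a : B} (ha : IsSelfAdjoint a) (s : ℝ) :
    cfc (fun t => t - s) a = a - algebraMap ℝ B s := by
  rw [cfc_sub (fun t => t) (fun _ => s) a continuousOn_id continuousOn_const, cfc_id' ℝ a ha,
    cfc_const s a ha]

namespace IsOneQuasitrace

theorem re_cfc_sum
    {B : Type*} [CStarAlgebra B] {τ : B → ℂ} (hτ : IsOneQuasitrace τ) {ι : Type*} (s : Finset ι)
    (f : ι → ℝ → ℝ)
    (hf : ∀ i, Continuous (f i)) (a : B) :
    (τ (cfc (∑ i ∈ s, f i) a)).re = ∑ i ∈ s, (τ (cfc (f i) a)).re := by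
  rw [cfc_sum f a s fun i _ => (hf i).continuousOn,
    hτ.map_sum_of_commute s _ (fun i _ => IsSelfAdjoint.cfc)
      (fun i _ j _ => cfc_commute_cfc _ _ _), Complex.re_sum]

variable {B : Type*} [CStarAlgebra B] [PartialOrder B] [StarOrderedRing B] {τ : B → ℂ}

/-- The shift by `2` makes up for the lack of operator monotonicity of ramps. Put `s = (i + 1) / m`.
Where the ramp of `a` is nonzero, `m (t - s) ≥ 1`; moreover `a - s ≤ b - s ≤ (b - s)₊`, and the ramp
of `b` is a unit for `(b - s)₊`. Thus `re_sq_le` applies with `z = e (b - s)₊^(1/2)` and `K = m`. -/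
theorem re_ramp_le (hτ : IsOneQuasitrace τ) {a b : B} (ha : IsSelfAdjoint a)
    (hb : IsSelfAdjoint b) (hab : a ≤ b) {m : ℝ} (hm : 0 < m) (i : ℝ) :
    (τ (cfc (fun t => ramp (m * t - (i + 2))) a)).re ≤
      (τ (cfc (fun t => ramp (m * t - i)) b)).re := by
  set s : ℝ := (i + 1) / m with hs
  set f : ℝ → ℝ := fun t => √(ramp (m * t - (i + 2))) with hf
  have hfc : Continuous f := by simp only [hf]; fun_prop
  set e := cfc f a with he
  have hesa : IsSelfAdjoint e := IsSelfAdjoint.cfc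
  set u : ℝ → ℝ := fun t => √(max (t - s) 0) with hu
  have huc : Continuous u := by simp only [hu]; fun_prop
  set w := cfc u b with hw
  have hwsa : IsSelfAdjoint w := IsSelfAdjoint.cfc
  have hee : e * e = cfc (fun t => ramp (m * t - (i + 2))) a := by
    rw [he, ← cfc_mul f f a hfc.continuousOn hfc.continuousOn]
    exact cfc_congr fun t _ => Real.mul_self_sqrt (ramp_nonneg _)
  have hww : w * w = cfc (fun t => max (t - s) 0) b := by
    rw [hw, ← cfc_mul u u b huc.continuousOn huc.continuousOn]
    exact cfc_congr fun t _ => Real.mul_self_sqrt (le_max_right _ _)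
  have he1 : ‖e‖ ≤ 1 := by
    refine norm_cfc_le zero_le_one fun t _ => ?_
    rw [Real.norm_of_nonneg (Real.sqrt_nonneg _), Real.sqrt_le_one]
    exact ramp_le_one _
  have h1 : a - algebraMap ℝ B s ≤ w * w := by
    calc a - algebraMap ℝ B s ≤ b - algebraMap ℝ B s := sub_le_sub_right hab _
      _ = cfc (fun t => t - s) b := by
          rw [cfc_id_sub_const hb]
      _ ≤ w * w := by
          rw [hww]
          exact cfc_mono fun t _ => le_max_left _ _
  have h2 : e * e ≤ m • (e * (a - algebraMap ℝ B s) * e) := by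
    have e1 : m • (e * (a - algebraMap ℝ B s) * e) = cfc (fun t => m * (f t * (t - s) * f t)) a := by
      rw [cfc_const_mul m (fun t => f t * (t - s) * f t) a
        ((hfc.mul (continuous_id.sub continuous_const)).mul hfc).continuousOn,
        cfc_mul_mul (g := fun t => t - s) hfc (by fun_prop) hfc, cfc_id_sub_const ha]
    rw [e1, hee]
    refine cfc_mono (fun t _ => ?_) (by fun_prop) (by fun_prop)
    have e2 : f t * (t - s) * f t = ramp (m * t - (i + 2)) * (t - s) := by
      rw [mul_right_comm, Real.mul_self_sqrt (ramp_nonneg _)]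
    rw [e2]
    rcases le_total (m * t - (i + 2)) 0 with h | h
    · rw [ramp_of_nonpos h]; simp
    · have h3 : 1 ≤ m * (t - s) := by
        rw [hs, mul_sub, mul_div_cancel₀ _ hm.ne']
        linarith
      calc ramp (m * t - (i + 2)) = ramp (m * t - (i + 2)) * 1 := (mul_one _).symm
        _ ≤ ramp (m * t - (i + 2)) * (m * (t - s)) := by
            gcongr; exact ramp_nonneg _
        _ = _ := by ring
  have h3 : e * (a - algebraMap ℝ B s) * e ≤ (e * w) * star (e * w) := by
    have := star_left_conjugate_le_conjugate h1 e
    rw [hesa.star_eq] at this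
    calc _ ≤ e * (w * w) * e := this
      _ = _ := by simp only [star_mul, hesa.star_eq, hwsa.star_eq, mul_assoc]
  have h4 : e * e ≤ m • ((e * w) * star (e * w)) :=
    h2.trans (smul_le_smul_of_nonneg_left h3 hm.le)
  rw [← hee]
  refine hτ.re_sq_le hesa he1 hm.le h4 (cfc_nonneg fun t _ => ramp_nonneg _) ?_
  rw [mul_assoc]
  congr 1
  rw [hw, ← cfc_mul u _ b huc.continuousOn (by fun_prop)]
  refine cfc_congr fun t _ => ?_
  simp only [hu]
  rcases le_total t s with h | h
  · rw [max_eq_right (by linarith)]; simp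
  · rw [ramp_of_one_le, mul_one]
    have : m * s ≤ m * t := by gcongr
    rw [hs, mul_div_cancel₀ _ hm.ne'] at this
    linarith

theorem re_eq_sum_ramp (hτ : IsOneQuasitrace τ) {a : B} (ha : 0 ≤ a) (ha1 : a ≤ 1) (m : ℕ)
    (hm : 0 < m) :
    m * (τ a).re = ∑ i ∈ Finset.range m, (τ (cfc (fun t : ℝ => ramp (m * t - i)) a)).re := by
  have hsa := ha.isSelfAdjoint
  rw [← hτ.re_cfc_sum _ (fun (i : ℕ) (t : ℝ) => ramp (m * t - i)) (fun i => by fun_prop)]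
  have h1 : cfc (∑ i ∈ Finset.range m, fun t : ℝ => ramp (m * t - i)) a = (m : ℝ) • a := by
    rw [← cfc_const_mul_id (m : ℝ) a]
    refine cfc_congr fun t ht => ?_
    have h0 : 0 ≤ t := spectrum_nonneg_of_nonneg ha ht
    have h1 : t ≤ 1 := (CFC.le_one_iff a hsa).1 ha1 t ht
    rw [Finset.sum_apply, sum_ramp (by positivity), min_eq_left]
    calc (m : ℝ) * t ≤ m * 1 := by gcongr
      _ = m := mul_one _
  rw [h1, hτ.map_real_smul hsa]
  simp

/-- Summing `re_ramp_le` over `m` ramps leaves out only the first two ramps of `a`, each of value at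
most `τ 1`. After division by `m` the error is `2 τ(1) / m`. -/
theorem re_le_of_le_one (hτ : IsOneQuasitrace τ) {a b : B} (ha : 0 ≤ a) (hab : a ≤ b)
    (hb1 : b ≤ 1) : (τ a).re ≤ (τ b).re := by
  have hb := ha.trans hab
  have hT : 0 ≤ (τ 1).re := hτ.re_nonneg zero_le_one
  have key : ∀ m : ℕ, 0 < m → (τ a).re ≤ (τ b).re + 2 * (τ 1).re / m := by
    intro m hm
    have hm' : (0 : ℝ) < m := by exact_mod_cast hm
    set h : ℕ → ℝ := fun i => (τ (cfc (fun t : ℝ => ramp (m * t - i)) a)).re with hh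
    set k : ℕ → ℝ := fun i => (τ (cfc (fun t : ℝ => ramp (m * t - i)) b)).re with hk
    have h0 : ∀ i, 0 ≤ h i := fun i => hτ.re_nonneg (cfc_nonneg fun t _ => ramp_nonneg _)
    have h1 : ∀ i, h i ≤ (τ 1).re := fun i => by
      refine hτ.re_le_of_commute IsSelfAdjoint.cfc (IsSelfAdjoint.one B) (Commute.one_right _) ?_
      exact cfc_le_one _ _ fun t _ => ramp_le_one _
    have h2 : ∀ i, h (i + 2) ≤ k i := fun i => by
      have := hτ.re_ramp_le ha.isSelfAdjoint hb.isSelfAdjoint hab hm' (i : ℝ)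
      simpa [hh, hk] using this
    have e1 := hτ.re_eq_sum_ramp ha (hab.trans hb1) m hm
    have e2 := hτ.re_eq_sum_ramp hb hb1 m hm
    have e3 : ∑ i ∈ Finset.range m, h i ≤ ∑ i ∈ Finset.range (m + 2), h i :=
      Finset.sum_le_sum_of_subset_of_nonneg (Finset.range_mono (by omega)) fun i _ _ => h0 i
    rw [Finset.sum_range_succ', Finset.sum_range_succ'] at e3
    have e4 : ∑ i ∈ Finset.range m, h (i + 1 + 1) ≤ ∑ i ∈ Finset.range m, k i :=
      Finset.sum_le_sum fun i _ => h2 i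
    have e5 : m * (τ a).re ≤ m * (τ b).re + 2 * (τ 1).re := by
      rw [e1, e2]
      linarith [h1 0, h1 (0 + 1)]
    rw [← sub_le_iff_le_add', le_div_iff₀ hm']
    linarith
  have hlim : Filter.Tendsto (fun m : ℕ => (τ b).re + 2 * (τ 1).re / m) Filter.atTop
      (𝓝 ((τ b).re + 0)) :=
    tendsto_const_nhds.add (tendsto_const_div_atTop_nhds_zero_nat _)
  rw [add_zero] at hlim
  exact ge_of_tendsto hlim ((Filter.eventually_gt_atTop 0).mono key)

/-- Quasitraces are monotone. -/
theorem re_mono (hτ : IsOneQuasitrace τ) {a b : B} (ha : IsSelfAdjoint a) (hb : IsSelfAdjoint b)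
    (hab : a ≤ b) : (τ a).re ≤ (τ b).re := by
  -- Adding the scalar `R` and dividing by `2 * R` moves both elements between `0` and `1`; the
  -- summand `1` keeps `R` positive.
  set R : ℝ := ‖a‖ + ‖b‖ + 1 with hR
  have hR0 : 0 < R := by positivity
  set c := algebraMap ℝ B R with hc
  have hcsa : IsSelfAdjoint c := IsSelfAdjoint.algebraMap B (IsSelfAdjoint.all R)
  have h1 : 0 ≤ a + c := by
    have := ha.neg_algebraMap_norm_le_self
    have h2 : algebraMap ℝ B ‖a‖ ≤ c := algebraMap_mono B (by rw [hR]; linarith [norm_nonneg b])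
    have h3 : -c ≤ a := (neg_le_neg h2).trans this
    simpa [add_comm] using sub_nonneg.2 h3
  have h2 : b + c ≤ (2 * R) • 1 := by
    have := hb.le_algebraMap_norm_self
    have h2 : algebraMap ℝ B ‖b‖ ≤ c := algebraMap_mono B (by rw [hR]; linarith [norm_nonneg a])
    calc b + c ≤ c + c := by gcongr; exact this.trans h2
      _ = (2 * R) • 1 := by rw [hc, ← map_add, Algebra.algebraMap_eq_smul_one, two_mul]
  have hr0 : 0 ≤ (2 * R)⁻¹ := by positivity
  have h3 := hτ.re_le_of_le_one (a := (2 * R)⁻¹ • (a + c)) (b := (2 * R)⁻¹ • (b + c))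
    (smul_nonneg hr0 h1) (smul_le_smul_of_nonneg_left (by gcongr) hr0) (by
      have := smul_le_smul_of_nonneg_left h2 hr0
      rwa [smul_smul, inv_mul_cancel₀ (by positivity), one_smul] at this)
  rw [hτ.map_real_smul (ha.add hcsa), hτ.map_real_smul (hb.add hcsa), Complex.re_ofReal_mul,
    Complex.re_ofReal_mul, hc, hτ.add_algebraMap ha, hτ.add_algebraMap hb, Complex.add_re,
    Complex.add_re] at h3
  have := le_of_mul_le_mul_left h3 (by positivity)
  linarith

theorem re_le_add_of_le (hτ : IsOneQuasitrace τ) {a b : B} (ha : IsSelfAdjoint a)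
    (hb : IsSelfAdjoint b) {r : ℝ} (h : a ≤ b + algebraMap ℝ B r) :
    (τ a).re ≤ (τ b).re + r * (τ 1).re := by
  have := hτ.re_mono ha (hb.add (IsSelfAdjoint.algebraMap B (IsSelfAdjoint.all r))) h
  rwa [hτ.add_algebraMap hb, Complex.add_re, Complex.re_ofReal_mul] at this

theorem re_one_nonneg (hτ : IsOneQuasitrace τ) : 0 ≤ (τ 1).re := hτ.re_nonneg zero_le_one

/-- Quasitraces are norm-continuous. -/
theorem abs_re_sub_le (hτ : IsOneQuasitrace τ) {a b : B} (ha : IsSelfAdjoint a)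
    (hb : IsSelfAdjoint b) : |(τ a).re - (τ b).re| ≤ ‖a - b‖ * (τ 1).re := by
  rw [abs_sub_le_iff]
  constructor
  · have := hτ.re_le_add_of_le ha hb (r := ‖a - b‖) (by
      rw [← sub_le_iff_le_add']; exact (ha.sub hb).le_algebraMap_norm_self)
    linarith
  · have := hτ.re_le_add_of_le hb ha (r := ‖a - b‖) (by
      rw [← sub_le_iff_le_add', norm_sub_rev]; exact (hb.sub ha).le_algebraMap_norm_self)
    linarith

/-- With `x = s²`, traciality turns `y⋆ s s y` into `s y y⋆ s`, which is at most `‖y‖² s²`. -/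
theorem re_conj_le (hτ : IsOneQuasitrace τ) {x : B} (hx : 0 ≤ x) (y : B) :
    (τ (star y * x * y)).re ≤ ‖y‖ ^ 2 * (τ x).re := by
  obtain ⟨s, hs, rfl⟩ := CStarAlgebra.nonneg_iff_exists_isSelfAdjoint_and_eq_mul_self.1 hx
  have e1 : star y * (s * s) * y = star (s * y) * (s * y) := by
    rw [star_mul, hs.star_eq]; simp only [mul_assoc]
  have e2 : s * y * star (s * y) = star s * (y * star y) * s := by
    rw [star_mul, hs.star_eq]; simp only [mul_assoc]
  rw [e1, hτ.tracial, e2]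
  have h1 : star s * (y * star y) * s ≤ star s * (algebraMap ℝ B (‖y‖ ^ 2)) * s :=
    star_left_conjugate_le_conjugate CStarAlgebra.mul_star_le_algebraMap_norm_sq s
  have h2 : star s * (algebraMap ℝ B (‖y‖ ^ 2)) * s = (‖y‖ ^ 2) • (s * s) := by
    rw [hs.star_eq, Algebra.algebraMap_eq_smul_one, mul_smul_comm, smul_mul_assoc, mul_one]
  rw [h2] at h1
  have hss : IsSelfAdjoint (s * s) := hx.isSelfAdjoint
  have h0 : IsSelfAdjoint (star s * (y * star y) * s) := by
    have := star_left_conjugate_nonneg (mul_star_self_nonneg y) s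
    exact this.isSelfAdjoint
  have := hτ.re_mono h0 (by rw [IsSelfAdjoint, star_smul, hss.star_eq]; simp) h1
  rwa [hτ.map_real_smul hss, Complex.re_ofReal_mul] at this

/-- A quasitrace in terms of its values on selfadjoint elements. -/
theorem eq_realPart_add (hτ : IsOneQuasitrace τ) (x : B) :
    τ x = ((τ (realPart x : B)).re : ℂ) + Complex.I * ((τ (imaginaryPart x : B)).re : ℂ) := by
  conv_lhs => rw [← realPart_add_I_smul_imaginaryPart x]
  rw [hτ.map_add_I_smul _ _ (realPart x).2 (imaginaryPart x).2, ← hτ.eq_re (realPart x).2,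
    ← hτ.eq_re (imaginaryPart x).2]

/-- Supplies the compactness needed for limits along an ultrafilter. The factor `2` comes from
estimating real and imaginary parts separately. -/
theorem norm_le (hτ : IsOneQuasitrace τ) (x : B) : ‖τ x‖ ≤ 2 * ‖x‖ * (τ 1).re := by
  have h : ∀ a : B, IsSelfAdjoint a → |(τ a).re| ≤ ‖a‖ * (τ 1).re := fun a ha => by
    have := hτ.abs_re_sub_le ha (IsSelfAdjoint.zero B)
    simpa [hτ.map_zero] using this
  have hT := hτ.re_one_nonneg
  rw [hτ.eq_realPart_add x]
  refine (norm_add_le _ _).trans ?_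
  rw [norm_mul, Complex.norm_I, one_mul, Complex.norm_real, Complex.norm_real, Real.norm_eq_abs,
    Real.norm_eq_abs]
  have h1 := h _ (realPart x).2
  have h2 := h _ (imaginaryPart x).2
  have h3 : ‖(realPart x : B)‖ ≤ ‖x‖ := realPart.norm_le x
  have h4 : ‖(imaginaryPart x : B)‖ ≤ ‖x‖ := imaginaryPart.norm_le x
  have h5 := mul_le_mul_of_nonneg_right h3 hT
  have h6 := mul_le_mul_of_nonneg_right h4 hT
  linarith

end IsOneQuasitrace

end Monotone

/-! ### Two-by-two matrices -/

namespace CStarMatrix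

section

variable {E : Type*}

/-- The two-by-two matrix with the given entries. -/
def of2 (a b c d : E) : CStarMatrix (Fin 2) (Fin 2) E := ofMatrix !![a, b; c, d]

theorem eq_of2 (x : CStarMatrix (Fin 2) (Fin 2) E) :
    x = of2 (x 0 0) (x 0 1) (x 1 0) (x 1 1) := by
  ext i j
  fin_cases i <;> fin_cases j <;> rfl

variable [CStarAlgebra E]

theorem of2_mul (a b c d a' b' c' d' : E) :
    of2 a b c d * of2 a' b' c' d' =
      of2 (a * a' + b * c') (a * b' + b * d') (c * a' + d * c') (c * b' + d * d') := by
  ext i j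
  rw [CStarMatrix.mul_apply, Fin.sum_univ_two]
  fin_cases i <;> fin_cases j <;> rfl

theorem star_of2 (a b c d : E) : star (of2 a b c d) = of2 (star a) (star c) (star b) (star d) := by
  ext i j
  rw [CStarMatrix.star_apply]
  fin_cases i <;> fin_cases j <;> rfl

theorem of2_add (a b c d a' b' c' d' : E) :
    of2 a b c d + of2 a' b' c' d' = of2 (a + a') (b + b') (c + c') (d + d') := by
  ext i j
  fin_cases i <;> fin_cases j <;> rfl

theorem of2_sub (a b c d a' b' c' d' : E) :
    of2 a b c d - of2 a' b' c' d' = of2 (a - a') (b - b') (c - c') (d - d') := by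
  ext i j
  fin_cases i <;> fin_cases j <;> rfl

theorem isSelfAdjoint_of2_left {a : E} (ha : IsSelfAdjoint a) :
    IsSelfAdjoint (of2 a 0 0 0) := by
  rw [IsSelfAdjoint, star_of2, ha.star_eq, star_zero]

theorem isSelfAdjoint_of2_right {a : E} (ha : IsSelfAdjoint a) :
    IsSelfAdjoint (of2 0 0 0 a) := by
  rw [IsSelfAdjoint, star_of2, ha.star_eq, star_zero]

end

end CStarMatrix

/-! ### Multiplicative bounds for the `2`-norm -/

namespace IsOneQuasitrace

section

variable {B : Type*} [CStarAlgebra B] [PartialOrder B] [StarOrderedRing B] {τ : B → ℂ}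

/-- The square of the `2`-norm is invariant under the involution and dominated by multiplication
on either side. -/
theorem re_star_mul_self_mul_left_le (hτ : IsOneQuasitrace τ) (a x : B) :
    (τ (star (a * x) * (a * x))).re ≤ ‖a‖ ^ 2 * (τ (star x * x)).re := by
  have h1 : star (a * x) * (a * x) ≤ ‖a‖ ^ 2 • (star x * x) := by
    have h := star_left_conjugate_le_conjugate
      (CStarAlgebra.star_mul_le_algebraMap_norm_sq (a := a)) x
    rw [Algebra.algebraMap_eq_smul_one, mul_smul_comm, smul_mul_assoc, mul_one] at h
    rw [star_mul, mul_assoc, ← mul_assoc (star a), ← mul_assoc]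
    exact h
  have hs : IsSelfAdjoint (star x * x) := IsSelfAdjoint.star_mul_self x
  have := hτ.re_mono (IsSelfAdjoint.star_mul_self _) ((IsSelfAdjoint.all (‖a‖ ^ 2)).smul hs) h1
  rwa [hτ.map_real_smul hs, Complex.re_ofReal_mul] at this

theorem re_star_mul_self_mul_right_le (hτ : IsOneQuasitrace τ) (a x : B) :
    (τ (star (x * a) * (x * a))).re ≤ ‖a‖ ^ 2 * (τ (star x * x)).re := by
  rw [hτ.tracial (x * a), hτ.tracial x]
  have := hτ.re_star_mul_self_mul_left_le (star a) (star x)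
  rwa [norm_star, ← star_mul, star_star, star_star] at this

theorem continuous_re (hτ : IsOneQuasitrace τ) {X : Type*} [TopologicalSpace X] {f : X → B}
    (hf : Continuous f) (hsa : ∀ x, IsSelfAdjoint (f x)) :
    Continuous fun x => (τ (f x)).re := by
  refine continuous_iff_continuousAt.2 fun x₀ => ?_
  refine tendsto_iff_dist_tendsto_zero.2 ?_
  refine squeeze_zero (fun _ => dist_nonneg)
    (fun x => (Real.dist_eq _ _).trans_le (hτ.abs_re_sub_le (hsa x) (hsa x₀))) ?_
  have h : Filter.Tendsto (fun x => ‖f x - f x₀‖) (𝓝 x₀) (𝓝 0) := by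
    have := tendsto_iff_norm_sub_tendsto_zero.1 (hf.tendsto x₀)
    exact this
  simpa using h.mul_const (τ 1).re

end

end IsOneQuasitrace

/-! ### Subadditivity and null elements -/

namespace IsQuasitrace

open CStarMatrix

variable {E : Type*} [CStarAlgebra E] [PartialOrder E] [StarOrderedRing E] {τ : E → ℂ}

/-- Expresses the condition on `τ₂` through the C⋆-algebra structure of the matrices, so that the
results on one-quasitraces apply to `τ₂`. -/
theorem exists_of2 (hτ : IsQuasitrace τ) :
    ∃ τ₂ : CStarMatrix (Fin 2) (Fin 2) E → ℂ,
      @IsOneQuasitrace _ NormedRing.toRing CStarAlgebra.toStarRing NormedAlgebra.toAlgebra _ τ₂ ∧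
      ∀ x : E, τ x = τ₂ (of2 x 0 0 0) :=
  hτ.exists_matrix

/-- Let `x` be the row `(s, r)` with `s² = a` and `r² = b`. Then `x x⋆ = (a + b) ⊗ e₁₁`, while `x⋆
x` has diagonal `a, b`. It is dominated by the diagonal matrix with entries `(1 + u²) a` and `(1 +
u⁻²) b`, because the difference is `y⋆ y` for the row `y = (u s, -u⁻¹ r)`. Traciality and
monotonicity of `τ₂` conclude. -/
theorem re_add_le_aux (hτ : IsQuasitrace τ) {a b : E} (ha : 0 ≤ a) (hb : 0 ≤ b) {u : ℝ}
    (hu : 0 < u) :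
    (τ (a + b)).re ≤ (1 + u ^ 2) * (τ a).re + (1 + (u ^ 2)⁻¹) * (τ b).re := by
  obtain ⟨τ₂, h₂, h⟩ := hτ.exists_of2
  obtain ⟨s, hs, hsa⟩ := CStarAlgebra.nonneg_iff_exists_isSelfAdjoint_and_eq_mul_self.1 ha
  obtain ⟨r, hr, hrb⟩ := CStarAlgebra.nonneg_iff_exists_isSelfAdjoint_and_eq_mul_self.1 hb
  have hs' := hs.star_eq
  have hr' := hr.star_eq
  have h0 : star (0 : E) = 0 := star_zero E
  have e1 : of2 s r 0 0 * star (of2 s r 0 0) = of2 (a + b) 0 0 0 := by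
    rw [star_of2, of2_mul, hs', hr', h0, hsa, hrb]
    simp
  have e2 : star (of2 s r 0 0) * of2 s r 0 0 = of2 a (s * r) (r * s) b := by
    rw [star_of2, of2_mul, hs', hr', h0, hsa, hrb]
    simp
  have e3 : of2 ((1 + u ^ 2) • a) 0 0 ((1 + (u ^ 2)⁻¹) • b) - of2 a (s * r) (r * s) b =
      star (of2 (u • s) (-(u⁻¹ • r)) 0 0) * of2 (u • s) (-(u⁻¹ • r)) 0 0 := by
    rw [star_of2, of2_mul, of2_sub, star_neg, star_smul, star_smul, hs', hr', h0, hsa, hrb,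
      star_trivial, star_trivial]
    have hu1 : u * u⁻¹ = 1 := mul_inv_cancel₀ hu.ne'
    have hu2 : u⁻¹ * u = 1 := inv_mul_cancel₀ hu.ne'
    congr 1
    · rw [smul_mul_smul_comm, add_smul, one_smul, ← sq u]; simp
    · rw [mul_neg, smul_mul_smul_comm, hu1]; simp
    · rw [neg_mul, smul_mul_smul_comm, hu2]; simp
    · rw [neg_mul_neg, smul_mul_smul_comm, add_smul, one_smul, ← sq u⁻¹, inv_pow]; simp
  have e4 : of2 ((1 + u ^ 2) • a) 0 0 ((1 + (u ^ 2)⁻¹) • b) =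
      of2 ((1 + u ^ 2) • a) 0 0 0 + of2 0 0 0 ((1 + (u ^ 2)⁻¹) • b) := by
    rw [of2_add]; simp
  have ha1 : IsSelfAdjoint ((1 + u ^ 2) • a) := (IsSelfAdjoint.all _).smul ha.isSelfAdjoint
  have hb1 : 0 ≤ (1 + (u ^ 2)⁻¹) • b := smul_nonneg (by positivity) hb
  -- Traciality at `r ⊗ e₁₂` identifies the values on the two diagonal corners.
  have h5 : ∀ b : E, 0 ≤ b → τ₂ (of2 0 0 0 b) = τ b := fun b hb => by
    obtain ⟨r, hr, hrb⟩ := CStarAlgebra.nonneg_iff_exists_isSelfAdjoint_and_eq_mul_self.1 hb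
    have hr' := hr.star_eq
    have e6 : star (of2 0 r 0 0) * of2 0 r 0 0 = of2 0 0 0 b := by
      rw [star_of2, of2_mul, hr', h0, hrb]; simp
    have e7 : of2 0 r 0 0 * star (of2 0 r 0 0) = of2 b 0 0 0 := by
      rw [star_of2, of2_mul, hr', h0, hrb]; simp
    rw [← e6, h₂.tracial, e7, h]
  have h6 : (τ₂ (star (of2 s r 0 0) * of2 s r 0 0)).re ≤
      (τ₂ (of2 ((1 + u ^ 2) • a) 0 0 0 + of2 0 0 0 ((1 + (u ^ 2)⁻¹) • b))).re := by
    refine h₂.re_mono (IsSelfAdjoint.star_mul_self _)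
      ((isSelfAdjoint_of2_left ha1).add (isSelfAdjoint_of2_right hb1.isSelfAdjoint)) ?_
    rw [← sub_nonneg, ← e4, e2, e3]
    exact star_mul_self_nonneg _
  rw [h₂.tracial, e1, ← h, h₂.add_of_commute (isSelfAdjoint_of2_left ha1)
    (isSelfAdjoint_of2_right hb1.isSelfAdjoint) (by
      rw [commute_iff_eq, of2_mul, of2_mul]; simp), ← h, h5 _ hb1,
    hτ.map_real_smul ha.isSelfAdjoint, hτ.map_real_smul hb.isSelfAdjoint, Complex.add_re,
    Complex.re_ofReal_mul, Complex.re_ofReal_mul] at h6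
  exact h6

/-- Weighted subadditivity of a quasitrace on positive elements. -/
theorem re_add_le (hτ : IsQuasitrace τ) {a b : E} (ha : 0 ≤ a) (hb : 0 ≤ b) {t : ℝ}
    (ht : 0 < t) :
    (τ (a + b)).re ≤ (1 + t) * (τ a).re + (1 + t⁻¹) * (τ b).re := by
  have := hτ.re_add_le_aux ha hb (Real.sqrt_pos.2 ht)
  rwa [Real.sq_sqrt ht.le] at this

/-- The parallelogram identity gives one factor `2`, subadditivity with weight `t = 1` the other. -/
theorem re_star_mul_self_add_le (hτ : IsQuasitrace τ) (x y : E) :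
    (τ (star (x + y) * (x + y))).re ≤
      4 * ((τ (star x * x)).re + (τ (star y * y)).re) := by
  have h1 : star (x + y) * (x + y) ≤ (2 : ℝ) • (star x * x + star y * y) := by
    rw [← sub_nonneg]
    have : (2 : ℝ) • (star x * x + star y * y) - star (x + y) * (x + y) =
        star (x - y) * (x - y) := by
      rw [two_smul, star_add, star_sub]; noncomm_ring
    rw [this]
    exact star_mul_self_nonneg _
  have hs : IsSelfAdjoint (star x * x + star y * y) :=
    (IsSelfAdjoint.star_mul_self x).add (IsSelfAdjoint.star_mul_self y)
  have h2 := hτ.re_mono (IsSelfAdjoint.star_mul_self _) ((IsSelfAdjoint.all (2 : ℝ)).smul hs) h1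
  rw [hτ.map_real_smul hs, Complex.re_ofReal_mul] at h2
  have h3 := hτ.re_add_le (star_mul_self_nonneg x) (star_mul_self_nonneg y) one_pos
  norm_num at h3
  linarith

/-- The elements of `2`-norm zero form an ideal. -/
def nullIdeal (hτ : IsQuasitrace τ) : Ideal E where
  carrier := {x | (τ (star x * x)).re = 0}
  zero_mem' := by simp [hτ.map_zero]
  add_mem' {x y} hx hy := by
    refine le_antisymm ?_ (hτ.re_star_mul_self_nonneg _)
    have := hτ.re_star_mul_self_add_le x y
    rw [hx, hy] at this
    simpa using this
  smul_mem' a x hx := by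
    refine le_antisymm ?_ (hτ.re_star_mul_self_nonneg _)
    have := hτ.re_star_mul_self_mul_left_le a x
    rw [hx] at this
    simpa using this

theorem mem_nullIdeal (hτ : IsQuasitrace τ) {x : E} :
    x ∈ hτ.nullIdeal ↔ (τ (star x * x)).re = 0 := Iff.rfl

theorem isTwoSided_nullIdeal (hτ : IsQuasitrace τ) : hτ.nullIdeal.IsTwoSided where
  mul_mem_of_left {x} a hx := by
    rw [mem_nullIdeal] at hx ⊢
    refine le_antisymm ?_ (hτ.re_star_mul_self_nonneg _)
    have := hτ.re_star_mul_self_mul_right_le a x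
    rw [hx] at this
    simpa using this

theorem isClosed_nullIdeal (hτ : IsQuasitrace τ) : IsClosed (hτ.nullIdeal : Set E) := by
  have h : Continuous fun x : E => (τ (star x * x)).re :=
    hτ.continuous_re (by fun_prop) fun x => IsSelfAdjoint.star_mul_self x
  exact isClosed_singleton.preimage h

/-- A quasitrace does not increase under selfadjoint perturbations of `2`-norm zero. -/
theorem re_le_of_null (hτ : IsQuasitrace τ) {x y : E} (hx : IsSelfAdjoint x)
    (hy : IsSelfAdjoint y) (h : (τ (star (x - y) * (x - y))).re = 0) :
    (τ x).re ≤ (τ y).re := by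
  have hT := hτ.re_one_nonneg
  set c := x - y with hc
  have hcsa : IsSelfAdjoint c := hx.sub hy
  set l : ℝ := ‖x‖ + ‖y‖ with hl
  have hyl : 0 ≤ y + algebraMap ℝ E l := by
    have h1 := hy.neg_algebraMap_norm_le_self
    have h2 : algebraMap ℝ E ‖y‖ ≤ algebraMap ℝ E l :=
      algebraMap_mono E (by rw [hl]; linarith [norm_nonneg x])
    have h3 := (neg_le_neg h2).trans h1
    simpa [add_comm] using sub_nonneg.2 h3
  -- The scalar `l` makes `y + l` positive, as weighted subadditivity requires; it cancels when `t →
  -- 0`.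
  have key : ∀ t : ℝ, 0 < t → (τ x).re + l * (τ 1).re ≤
      (1 + t) * ((τ y).re + (l + t) * (τ 1).re) := by
    intro t ht
    -- This is `(2t - s)² ≥ 0`. It trades `c` for a small scalar and a multiple of the null element
    -- `c⋆c`.
    have h1 : c ≤ algebraMap ℝ E t + (4 * t)⁻¹ • (star c * c) := by
      have h2 : cfc (fun s : ℝ => s) c ≤ cfc (fun s : ℝ => t + (4 * t)⁻¹ * (s * s)) c := by
        refine cfc_mono (fun s _ => ?_) (by fun_prop) (by fun_prop)
        have : t + (4 * t)⁻¹ * (s * s) - s = (4 * t)⁻¹ * (2 * t - s) ^ 2 := by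
          field_simp; ring
        have h3 : 0 ≤ (4 * t)⁻¹ * (2 * t - s) ^ 2 := by positivity
        linarith
      rw [cfc_id' ℝ c, cfc_const_add t _ c (by fun_prop),
        cfc_const_mul (4 * t)⁻¹ (fun s : ℝ => s * s) c (by fun_prop),
        cfc_mul (fun s : ℝ => s) (fun s : ℝ => s) c (by fun_prop) (by fun_prop),
        cfc_id' ℝ c] at h2
      rwa [hcsa.star_eq]
    have hq0 : 0 ≤ (4 * t)⁻¹ • (star c * c) :=
      smul_nonneg (by positivity) (star_mul_self_nonneg c)
    have hyt : 0 ≤ y + algebraMap ℝ E (l + t) := by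
      rw [map_add, ← add_assoc]
      exact add_nonneg hyl (algebraMap_nonneg E ht.le)
    have h2 : x + algebraMap ℝ E l ≤ (y + algebraMap ℝ E (l + t)) + (4 * t)⁻¹ • (star c * c) := by
      have : x = y + c := by rw [hc]; abel
      calc x + algebraMap ℝ E l = y + algebraMap ℝ E l + c := by rw [this]; abel
        _ ≤ y + algebraMap ℝ E l + (algebraMap ℝ E t + (4 * t)⁻¹ • (star c * c)) := by gcongr
        _ = _ := by rw [map_add (algebraMap ℝ E) l t]; abel
    have h3 := hτ.re_mono (hx.add (IsSelfAdjoint.algebraMap E (IsSelfAdjoint.all l)))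
      (hyt.isSelfAdjoint.add hq0.isSelfAdjoint) h2
    have h4 := hτ.re_add_le hyt hq0 ht
    rw [hτ.map_real_smul (IsSelfAdjoint.star_mul_self c), Complex.re_ofReal_mul, h,
      hτ.add_algebraMap hy, Complex.add_re, Complex.re_ofReal_mul] at h4
    rw [hτ.add_algebraMap hx, Complex.add_re, Complex.re_ofReal_mul] at h3
    linarith
  have hlim : Filter.Tendsto (fun t : ℝ => (1 + t) * ((τ y).re + (l + t) * (τ 1).re)) (𝓝[>] 0)
      (𝓝 ((1 + 0) * ((τ y).re + (l + 0) * (τ 1).re))) :=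
    (Continuous.tendsto (by fun_prop) 0).mono_left nhdsWithin_le_nhds
  have := ge_of_tendsto hlim (Filter.eventually_of_mem self_mem_nhdsWithin key)
  simp only [add_zero, one_mul] at this
  linarith

/-- A closed two-sided ideal is selfadjoint, so the real and imaginary parts of `x - y` are null
too, and `re_le_of_null` applies to them in both directions. -/
theorem eq_of_null (hτ : IsQuasitrace τ) {x y : E} (h : x - y ∈ hτ.nullIdeal) : τ x = τ y := by
  have := hτ.isTwoSided_nullIdeal
  have := hτ.isClosed_nullIdeal
  have key : ∀ x y : E, IsSelfAdjoint x → IsSelfAdjoint y → x - y ∈ hτ.nullIdeal →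
      (τ x).re = (τ y).re := fun x y hx hy h =>
    le_antisymm (hτ.re_le_of_null hx hy h)
      (hτ.re_le_of_null hy hx (by rw [← neg_sub]; exact neg_mem h))
  have hs : star (x - y) ∈ hτ.nullIdeal := CStarQuotient.star_mem _ h
  have hC : ∀ (r : ℂ) (z : E), z ∈ hτ.nullIdeal → r • z ∈ hτ.nullIdeal := fun r z hz => by
    rw [← one_mul z, ← smul_mul_assoc]
    exact hτ.nullIdeal.mul_mem_left _ hz
  rw [hτ.eq_realPart_add x, hτ.eq_realPart_add y,
    key _ _ (realPart x).2 (realPart y).2 ?_, key _ _ (imaginaryPart x).2 (imaginaryPart y).2 ?_]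
  · rw [← AddSubgroupClass.coe_sub, ← map_sub, imaginaryPart_apply_coe]
    refine hC _ _ ?_
    rw [← Complex.coe_smul]
    exact hC _ _ (sub_mem h hs)
  · rw [← AddSubgroupClass.coe_sub, ← map_sub, realPart_apply_coe, ← Complex.coe_smul]
    exact hC _ _ (add_mem h hs)

theorem norm_of2_le_one_of_star_mul_self {u : CStarMatrix (Fin 2) (Fin 2) E}
    (h : IsStarProjection (star u * u)) : ‖u‖ ≤ 1 := by
  have h1 := h.norm_le
  rw [CStarRing.norm_star_mul_self] at h1
  nlinarith [norm_nonneg u]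

/-- The `2`-norm of an entry is dominated by the `2`-norm of the matrix. -/
theorem re_entry_le {τ₂ : CStarMatrix (Fin 2) (Fin 2) E → ℂ}
    (h₂ : @IsOneQuasitrace _ NormedRing.toRing CStarAlgebra.toStarRing NormedAlgebra.toAlgebra _ τ₂)
    (h : ∀ x : E, τ x = τ₂ (of2 x 0 0 0)) (x : CStarMatrix (Fin 2) (Fin 2) E) (i j : Fin 2) :
    (τ (star (x i j) * x i j)).re ≤ (τ₂ (star x * x)).re := by
  -- Matrix units `u = e₁ᵢ` and `v = eⱼ₁` are contractions that move the entry to the upper left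
  -- corner.
  have key : ∀ u v : CStarMatrix (Fin 2) (Fin 2) E, ‖u‖ ≤ 1 → ‖v‖ ≤ 1 →
      u * x * v = of2 (x i j) 0 0 0 → (τ (star (x i j) * x i j)).re ≤ (τ₂ (star x * x)).re := by
    intro u v hu hv huv
    have e1 : τ (star (x i j) * x i j) = τ₂ (star (u * x * v) * (u * x * v)) := by
      rw [huv, h, star_of2, of2_mul]; simp
    rw [e1]
    have h0 := h₂.re_star_mul_self_nonneg x
    calc _ ≤ ‖v‖ ^ 2 * (τ₂ (star (u * x) * (u * x))).re := h₂.re_star_mul_self_mul_right_le v _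
      _ ≤ ‖v‖ ^ 2 * (‖u‖ ^ 2 * (τ₂ (star x * x)).re) := by
          gcongr; exact h₂.re_star_mul_self_mul_left_le u x
      _ ≤ 1 ^ 2 * (1 ^ 2 * (τ₂ (star x * x)).re) := by gcongr
      _ = _ := by ring
  have n1 : ‖(of2 1 0 0 0 : CStarMatrix (Fin 2) (Fin 2) E)‖ ≤ 1 := by
    refine norm_of2_le_one_of_star_mul_self ⟨?_, IsSelfAdjoint.star_mul_self _⟩
    rw [IsIdempotentElem, star_of2, of2_mul, of2_mul]; simp
  have n2 : ‖(of2 0 1 0 0 : CStarMatrix (Fin 2) (Fin 2) E)‖ ≤ 1 := by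
    refine norm_of2_le_one_of_star_mul_self ⟨?_, IsSelfAdjoint.star_mul_self _⟩
    rw [IsIdempotentElem, star_of2, of2_mul, of2_mul]; simp
  have n3 : ‖(of2 0 0 1 0 : CStarMatrix (Fin 2) (Fin 2) E)‖ ≤ 1 := by
    refine norm_of2_le_one_of_star_mul_self ⟨?_, IsSelfAdjoint.star_mul_self _⟩
    rw [IsIdempotentElem, star_of2, of2_mul, of2_mul]; simp
  obtain ⟨a, b, c, d, rfl⟩ : ∃ a b c d, x = of2 a b c d := ⟨_, _, _, _, eq_of2 x⟩
  fin_cases i <;> fin_cases j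
  · refine key _ _ n1 n1 ?_
    change _ = of2 a 0 0 0
    rw [of2_mul, of2_mul]; simp
  · refine key _ _ n1 n3 ?_
    change _ = of2 b 0 0 0
    rw [of2_mul, of2_mul]; simp
  · refine key _ _ n2 n1 ?_
    change _ = of2 c 0 0 0
    rw [of2_mul, of2_mul]; simp
  · refine key _ _ n2 n3 ?_
    change _ = of2 d 0 0 0
    rw [of2_mul, of2_mul]; simp

end IsQuasitrace

/-! ### Quasitraces on the positive cone and their push-forward along quotient maps -/

/-- A quasitrace on the positive cone of a C⋆-algebra, in the weak form in which linearity is only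
required on orthogonal pairs of elements; `T` is a bound for the value at the unit. -/
structure IsPositiveQuasitrace {Q : Type*} [CStarAlgebra Q] [PartialOrder Q] (σ : Q → ℝ) (T : ℝ) :
    Prop where
  nonneg : ∀ a : Q, 0 ≤ a → 0 ≤ σ a
  mono : ∀ a b : Q, 0 ≤ a → a ≤ b → σ a ≤ σ b
  smul : ∀ (r : ℝ) (a : Q), 0 ≤ r → 0 ≤ a → σ (r • a) = r * σ a
  tracial : ∀ x : Q, σ (star x * x) = σ (x * star x)
  add_of_mul_eq_zero : ∀ a b : Q, 0 ≤ a → 0 ≤ b → a * b = 0 → σ (a + b) = σ a + σ b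
  add_algebraMap_le : ∀ (a : Q) (r : ℝ), 0 ≤ a → 0 ≤ r → σ (a + algebraMap ℝ Q r) ≤ σ a + r * T
  bound_nonneg : 0 ≤ T

section

variable {Q : Type*} [CStarAlgebra Q] [PartialOrder Q] [StarOrderedRing Q]

/-- Orthogonal positive elements are the positive and negative parts of their difference. An
orthogonal pair is thus handled through functions of one selfadjoint element, which is easily
lifted. -/
theorem cfc_max_sub_of_mul_eq_zero {a b : Q} (ha : 0 ≤ a) (hb : 0 ≤ b) (hab : a * b = 0) :
    cfc (fun t : ℝ => max t 0) (a - b) = a ∧ cfc (fun t : ℝ => max (-t) 0) (a - b) = b := by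
  obtain ⟨h1, h2⟩ := CFC.posPart_negPart_unique (rfl : a - b = a - b) hab ha hb
  rw [CFC.posPart_def, cfcₙ_eq_cfc] at h1
  rw [CFC.negPart_def, cfcₙ_eq_cfc] at h2
  refine ⟨Eq.trans (cfc_congr fun t _ => ?_) h1, Eq.trans (cfc_congr fun t _ => ?_) h2⟩
  · exact (posPart_def t).symm
  · exact (negPart_def t).symm

/-- Where `p ≥ δ` the ramp equals `1` and nothing is lost; elsewhere the left side is at most `δ`.
-/
theorem le_conj_cfc_ramp (c : Q) {δ : ℝ} (hδ : 0 < δ) {p : ℝ → ℝ} (hp : Continuous p) :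
    cfc (fun t : ℝ => max (p t) 0) c ≤ cfc (fun t => ramp (p t / δ)) c *
      cfc (fun t : ℝ => max (p t) 0) c * cfc (fun t => ramp (p t / δ)) c
        + algebraMap ℝ Q δ := by
  by_cases hc : IsSelfAdjoint c
  · rw [← cfc_mul_mul (f := fun t => ramp (p t / δ)) (g := fun t => max (p t) 0)
      (h := fun t => ramp (p t / δ)) (by fun_prop) (by fun_prop) (by fun_prop), add_comm,
      ← cfc_const_add δ _ c (by fun_prop)]
    refine cfc_mono (fun t _ => ?_) (by fun_prop) (by fun_prop)
    have h0 := ramp_nonneg (p t / δ)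
    rcases le_total δ (p t) with h | h
    · rw [ramp_of_one_le ((one_le_div hδ).2 h)]
      linarith
    · have h1 : max (p t) 0 ≤ δ := max_le h hδ.le
      have h2 : 0 ≤ ramp (p t / δ) * max (p t) 0 * ramp (p t / δ) := by positivity
      linarith
  -- If `c` is not selfadjoint, the functional calculus takes its default value `0`.
  · simp only [cfc_apply_of_not_predicate c hc, zero_mul, zero_add]
    exact algebraMap_nonneg Q hδ.le

theorem le_algebraMap_of_norm_le {a : Q} (ha : IsSelfAdjoint a) {r : ℝ} (h : ‖a‖ ≤ r) :
    a ≤ algebraMap ℝ Q r :=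
  ha.le_algebraMap_norm_self.trans (algebraMap_mono Q h)

end

section StarAlgHom

variable {E Q : Type*} [CStarAlgebra E] [CStarAlgebra Q]

theorem StarAlgHom.continuous_of_cstarAlgebra (π : E →⋆ₐ[ℂ] Q) : Continuous π :=
  AddMonoidHomClass.continuous_of_bound π 1 fun x => by
    simpa using NonUnitalStarAlgHom.norm_apply_le π x

theorem StarAlgHom.map_cfc_real (π : E →⋆ₐ[ℂ] Q) {a : E} (ha : IsSelfAdjoint a) {f : ℝ → ℝ}
    (hf : Continuous f) : π (cfc f a) = cfc f (π a) :=
  π.map_cfc f a hf.continuousOn π.continuous_of_cstarAlgebra ha (ha.map π)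

/-- A cutoff which is trivial in the quotient. -/
theorem exists_cutoff_of_map_eq_zero (π : E →⋆ₐ[ℂ] Q) {i : E} (hi : π i = 0) {ε : ℝ}
    (hε : 0 < ε) :
    ∃ f : E, star f = f ∧ ‖f‖ ≤ 1 ∧ ‖i * f‖ ≤ ε ∧ π f = 1 ∧ ∀ w, i * w = 0 → f * w = w := by
  obtain ⟨f, c, h1, h2, h3, h4⟩ := CStarQuotient.exists_cutoff i hε
  refine ⟨f, h1, h2, h3, ?_, fun w hw => ?_⟩
  · have := congrArg π h4
    rw [map_sub, map_mul, hi, mul_zero, map_one, sub_eq_zero] at this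
    exact this.symm
  · have := congrArg (· * w) h4
    simp only [sub_mul, one_mul, mul_assoc, hw, mul_zero] at this
    exact (sub_eq_zero.1 this).symm

theorem StarAlgHom.exists_selfAdjoint_lift (π : E →⋆ₐ[ℂ] Q) (hπ : Function.Surjective π) {a : Q}
    (ha : IsSelfAdjoint a) : ∃ h : E, IsSelfAdjoint h ∧ π h = a := by
  obtain ⟨x, hx⟩ := hπ a
  refine ⟨(realPart x : E), (realPart x).2, ?_⟩
  have h1 : ((2⁻¹ : ℝ) • (x + star x) : E) = (2⁻¹ : ℂ) • (x + star x) := by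
    rw [← Complex.coe_smul]; simp
  rw [realPart_apply_coe, h1, map_smul, map_add, map_star, hx, ha.star_eq, ← two_smul ℂ a, smul_smul]
  norm_num

end StarAlgHom

/-! ### Order and trace properties of the push-forward -/

section PushForward

variable {E Q : Type*} [CStarAlgebra E] [PartialOrder E]

/-- The push-forward of a quasitrace to a quotient: the infimum over all positive lifts. -/
noncomputable def infLift [CStarAlgebra Q] (π : E →⋆ₐ[ℂ] Q) (τ : E → ℂ) (a : Q) : ℝ :=
  sInf {r : ℝ | ∃ h : E, 0 ≤ h ∧ π h = a ∧ (τ h).re = r}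

variable [StarOrderedRing E] [CStarAlgebra Q] {π : E →⋆ₐ[ℂ] Q} {τ : E → ℂ}

theorem infLift_le (hτ : IsOneQuasitrace τ) {h : E} (hh : 0 ≤ h) :
    infLift π τ (π h) ≤ (τ h).re :=
  csInf_le ⟨0, by rintro r ⟨h, hh, -, rfl⟩; exact hτ.re_nonneg hh⟩ ⟨h, hh, rfl, rfl⟩

theorem infLift_nonneg (hτ : IsOneQuasitrace τ) (a : Q) : 0 ≤ infLift π τ a :=
  Real.sInf_nonneg fun _ ⟨_, hh, _, hr⟩ => hr ▸ hτ.re_nonneg hh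

variable [PartialOrder Q] [StarOrderedRing Q]

theorem exists_nonneg_lift (hπ : Function.Surjective π) {a : Q} (ha : 0 ≤ a) :
    ∃ h : E, 0 ≤ h ∧ π h = a := by
  obtain ⟨y, rfl⟩ := CStarAlgebra.nonneg_iff_eq_star_mul_self.1 ha
  obtain ⟨x, rfl⟩ := hπ y
  exact ⟨star x * x, star_mul_self_nonneg x, by rw [map_mul, map_star]⟩

theorem exists_lift_lt (hπ : Function.Surjective π) {a : Q} (ha : 0 ≤ a) {ε : ℝ} (hε : 0 < ε) :
    ∃ h : E, 0 ≤ h ∧ π h = a ∧ (τ h).re < infLift π τ a + ε := by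
  obtain ⟨h, hh, hha⟩ := exists_nonneg_lift hπ ha
  obtain ⟨r, ⟨h, h1, h2, rfl⟩, h3⟩ := Real.lt_sInf_add_pos
    (s := {r : ℝ | ∃ h : E, 0 ≤ h ∧ π h = a ∧ (τ h).re = r}) ⟨_, h, hh, hha, rfl⟩ hε
  exact ⟨h, h1, h2, h3⟩

/-- A lift `h` of `b` need not dominate a lift `k` of `a`, but the excess `j = (k - h)₊` lies in the
kernel. A cutoff `f` over `1` makes `j f` small, and `f k f` is still a lift of `a`, now below `f h
f + δ`. -/
theorem infLift_mono (hτ : IsOneQuasitrace τ) (hπ : Function.Surjective π) {a b : Q}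
    (ha : 0 ≤ a) (hab : a ≤ b) : infLift π τ a ≤ infLift π τ b := by
  have hT := hτ.re_one_nonneg
  refine le_of_forall_pos_le_add fun ε hε => ?_
  obtain ⟨h, hh, rfl, hlt⟩ := exists_lift_lt (τ := τ) hπ (ha.trans hab) (half_pos hε)
  obtain ⟨k, hk, rfl⟩ := exists_nonneg_lift hπ ha
  -- Chosen so that `δ τ(1) ≤ ε / 2`; the summand `1` covers the case `τ 1 = 0`.
  set δ : ℝ := ε / 2 / ((τ 1).re + 1) with hδ
  have hδ0 : 0 < δ := by positivity
  have hδT : δ * (τ 1).re ≤ ε / 2 := by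
    rw [hδ, div_mul_eq_mul_div, div_le_iff₀ (by positivity)]
    nlinarith
  have hsa : IsSelfAdjoint (k - h) := hk.isSelfAdjoint.sub hh.isSelfAdjoint
  set j := cfc (fun t : ℝ => max t 0) (k - h) with hj
  have hj0 : 0 ≤ j := cfc_nonneg fun t _ => le_max_right _ _
  have hπj : π j = 0 := by
    rw [hj, π.map_cfc_real hsa (by fun_prop), ← cfc_const_zero ℝ (π (k - h))]
    refine cfc_congr fun t ht => ?_
    have h1 : 0 ≤ -(π (k - h)) := by rw [map_sub, neg_sub]; exact sub_nonneg.2 hab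
    have h2 : -t ∈ spectrum ℝ (-(π (k - h))) := by
      rw [← spectrum.neg_eq]; simpa using ht
    have h3 := spectrum_nonneg_of_nonneg h1 h2
    exact max_eq_right (by linarith)
  have hkj : k ≤ h + j := by
    rw [← sub_le_iff_le_add']
    calc k - h = cfc (fun t : ℝ => t) (k - h) := (cfc_id' ℝ _).symm
      _ ≤ j := cfc_mono (fun t _ => le_max_left _ _) (by fun_prop) (by fun_prop)
  obtain ⟨f, hf, hf1, hjf, hπf, -⟩ := exists_cutoff_of_map_eq_zero π hπj hδ0
  have h1 : star f * k * f ≤ star f * h * f + algebraMap ℝ E δ := by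
    have h2 := star_left_conjugate_le_conjugate hkj f
    have h3 : star f * j * f ≤ algebraMap ℝ E δ := by
      refine le_algebraMap_of_norm_le (star_left_conjugate_nonneg hj0 f).isSelfAdjoint ?_
      rw [mul_assoc]
      calc ‖star f * (j * f)‖ ≤ ‖star f‖ * ‖j * f‖ := norm_mul_le _ _
        _ ≤ 1 * δ := by rw [norm_star]; gcongr
        _ = δ := one_mul δ
    calc _ ≤ _ := h2
      _ = star f * h * f + star f * j * f := by rw [mul_add, add_mul]
      _ ≤ _ := by gcongr
  have h2 : π (star f * k * f) = π k := by
    rw [map_mul, map_mul, map_star, hπf, star_one, one_mul, mul_one]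
  calc infLift π τ (π k) = infLift π τ (π (star f * k * f)) := by rw [h2]
    _ ≤ (τ (star f * k * f)).re := infLift_le hτ (star_left_conjugate_nonneg hk f)
    _ ≤ (τ (star f * h * f)).re + δ * (τ 1).re :=
        hτ.re_le_add_of_le (star_left_conjugate_nonneg hk f).isSelfAdjoint
          (star_left_conjugate_nonneg hh f).isSelfAdjoint h1
    _ ≤ ‖f‖ ^ 2 * (τ h).re + ε / 2 := add_le_add (hτ.re_conj_le hh f) hδT
    _ ≤ 1 ^ 2 * (τ h).re + ε / 2 := by have := hτ.re_nonneg hh; gcongr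
    _ ≤ infLift π τ (π h) + ε := by linarith

theorem infLift_add_algebraMap_le (hτ : IsOneQuasitrace τ) (hπ : Function.Surjective π) {a : Q}
    (ha : 0 ≤ a) {r : ℝ} (hr : 0 ≤ r) :
    infLift π τ (a + algebraMap ℝ Q r) ≤ infLift π τ a + r * (τ 1).re := by
  refine le_of_forall_pos_le_add fun ε hε => ?_
  obtain ⟨h, hh, rfl, hlt⟩ := exists_lift_lt (τ := τ) hπ ha hε
  have h1 : π (h + algebraMap ℝ E r) = π h + algebraMap ℝ Q r := by
    rw [map_add, Algebra.algebraMap_eq_smul_one, Algebra.algebraMap_eq_smul_one, ← Complex.coe_smul,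
      ← Complex.coe_smul, map_smul, map_one]
  have h2 := infLift_le (π := π) hτ (add_nonneg hh (algebraMap_nonneg E hr))
  rw [h1, hτ.add_algebraMap hh.isSelfAdjoint, Complex.add_re, Complex.re_ofReal_mul] at h2
  linarith

/-- For lifts `z` of `x` and `h` of `x⋆x`, the element `z⋆z - h` lies in the kernel. A cutoff `f`
gives a lift `z f` of `x` with `(z f)⋆(z f) ≤ f h f + δ`, to which traciality upstairs applies. -/
theorem infLift_tracial_le (hτ : IsOneQuasitrace τ) (hπ : Function.Surjective π) (x : Q) :
    infLift π τ (x * star x) ≤ infLift π τ (star x * x) := by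
  have hT := hτ.re_one_nonneg
  refine le_of_forall_pos_le_add fun ε hε => ?_
  obtain ⟨h, hh, hha, hlt⟩ := exists_lift_lt (τ := τ) hπ (star_mul_self_nonneg x) (half_pos hε)
  obtain ⟨z, rfl⟩ := hπ x
  set δ : ℝ := ε / 2 / ((τ 1).re + 1) with hδ
  have hδ0 : 0 < δ := by positivity
  have hδT : δ * (τ 1).re ≤ ε / 2 := by
    rw [hδ, div_mul_eq_mul_div, div_le_iff₀ (by positivity)]
    nlinarith
  have hk : π (star z * z - h) = 0 := by rw [map_sub, map_mul, map_star, hha, sub_self]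
  obtain ⟨f, hf, hf1, hjf, hπf, -⟩ := exists_cutoff_of_map_eq_zero π hk hδ0
  have hsa : IsSelfAdjoint (star z * z - h) := (IsSelfAdjoint.star_mul_self z).sub hh.isSelfAdjoint
  have h1 : star (z * f) * (z * f) ≤ star f * h * f + algebraMap ℝ E δ := by
    have h3 : star f * (star z * z - h) * f ≤ algebraMap ℝ E δ := by
      refine le_algebraMap_of_norm_le (hsa.conjugate' f) ?_
      rw [mul_assoc]
      calc ‖star f * ((star z * z - h) * f)‖ ≤ ‖star f‖ * ‖(star z * z - h) * f‖ := norm_mul_le _ _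
        _ ≤ 1 * δ := by rw [norm_star]; gcongr
        _ = δ := one_mul δ
    calc star (z * f) * (z * f) = star f * h * f + star f * (star z * z - h) * f := by
          rw [star_mul]; noncomm_ring
      _ ≤ _ := by gcongr
  have h2 : π (z * f * star (z * f)) = π z * star (π z) := by
    rw [map_mul, map_star, map_mul, hπf, mul_one]
  calc infLift π τ (π z * star (π z)) = infLift π τ (π (z * f * star (z * f))) := by rw [h2]
    _ ≤ (τ (z * f * star (z * f))).re := infLift_le hτ (mul_star_self_nonneg _)
    _ = (τ (star (z * f) * (z * f))).re := by rw [hτ.tracial]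
    _ ≤ (τ (star f * h * f)).re + δ * (τ 1).re :=
        hτ.re_le_add_of_le (IsSelfAdjoint.star_mul_self _)
          (star_left_conjugate_nonneg hh f).isSelfAdjoint h1
    _ ≤ ‖f‖ ^ 2 * (τ h).re + ε / 2 := add_le_add (hτ.re_conj_le hh f) hδT
    _ ≤ 1 ^ 2 * (τ h).re + ε / 2 := by have := hτ.re_nonneg hh; gcongr
    _ ≤ infLift π τ (star (π z) * π z) + ε := by linarith

theorem infLift_smul_le (hτ : IsOneQuasitrace τ) (hπ : Function.Surjective π) {a : Q}
    (ha : 0 ≤ a) {r : ℝ} (hr : 0 ≤ r) : infLift π τ (r • a) ≤ r * infLift π τ a := by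
  refine le_of_forall_pos_le_add fun ε hε => ?_
  obtain ⟨h, hh, rfl, hlt⟩ := exists_lift_lt (τ := τ) hπ ha (ε := ε / (r + 1)) (by positivity)
  have h1 : π (r • h) = r • π h := by
    rw [← Complex.coe_smul, ← Complex.coe_smul, map_smul]
  have h2 := infLift_le (π := π) hτ (smul_nonneg hr hh)
  rw [h1, hτ.map_real_smul hh.isSelfAdjoint, Complex.re_ofReal_mul] at h2
  have h3 : r * (ε / (r + 1)) ≤ ε := by
    rw [← mul_div_assoc, div_le_iff₀ (by positivity)]; nlinarith
  have h4 := mul_le_mul_of_nonneg_left hlt.le hr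
  linarith

theorem infLift_smul (hτ : IsOneQuasitrace τ) (hπ : Function.Surjective π) {a : Q}
    (ha : 0 ≤ a) {r : ℝ} (hr : 0 ≤ r) : infLift π τ (r • a) = r * infLift π τ a := by
  refine le_antisymm (infLift_smul_le hτ hπ ha hr) ?_
  rcases hr.eq_or_lt with rfl | hr'
  · simpa using infLift_nonneg hτ _
  · have := infLift_smul_le hτ hπ (smul_nonneg hr ha) (inv_nonneg.2 hr)
    rw [smul_smul, inv_mul_cancel₀ hr'.ne', one_smul] at this
    calc r * infLift π τ a ≤ r * (r⁻¹ * infLift π τ (r • a)) := by gcongr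
      _ = infLift π τ (r • a) := by rw [← mul_assoc, mul_inv_cancel₀ hr'.ne', one_mul]

end PushForward

/-! ### Additivity of the push-forward on orthogonal elements -/

section PushForward

variable {E Q : Type*} [CStarAlgebra E] [PartialOrder E] [StarOrderedRing E]
  [CStarAlgebra Q] [PartialOrder Q] [StarOrderedRing Q] {π : E →⋆ₐ[ℂ] Q} {τ : E → ℂ}

theorem infLift_le_add (hτ : IsOneQuasitrace τ) (hπ : Function.Surjective π) {a b : Q}
    (ha : 0 ≤ a) (hb : 0 ≤ b) {r : ℝ} (hr : 0 ≤ r) (h : a ≤ b + algebraMap ℝ Q r) :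
    infLift π τ a ≤ infLift π τ b + r * (τ 1).re :=
  (infLift_mono hτ hπ ha h).trans (infLift_add_algebraMap_le hτ hπ hb hr)

/-- Functions of a selfadjoint element separating its positive and negative parts. -/
theorem ramp_pair (u : E) {δ : ℝ} (hδ : 0 < δ) :
    let v := cfc (fun t => ramp (t / δ)) u
    let w := cfc (fun t => ramp (-t / δ)) u
    IsSelfAdjoint v ∧ IsSelfAdjoint w ∧ v * w = 0 ∧ w * v = 0 ∧ v * v + w * w ≤ 1 := by
  intro v w
  have hz : ∀ t : ℝ, ramp (t / δ) * ramp (-t / δ) = 0 := fun t => by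
    rcases le_total t 0 with h | h
    · rw [ramp_of_nonpos (div_nonpos_of_nonpos_of_nonneg h hδ.le), zero_mul]
    · rw [ramp_of_nonpos (s := -t / δ) (div_nonpos_of_nonpos_of_nonneg (by linarith) hδ.le),
        mul_zero]
  have hvw : v * w = 0 := by
    rw [← cfc_mul (fun t => ramp (t / δ)) (fun t => ramp (-t / δ)) u (by fun_prop) (by fun_prop),
      ← cfc_const_zero ℝ u]
    exact cfc_congr fun t _ => hz t
  refine ⟨IsSelfAdjoint.cfc, IsSelfAdjoint.cfc, hvw, ?_, ?_⟩
  · rw [← hvw]; exact (cfc_commute_cfc _ _ u).eq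
  · rw [← cfc_mul (fun t => ramp (t / δ)) (fun t => ramp (t / δ)) u (by fun_prop) (by fun_prop),
      ← cfc_mul (fun t => ramp (-t / δ)) (fun t => ramp (-t / δ)) u (by fun_prop) (by fun_prop),
      ← cfc_add (a := u) (fun t => ramp (t / δ) * ramp (t / δ))
        (fun t => ramp (-t / δ) * ramp (-t / δ)) (by fun_prop) (by fun_prop)]
    refine cfc_le_one _ _ fun t _ => ?_
    have h1 := hz t
    have h2 := ramp_nonneg (t / δ)
    have h3 := ramp_nonneg (-t / δ)
    have h4 := ramp_le_one (t / δ)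
    have h5 := ramp_le_one (-t / δ)
    rcases mul_eq_zero.1 h1 with h | h <;> rw [h] <;> nlinarith

theorem norm_le_one_of_mul_self_add {v w : E} (hv : IsSelfAdjoint v)
    (hle : v * v + w * w ≤ 1) (hw : IsSelfAdjoint w) : ‖v‖ ≤ 1 := by
  have h1 : star v * v ≤ 1 := by
    rw [hv.star_eq]
    refine le_trans (le_add_of_nonneg_right ?_) hle
    simpa [hw.star_eq] using star_mul_self_nonneg w
  have h2 := (CStarAlgebra.norm_le_one_iff_of_nonneg _ (star_mul_self_nonneg v)).2 h1
  rw [CStarRing.norm_star_mul_self] at h2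
  nlinarith [norm_nonneg v]

/-- Ramps `v`, `w` of the positive and negative part of a lift of `a - b` are orthogonal. They
compress lifts `h` of `a` and `k` of `b` to the orthogonal elements `v h v` and `w k w`, on which
`τ` is additive; by `le_conj_cfc_ramp` each compression costs at most `δ` in the quotient. -/
theorem infLift_add_le (hτ : IsOneQuasitrace τ) (hπ : Function.Surjective π) {a b : Q}
    (ha : 0 ≤ a) (hb : 0 ≤ b) (hab : a * b = 0) :
    infLift π τ (a + b) ≤ infLift π τ a + infLift π τ b := by
  have hT := hτ.re_one_nonneg
  refine le_of_forall_pos_le_add fun ε hε => ?_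
  obtain ⟨h, hh, hha, hlt⟩ := exists_lift_lt (τ := τ) hπ ha (ε := ε / 4) (by positivity)
  obtain ⟨k, hk, hkb, hlt'⟩ := exists_lift_lt (τ := τ) hπ hb (ε := ε / 4) (by positivity)
  set δ : ℝ := ε / 4 / ((τ 1).re + 1) with hδ
  have hδ0 : 0 < δ := by positivity
  have hδT : δ * (τ 1).re ≤ ε / 4 := by
    rw [hδ, div_mul_eq_mul_div, div_le_iff₀ (by positivity)]
    nlinarith
  obtain ⟨u, hu, huc⟩ := π.exists_selfAdjoint_lift hπ (ha.isSelfAdjoint.sub hb.isSelfAdjoint)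
  obtain ⟨hpa, hpb⟩ := cfc_max_sub_of_mul_eq_zero ha hb hab
  obtain ⟨hv, hw, hvw, hwv, hle⟩ := ramp_pair u hδ0
  set v := cfc (fun t => ramp (t / δ)) u with hvdef
  set w := cfc (fun t => ramp (-t / δ)) u with hwdef
  have hv1 := norm_le_one_of_mul_self_add hv hle hw
  have hw1 := norm_le_one_of_mul_self_add hw (by rwa [add_comm]) hv
  have hπv : π v = cfc (fun t => ramp (t / δ)) (a - b) := by
    rw [hvdef, π.map_cfc_real hu (by fun_prop), huc]
  have hπw : π w = cfc (fun t => ramp (-t / δ)) (a - b) := by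
    rw [hwdef, π.map_cfc_real hu (by fun_prop), huc]
  have h1 : a ≤ π v * a * π v + algebraMap ℝ Q δ := by
    have := le_conj_cfc_ramp (a - b) hδ0 (p := fun t => t) continuous_id
    rwa [hpa, ← hπv] at this
  have h2 : b ≤ π w * b * π w + algebraMap ℝ Q δ := by
    have := le_conj_cfc_ramp (a - b) hδ0 (p := fun t => -t) continuous_neg
    rwa [hpb, ← hπw] at this
  have hH1 : 0 ≤ v * h * v := by simpa [hv.star_eq] using star_left_conjugate_nonneg hh v
  have hH2 : 0 ≤ w * k * w := by simpa [hw.star_eq] using star_left_conjugate_nonneg hk w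
  have hcomm : Commute (v * h * v) (w * k * w) := by
    have e1 : v * h * v * (w * k * w) = v * h * (v * w) * k * w := by noncomm_ring
    have e2 : w * k * w * (v * h * v) = w * k * (w * v) * h * v := by noncomm_ring
    rw [commute_iff_eq, e1, e2, hvw, hwv]
    simp
  have hπH : a + b ≤ π (v * h * v + w * k * w) + algebraMap ℝ Q (δ + δ) := by
    rw [map_add, map_mul, map_mul, map_mul, map_mul, hha, hkb, map_add]
    calc a + b ≤ (π v * a * π v + algebraMap ℝ Q δ) + (π w * b * π w + algebraMap ℝ Q δ) :=
          add_le_add h1 h2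
      _ = _ := by abel
  have hπH0 : 0 ≤ π (v * h * v + w * k * w) := by
    rw [map_add, map_mul, map_mul, map_mul, map_mul]
    refine add_nonneg ?_ ?_
    · have := star_left_conjugate_nonneg (ha) (π v)
      rwa [← hha, ← map_star, hv.star_eq] at this
    · have := star_left_conjugate_nonneg (hb) (π w)
      rwa [← hkb, ← map_star, hw.star_eq] at this
  have h3 := infLift_le_add hτ hπ (add_nonneg ha hb) hπH0 (by positivity) hπH
  have h4 := infLift_le (π := π) hτ (add_nonneg hH1 hH2)
  rw [hτ.add_of_commute hH1.isSelfAdjoint hH2.isSelfAdjoint hcomm, Complex.add_re] at h4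
  have h5 : (τ (v * h * v)).re ≤ (τ h).re := by
    have := hτ.re_conj_le hh v
    rw [hv.star_eq] at this
    have h0 := hτ.re_nonneg hh
    have : ‖v‖ ^ 2 ≤ 1 := pow_le_one₀ (norm_nonneg v) hv1
    nlinarith
  have h6 : (τ (w * k * w)).re ≤ (τ k).re := by
    have := hτ.re_conj_le hk w
    rw [hw.star_eq] at this
    have h0 := hτ.re_nonneg hk
    have : ‖w‖ ^ 2 ≤ 1 := pow_le_one₀ (norm_nonneg w) hw1
    nlinarith
  linarith

/-- A lift `h` of `a + b` is compressed to the corners of two orthogonal ramps `v`, `w`. The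
off-diagonal corner `w h v` lies in the kernel, and a cutoff `f` makes `w h v f` small. With `X = f
v + w`, the element `X h X⋆` then differs from the sum of the orthogonal elements `f v h v f` and `w
h w` by at most `2δ`. -/
theorem le_infLift_add (hτ : IsOneQuasitrace τ) (hπ : Function.Surjective π) {a b : Q}
    (ha : 0 ≤ a) (hb : 0 ≤ b) (hab : a * b = 0) :
    infLift π τ a + infLift π τ b ≤ infLift π τ (a + b) := by
  have hT := hτ.re_one_nonneg
  refine le_of_forall_pos_le_add fun ε hε => ?_
  obtain ⟨h, hh, hhab, hlt⟩ := exists_lift_lt (τ := τ) hπ (add_nonneg ha hb) (ε := ε / 5)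
    (by positivity)
  set δ : ℝ := ε / 5 / ((τ 1).re + 1) with hδ
  have hδ0 : 0 < δ := by positivity
  have hδT : δ * (τ 1).re ≤ ε / 5 := by
    rw [hδ, div_mul_eq_mul_div, div_le_iff₀ (by positivity)]
    nlinarith
  obtain ⟨u, hu, huc⟩ := π.exists_selfAdjoint_lift hπ (ha.isSelfAdjoint.sub hb.isSelfAdjoint)
  obtain ⟨hpa, hpb⟩ := cfc_max_sub_of_mul_eq_zero ha hb hab
  obtain ⟨hv, hw, hvw, hwv, hle⟩ := ramp_pair u hδ0
  set v := cfc (fun t => ramp (t / δ)) u with hvdef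
  set w := cfc (fun t => ramp (-t / δ)) u with hwdef
  have hv1 := norm_le_one_of_mul_self_add hv hle hw
  have hw1 := norm_le_one_of_mul_self_add hw (by rwa [add_comm]) hv
  have hπv : π v = cfc (fun t => ramp (t / δ)) (a - b) := by
    rw [hvdef, π.map_cfc_real hu (by fun_prop), huc]
  have hπw : π w = cfc (fun t => ramp (-t / δ)) (a - b) := by
    rw [hwdef, π.map_cfc_real hu (by fun_prop), huc]
  have h1 : a ≤ π v * a * π v + algebraMap ℝ Q δ := by
    have := le_conj_cfc_ramp (a - b) hδ0 (p := fun t => t) continuous_id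
    rwa [hpa, ← hπv] at this
  have h2 : b ≤ π w * b * π w + algebraMap ℝ Q δ := by
    have := le_conj_cfc_ramp (a - b) hδ0 (p := fun t => -t) continuous_neg
    rwa [hpb, ← hπw] at this
  have hsv : star (π v) = π v := by rw [← map_star, hv.star_eq]
  have hsw : star (π w) = π w := by rw [← map_star, hw.star_eq]
  -- `a + b = |a - b|` is a function of `a - b`, and the two ramps are never both nonzero.
  have hzero : π (v * h * w) = 0 := by
    have hab' : a + b = cfc (fun t : ℝ => max t 0 + max (-t) 0) (a - b) := by
      rw [cfc_add (a := a - b) (fun t : ℝ => max t 0) (fun t : ℝ => max (-t) 0) (by fun_prop)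
        (by fun_prop), hpa, hpb]
    rw [map_mul, map_mul, hhab, hπv, hπw, hab', ← cfc_mul_mul (by fun_prop) (by fun_prop)
      (by fun_prop), ← cfc_const_zero ℝ (a - b)]
    refine cfc_congr fun t _ => ?_
    rcases le_total t 0 with h | h
    · simp only [ramp_of_nonpos (div_nonpos_of_nonpos_of_nonneg h hδ0.le), zero_mul]
    · simp only [ramp_of_nonpos (s := -t / δ)
        (div_nonpos_of_nonpos_of_nonneg (by linarith) hδ0.le), mul_zero]
  have hi : π (star (v * h * w)) = 0 := by rw [map_star, hzero, star_zero]
  have hi' : star (v * h * w) = w * h * v := by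
    rw [star_mul, star_mul, hv.star_eq, hw.star_eq, hh.isSelfAdjoint.star_eq, mul_assoc]
  obtain ⟨f, hf, hf1, hfi, hπf, hfw⟩ := exists_cutoff_of_map_eq_zero π hi hδ0
  rw [hi'] at hfi hfw
  have hfw' : f * w = w := hfw w (by rw [mul_assoc, hvw, mul_zero])
  have hwf' : w * f = w := by
    have := congrArg star hfw'
    rwa [star_mul, hf, hw.star_eq] at this
  -- Since `f` fixes `w`, the cross terms of `X⋆ X` vanish and `X⋆ X = v f² v + w² ≤ v² + w² ≤ 1`.
  set X := f * v + w with hX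
  have hXX : star X * X ≤ 1 := by
    have e1 : star X * X = star v * (f * f) * v + w * w := by
      rw [hX, star_add, star_mul, hf, hw.star_eq, hv.star_eq]
      calc (v * f + w) * (f * v + w)
          = v * (f * f) * v + v * (f * w) + (w * f) * v + w * w := by noncomm_ring
        _ = v * (f * f) * v + w * w := by rw [hfw', hwf', hvw, hwv]; simp
    have hff : f * f ≤ 1 := by
      have h0 : 0 ≤ f * f := by simpa [hf] using star_mul_self_nonneg f
      rw [← CStarAlgebra.norm_le_one_iff_of_nonneg _ h0]
      calc ‖f * f‖ ≤ ‖f‖ * ‖f‖ := norm_mul_le _ _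
        _ ≤ 1 * 1 := by gcongr
        _ = 1 := one_mul 1
    have e2 := star_left_conjugate_le_conjugate hff v
    rw [mul_one] at e2
    rw [e1]
    rw [hv.star_eq] at e2 ⊢
    exact (add_le_add_left e2 (w * w)).trans hle
  have hX1 : ‖star X‖ ≤ 1 := by
    have h3 := (CStarAlgebra.norm_le_one_iff_of_nonneg _ (star_mul_self_nonneg X)).2 hXX
    rw [CStarRing.norm_star_mul_self] at h3
    rw [norm_star]
    nlinarith [norm_nonneg X]
  set A := f * v * h * (v * f) with hA
  set C := w * h * w with hC
  have hA0 : 0 ≤ A := by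
    have := star_left_conjugate_nonneg hh (v * f)
    rwa [star_mul, hf, hv.star_eq] at this
  have hC0 : 0 ≤ C := by simpa [hw.star_eq] using star_left_conjugate_nonneg hh w
  have hAC : Commute A C := by
    have e1 : A * C = f * v * h * v * (f * w) * h * w := by rw [hA, hC]; noncomm_ring
    have e2 : C * A = w * h * (w * f) * v * h * (v * f) := by rw [hA, hC]; noncomm_ring
    rw [commute_iff_eq, e1, e2, hfw', hwf']
    have e3 : f * v * h * v * w * h * w = f * v * h * (v * w) * h * w := by noncomm_ring
    have e4 : w * h * w * v * h * (v * f) = w * h * (w * v) * h * (v * f) := by noncomm_ring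
    rw [e3, e4, hvw, hwv]
    simp
  have hsum : A + C ≤ star (star X) * h * star X + algebraMap ℝ E (δ + δ) := by
    have e1 : A + C - star (star X) * h * star X = -(star (w * h * v * f) + w * h * v * f) := by
      rw [star_star, hX, hA, hC, star_add, star_mul, star_mul, star_mul, star_mul, hf, hw.star_eq,
        hv.star_eq, hh.isSelfAdjoint.star_eq]
      noncomm_ring
    rw [← sub_le_iff_le_add', e1]
    refine le_algebraMap_of_norm_le (IsSelfAdjoint.star_add_self _).neg ?_
    rw [norm_neg]
    refine (norm_add_le _ _).trans ?_
    rw [norm_star]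
    exact add_le_add hfi hfi
  have h3 := hτ.re_le_add_of_le (hA0.isSelfAdjoint.add hC0.isSelfAdjoint)
    (star_left_conjugate_nonneg hh (star X)).isSelfAdjoint hsum
  rw [hτ.add_of_commute hA0.isSelfAdjoint hC0.isSelfAdjoint hAC, Complex.add_re] at h3
  have h4 : (τ (star (star X) * h * star X)).re ≤ (τ h).re := by
    have := hτ.re_conj_le hh (star X)
    have h0 := hτ.re_nonneg hh
    have : ‖star X‖ ^ 2 ≤ 1 := pow_le_one₀ (norm_nonneg _) hX1
    nlinarith
  have hva : 0 ≤ π v * b * π v := by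
    have := star_left_conjugate_nonneg hb (π v); rwa [hsv] at this
  have hwa : 0 ≤ π w * a * π w := by
    have := star_left_conjugate_nonneg ha (π w); rwa [hsw] at this
  have hπA : π A = π v * (a + b) * π v := by
    simp only [hA, map_mul, hπf, one_mul, mul_one, hhab, mul_assoc]
  have hπC : π C = π w * (a + b) * π w := by
    simp only [hC, map_mul, hhab]
  have hπA0 : 0 ≤ π A := by
    rw [hπA]
    have := star_left_conjugate_nonneg (add_nonneg ha hb) (π v); rwa [hsv] at this
  have hπC0 : 0 ≤ π C := by
    rw [hπC]
    have := star_left_conjugate_nonneg (add_nonneg ha hb) (π w); rwa [hsw] at this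
  have h5 : a ≤ π A + algebraMap ℝ Q δ := by
    refine h1.trans ?_
    rw [hπA, mul_add, add_mul]
    gcongr
    exact le_add_of_nonneg_right hva
  have h6 : b ≤ π C + algebraMap ℝ Q δ := by
    refine h2.trans ?_
    rw [hπC, mul_add, add_mul]
    gcongr
    exact le_add_of_nonneg_left hwa
  have h7 := infLift_le_add hτ hπ ha hπA0 hδ0.le h5
  have h8 := infLift_le_add hτ hπ hb hπC0 hδ0.le h6
  have h9 := infLift_le (π := π) hτ hA0
  have h10 := infLift_le (π := π) hτ hC0
  linarith

/-- The push-forward of a quasitrace along a quotient map is a quasitrace on the positive cone. -/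
theorem isPositiveQuasitrace_infLift (hτ : IsOneQuasitrace τ) (hπ : Function.Surjective π) :
    IsPositiveQuasitrace (infLift π τ) (τ 1).re where
  nonneg a _ := infLift_nonneg hτ a
  mono _ _ ha hab := infLift_mono hτ hπ ha hab
  smul _ _ hr ha := infLift_smul hτ hπ ha hr
  tracial x := by
    refine le_antisymm ?_ (infLift_tracial_le hτ hπ x)
    simpa using infLift_tracial_le hτ hπ (star x)
  add_of_mul_eq_zero _ _ ha hb hab :=
    le_antisymm (infLift_add_le hτ hπ ha hb hab) (le_infLift_add hτ hπ ha hb hab)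
  add_algebraMap_le _ _ ha hr := infLift_add_algebraMap_le hτ hπ ha hr
  bound_nonneg := hτ.re_one_nonneg

end PushForward

/-! ### Extension of a quasitrace from the positive cone in the presence of supports -/

/-- Every positive element has a support projection. -/
def HasSupports (Q : Type*) [CStarAlgebra Q] [PartialOrder Q] : Prop :=
  ∀ a : Q, 0 ≤ a → ∃ p : Q, IsStarProjection p ∧ ∀ x, a * x = 0 ↔ p * x = 0

section Supports

variable {Q : Type*} [CStarAlgebra Q] {s p : Q}

theorem mul_support (hp : IsStarProjection p) (h : ∀ x, s * x = 0 ↔ p * x = 0) : s * p = s := by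
  have := (h (1 - p)).2 hp.mul_one_sub_self
  rw [mul_sub, mul_one, sub_eq_zero] at this
  exact this.symm

theorem support_mul (hs : IsSelfAdjoint s) (hp : IsStarProjection p)
    (h : ∀ x, s * x = 0 ↔ p * x = 0) : p * s = s := by
  have := congrArg star (mul_support hp h)
  rwa [star_mul, hs.star_eq, hp.isSelfAdjoint.star_eq] at this

/-- The right annihilator of `s` is stable under left multiplication by `u`, hence `p u = p u p`.
The adjoint of this identity gives `u p = p u p`. -/
theorem commute_support (hp : IsStarProjection p)
    (h : ∀ x, s * x = 0 ↔ p * x = 0) {u : Q} (hu : IsSelfAdjoint u) (hc : Commute s u) :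
    Commute p u := by
  have h1 : s * (1 - p) = 0 := (h (1 - p)).2 hp.mul_one_sub_self
  have h2 : p * (u * (1 - p)) = 0 := by
    rw [← h, ← mul_assoc, hc.eq, mul_assoc, h1, mul_zero]
  have h3 : p * u = p * u * p := by
    rw [mul_sub, mul_one, mul_sub, sub_eq_zero, ← mul_assoc] at h2
    exact h2
  have h4 := congrArg star h3
  rw [star_mul, star_mul, star_mul, hu.star_eq, hp.isSelfAdjoint.star_eq, ← mul_assoc] at h4
  rw [commute_iff_eq, h3, ← h4]

variable [PartialOrder Q] [StarOrderedRing Q]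

theorem le_support (hs : 0 ≤ s) (hs1 : s ≤ 1) (hp : IsStarProjection p)
    (h : ∀ x, s * x = 0 ↔ p * x = 0) : s ≤ p := by
  have h1 := star_left_conjugate_le_conjugate hs1 p
  rwa [hp.isSelfAdjoint.star_eq, mul_one, hp.isIdempotentElem.eq, support_mul hs.isSelfAdjoint hp h,
    mul_support hp h] at h1

/-- From `s t = s` follow `p t = p` and `t p = p`, so that `t - p = (1 - p) t (1 - p) ≥ 0`. -/
theorem support_le {t : Q} (hp : IsStarProjection p) (h : ∀ x, s * x = 0 ↔ p * x = 0)
    (ht : 0 ≤ t) (hst : s * t = s) : p ≤ t := by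
  have h1 : p * t = p := by
    have : p * (1 - t) = 0 := by rw [← h, mul_sub, hst, mul_one, sub_self]
    rw [mul_sub, mul_one, sub_eq_zero] at this
    exact this.symm
  have h2 : t * p = p := by
    have := congrArg star h1
    rwa [star_mul, ht.isSelfAdjoint.star_eq, hp.isSelfAdjoint.star_eq] at this
  have h3 := star_left_conjugate_nonneg ht (1 - p)
  rw [hp.one_sub.isSelfAdjoint.star_eq, sub_mul, one_mul, h1, mul_sub, mul_one, sub_mul, h2,
    hp.isIdempotentElem.eq, sub_self, sub_zero] at h3
  exact sub_nonneg.1 h3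

/-- A positive contraction is approximated from below, up to `1 / (k + 1)`, by an average of
projections commuting with its commutant. -/
theorem HasSupports.exists_sum_projections (hQ : HasSupports Q) {x : Q} (hx : 0 ≤ x) (hx1 : x ≤ 1)
    (k : ℕ) :
    ∃ e : ℕ → Q, (∀ i, IsStarProjection (e i)) ∧
      (∀ i u, IsSelfAdjoint u → Commute x u → Commute (e i) u) ∧
      ((k + 1 : ℝ)⁻¹ • ∑ i ∈ Finset.range k, e i) ≤ x ∧
      x ≤ ((k + 1 : ℝ)⁻¹ • ∑ i ∈ Finset.range k, e i) + algebraMap ℝ Q (k + 1 : ℝ)⁻¹ := by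
  set g : ℕ → ℝ → ℝ := fun i t => ramp ((k + 1) * t - i) with hg
  have hgc : ∀ i, Continuous (g i) := fun i => by simp only [hg]; fun_prop
  set G : ℕ → Q := fun i => cfc (g i) x with hG
  have hG0 : ∀ i, 0 ≤ G i := fun i => cfc_nonneg fun t _ => ramp_nonneg _
  have hG1 : ∀ i, G i ≤ 1 := fun i => cfc_le_one _ _ fun t _ => ramp_le_one _
  -- `x` is the average of `G 0, …, G k`, and `G i` is a unit for `G (i + 1)`. The support `e i` of
  -- `G (i + 1)` therefore satisfies `G (i + 1) ≤ e i ≤ G i`.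
  choose e he hes using fun i => hQ (G (i + 1)) (hG0 (i + 1))
  have hk : (0 : ℝ) < k + 1 := by positivity
  have hsum : x = (k + 1 : ℝ)⁻¹ • ∑ i ∈ Finset.range (k + 1), G i := by
    simp only [hG]
    rw [← cfc_sum g x _ fun i _ => (hgc i).continuousOn, ← cfc_const_mul _ _ _
      (by simpa only [Finset.sum_fn] using
        (continuous_finsetSum _ fun i _ => hgc i).continuousOn)]
    nth_rw 1 [← cfc_id' ℝ x]
    refine cfc_congr fun t ht => ?_
    have h0 : 0 ≤ t := spectrum_nonneg_of_nonneg hx ht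
    have h1 : t ≤ 1 := (le_algebraMap_iff_spectrum_le (r := (1 : ℝ)) (a := x)).1
      (by simpa using hx1) t ht
    simp only [Finset.sum_apply, hg]
    rw [sum_ramp (by positivity), min_eq_left (by push_cast; nlinarith)]
    field_simp
  have hle : ∀ i, G (i + 1) ≤ e i := fun i => le_support (hG0 _) (hG1 _) (he i) (hes i)
  have hge : ∀ i, e i ≤ G i := fun i => by
    refine support_le (he i) (hes i) (hG0 i) ?_
    simp only [hG]
    rw [← cfc_mul _ _ x (hgc _).continuousOn (hgc _).continuousOn]
    refine cfc_congr fun t _ => ?_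
    simp only [hg]
    rcases le_total ((k + 1) * t - i) 1 with h | h
    · rw [ramp_of_nonpos (s := (k + 1) * t - (i + 1 : ℕ)) (by push_cast; linarith), zero_mul]
    · rw [ramp_of_one_le h, mul_one]
  refine ⟨e, he, fun i u hu hc => commute_support (he i) (hes i) hu
    (hc.cfc_real _), ?_, ?_⟩
  · rw [hsum, Finset.sum_range_succ]
    refine smul_le_smul_of_nonneg_left ?_ (by positivity)
    exact (Finset.sum_le_sum fun i _ => hge i).trans (le_add_of_nonneg_right (hG0 k))
  · nth_rw 1 [hsum]
    rw [Finset.sum_range_succ', Algebra.algebraMap_eq_smul_one, ← smul_add]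
    refine smul_le_smul_of_nonneg_left ?_ (by positivity)
    exact add_le_add (Finset.sum_le_sum fun i _ => hle i) (hG1 0)

end Supports

/-! ### Additivity on commuting elements -/

namespace IsPositiveQuasitrace

variable {Q : Type*} [CStarAlgebra Q] [PartialOrder Q] [StarOrderedRing Q] {σ : Q → ℝ} {T : ℝ}

theorem map_zero {Q : Type*} [CStarAlgebra Q] [PartialOrder Q] {σ : Q → ℝ} {T : ℝ}
    (hσ : IsPositiveQuasitrace σ T) : σ 0 = 0 := by
  simpa using hσ.smul 0 0 le_rfl le_rfl

theorem eq_add_of_commute_projection (hσ : IsPositiveQuasitrace σ T) {e x : Q}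
    (he : IsStarProjection e) (hx : 0 ≤ x) (hc : Commute e x) :
    σ x = σ (e * x) + σ ((1 - e) * x) := by
  have hc' : Commute (1 - e) x := (Commute.one_left x).sub_left hc
  rw [← hσ.add_of_mul_eq_zero _ _ (hc.mul_nonneg he.nonneg hx)
    (hc'.mul_nonneg he.one_sub.nonneg hx), ← add_mul, add_sub_cancel, one_mul]
  rw [hc.eq, mul_assoc, ← mul_assoc e, he.mul_one_sub_self, zero_mul, mul_zero]

/-- Induction on the projections: multiplication by `e i` and `1 - e i` gives orthogonal pieces, on
which `e i` acts as the scalar `1` or `0` and is absorbed into the constants. The projection `f` and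
the constants `a`, `b` provide the generality for this; with no projections left, both elements are
multiples of `f`. -/
theorem add_of_sum_projections (hσ : IsPositiveQuasitrace σ T) {ι : Type*} (s : Finset ι)
    (e : ι → Q) (he : ∀ i ∈ s, IsStarProjection (e i))
    (hc : ∀ i ∈ s, ∀ j ∈ s, Commute (e i) (e j)) {l m : ι → ℝ} (hl : ∀ i, 0 ≤ l i)
    (hm : ∀ i, 0 ≤ m i) :
    ∀ (f : Q) (a b : ℝ), IsStarProjection f → (∀ i ∈ s, Commute f (e i)) → 0 ≤ a → 0 ≤ b →
      σ (f * (algebraMap ℝ Q a + ∑ i ∈ s, l i • e i)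
          + f * (algebraMap ℝ Q b + ∑ i ∈ s, m i • e i)) =
        σ (f * (algebraMap ℝ Q a + ∑ i ∈ s, l i • e i))
          + σ (f * (algebraMap ℝ Q b + ∑ i ∈ s, m i • e i)) := by
  classical
  induction s using Finset.induction_on with
  | empty =>
    intro f a b hf _ ha hb
    simp only [Finset.sum_empty, add_zero, Algebra.algebraMap_eq_smul_one, mul_smul_comm, mul_one,
      ← add_smul]
    rw [hσ.smul _ _ (add_nonneg ha hb) hf.nonneg, hσ.smul _ _ ha hf.nonneg,
      hσ.smul _ _ hb hf.nonneg, add_mul]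
  | insert i s hi ih =>
    intro f a b hf hfc ha hb
    have ih := ih (fun j hj => he j (Finset.mem_insert_of_mem hj)) fun j hj k hk =>
      hc j (Finset.mem_insert_of_mem hj) k (Finset.mem_insert_of_mem hk)
    have hei := he i (Finset.mem_insert_self i s)
    have hfi : Commute f (e i) := hfc i (Finset.mem_insert_self i s)
    have hij : ∀ j ∈ s, Commute (e i) (e j) := fun j hj =>
      hc i (Finset.mem_insert_self i s) j (Finset.mem_insert_of_mem hj)
    have hfj : ∀ j ∈ s, Commute f (e j) := fun j hj => hfc j (Finset.mem_insert_of_mem hj)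
    set g := e i * f with hg
    set g' := (1 - e i) * f with hg'
    have hgp : IsStarProjection g := hei.mul hf hfi.symm
    have hgp' : IsStarProjection g' :=
      hei.one_sub.mul hf ((Commute.one_left f).sub_left hfi.symm)
    have split : ∀ (n : ι → ℝ), (∀ i, 0 ≤ n i) → ∀ c : ℝ, 0 ≤ c →
        0 ≤ f * (algebraMap ℝ Q c + ∑ j ∈ insert i s, n j • e j) ∧
        Commute (e i) (f * (algebraMap ℝ Q c + ∑ j ∈ insert i s, n j • e j)) ∧
        e i * (f * (algebraMap ℝ Q c + ∑ j ∈ insert i s, n j • e j)) =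
          g * (algebraMap ℝ Q (c + n i) + ∑ j ∈ s, n j • e j) ∧
        (1 - e i) * (f * (algebraMap ℝ Q c + ∑ j ∈ insert i s, n j • e j)) =
          g' * (algebraMap ℝ Q c + ∑ j ∈ s, n j • e j) := by
      intro n hn c h0
      have hcm : ∀ u, (∀ j ∈ insert i s, Commute u (e j)) →
          Commute u (algebraMap ℝ Q c + ∑ j ∈ insert i s, n j • e j) := fun u hu =>
        (Algebra.commute_algebraMap_right c u).add_right
          (Commute.sum_right _ _ _ fun j hj => (hu j hj).smul_right _)
      refine ⟨?_, ?_, ?_, ?_⟩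
      · refine Commute.mul_nonneg hf.nonneg (add_nonneg (algebraMap_nonneg Q h0)
          (Finset.sum_nonneg fun j hj => smul_nonneg (hn j) (he j hj).nonneg)) (hcm f hfc)
      · exact hfi.symm.mul_right (hcm _ fun j hj => hc i (Finset.mem_insert_self i s) j hj)
      · rw [Finset.sum_insert hi, ← mul_assoc, ← hg, map_add, Algebra.algebraMap_eq_smul_one (n i)]
        have h1 : g * e i = g := by
          rw [hg, mul_assoc, hfi.eq, ← mul_assoc, hei.isIdempotentElem.eq]
        simp only [mul_add, mul_smul_comm, h1, mul_one]
        abel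
      · rw [Finset.sum_insert hi, ← mul_assoc, ← hg']
        have h1 : g' * e i = 0 := by
          rw [hg', mul_assoc, hfi.eq, ← mul_assoc, hei.one_sub_mul_self, zero_mul]
        simp only [mul_add, mul_smul_comm, h1, smul_zero, zero_add]
    obtain ⟨p1, p2, p3, p4⟩ := split l hl a ha
    obtain ⟨q1, q2, q3, q4⟩ := split m hm b hb
    rw [hσ.eq_add_of_commute_projection hei (add_nonneg p1 q1) (p2.add_right q2),
      hσ.eq_add_of_commute_projection hei p1 p2, hσ.eq_add_of_commute_projection hei q1 q2,
      mul_add (e i), mul_add (1 - e i), p3, p4, q3, q4,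
      ih g _ _ hgp (fun j hj => (hij j hj).mul_left (hfj j hj)) (add_nonneg ha (hl i))
        (add_nonneg hb (hm i)),
      ih g' _ _ hgp' (fun j hj => ((Commute.one_left _).sub_left (hij j hj)).mul_left (hfj j hj))
        ha hb]
    ring

/-- Both elements are approximated in norm by averages of projections. All these projections
commute, because each commutes with what commutes with `x` or `y`; monotonicity bounds the error by
a multiple of `T / (k + 1)`. -/
theorem add_of_commute_of_le_one (hσ : IsPositiveQuasitrace σ T) (hQ : HasSupports Q) {x y : Q}
    (hx : 0 ≤ x) (hx1 : x ≤ 1) (hy : 0 ≤ y) (hy1 : y ≤ 1) (hxy : Commute x y) :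
    σ (x + y) = σ x + σ y := by
  have hT := hσ.bound_nonneg
  have key : ∀ k : ℕ, |σ (x + y) - (σ x + σ y)| ≤ 2 * T * (1 / ((k : ℝ) + 1)) := fun k => by
    obtain ⟨e, he, hec, hex, hxe⟩ := hQ.exists_sum_projections hx hx1 k
    obtain ⟨f, hf, hfc, hfy, hyf⟩ := hQ.exists_sum_projections hy hy1 k
    set c : ℝ := (k + 1 : ℝ)⁻¹ with hc
    have hc0 : 0 ≤ c := by positivity
    set X := c • ∑ i ∈ Finset.range k, e i with hX
    set Y := c • ∑ i ∈ Finset.range k, f i with hY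
    have hX0 : 0 ≤ X := smul_nonneg hc0 (Finset.sum_nonneg fun i _ => (he i).nonneg)
    have hY0 : 0 ≤ Y := smul_nonneg hc0 (Finset.sum_nonneg fun i _ => (hf i).nonneg)
    have hxe' : ∀ i, Commute x (e i) := fun i =>
      (hec i x hx.isSelfAdjoint (Commute.refl x)).symm
    have hyf' : ∀ i, Commute y (f i) := fun i =>
      (hfc i y hy.isSelfAdjoint (Commute.refl y)).symm
    have hxf : ∀ i, Commute x (f i) := fun i =>
      (hfc i x hx.isSelfAdjoint hxy.symm).symm
    have hee : ∀ i j, Commute (e i) (e j) := fun i j =>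
      hec i _ (he j).isSelfAdjoint (hxe' j)
    have hff : ∀ i j, Commute (f i) (f j) := fun i j =>
      hfc i _ (hf j).isSelfAdjoint (hyf' j)
    have hef : ∀ i j, Commute (e i) (f j) := fun i j =>
      hec i _ (hf j).isSelfAdjoint (hxf j)
    have hXY : σ (X + Y) = σ X + σ Y := by
      -- The two families are merged into one, each average having coefficient zero on the other
      -- family.
      have := hσ.add_of_sum_projections ((Finset.range k).disjSum (Finset.range k)) (Sum.elim e f)
        (by rintro (i | i) _ <;> simp [he, hf])
        (by
          rintro (i | i) _ (j | j) _
          · exact hee i j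
          · exact hef i j
          · exact (hef j i).symm
          · exact hff i j) (l := Sum.elim (fun _ => c) fun _ => 0)
        (m := Sum.elim (fun _ => 0) fun _ => c)
        (by rintro (i | i) <;> simp [hc0]) (by rintro (i | i) <;> simp [hc0]) 1 0 0
        (IsStarProjection.one Q) (fun i _ => Commute.one_left _) le_rfl le_rfl
      simpa only [Finset.sum_disjSum, Sum.elim_inl, Sum.elim_inr, zero_smul,
        Finset.sum_const_zero, add_zero, zero_add, one_mul, _root_.map_zero, ← Finset.smul_sum] using this
    have h1 : σ (x + y) ≤ σ (X + Y) + (c + c) * T := by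
      refine le_trans (hσ.mono _ _ (add_nonneg hx hy) ?_)
        (hσ.add_algebraMap_le _ _ (add_nonneg hX0 hY0) (add_nonneg hc0 hc0))
      rw [map_add]
      calc x + y ≤ _ := add_le_add hxe hyf
        _ = _ := by abel
    have h2 := hσ.mono _ _ (add_nonneg hX0 hY0) (add_le_add hex hfy)
    have h3 := (hσ.mono _ _ hx hxe).trans (hσ.add_algebraMap_le _ _ hX0 hc0)
    have h4 := (hσ.mono _ _ hy hyf).trans (hσ.add_algebraMap_le _ _ hY0 hc0)
    have h5 := hσ.mono _ _ hX0 hex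
    have h6 := hσ.mono _ _ hY0 hfy
    rw [one_div, ← hc, abs_le]
    constructor <;> nlinarith
  have hlim : Filter.Tendsto (fun k : ℕ => 2 * T * (1 / ((k : ℝ) + 1))) Filter.atTop
      (𝓝 (2 * T * 0)) := tendsto_one_div_add_atTop_nhds_zero_nat.const_mul _
  have := ge_of_tendsto hlim (Filter.Eventually.of_forall key)
  rw [mul_zero] at this
  exact sub_eq_zero.1 (abs_nonpos_iff.1 this)

theorem add_of_commute (hσ : IsPositiveQuasitrace σ T) (hQ : HasSupports Q) {x y : Q}
    (hx : 0 ≤ x) (hy : 0 ≤ y) (hxy : Commute x y) : σ (x + y) = σ x + σ y := by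
  set r : ℝ := ‖x‖ + ‖y‖ + 1 with hr
  have hr0 : 0 < r := by positivity
  have hsc : ∀ z : Q, 0 ≤ z → ‖z‖ ≤ r → r⁻¹ • z ≤ 1 := fun z hz hzr => by
    rw [← CStarAlgebra.norm_le_one_iff_of_nonneg _ (smul_nonneg (by positivity) hz), norm_smul,
      Real.norm_of_nonneg (by positivity), inv_mul_le_one₀ hr0]
    exact hzr
  have h := hσ.add_of_commute_of_le_one hQ (smul_nonneg (by positivity : 0 ≤ r⁻¹) hx)
    (hsc x hx (by linarith [norm_nonneg y])) (smul_nonneg (by positivity) hy)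
    (hsc y hy (by linarith [norm_nonneg x])) ((hxy.smul_left r⁻¹).smul_right r⁻¹)
  have hr1 : 0 ≤ r⁻¹ := by positivity
  rw [← smul_add, hσ.smul _ _ hr1 (add_nonneg hx hy), hσ.smul _ _ hr1 hx, hσ.smul _ _ hr1 hy,
    ← mul_add] at h
  exact mul_left_cancel₀ (by positivity) h

/-- The function `x ↦ σ x⁺ - σ x⁻` is additive on commuting selfadjoint elements. -/
theorem sub_parts_add (hσ : IsPositiveQuasitrace σ T) (hQ : HasSupports Q) {x y : Q}
    (hx : IsSelfAdjoint x) (hy : IsSelfAdjoint y) (hxy : Commute x y) :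
    σ (x + y)⁺ - σ (x + y)⁻ = (σ x⁺ - σ x⁻) + (σ y⁺ - σ y⁻) := by
  have hp : ∀ u v : Q, Commute u v → Commute u⁺ v := fun u v h => h.cfcₙ_real _
  have hn : ∀ u v : Q, Commute u v → Commute u⁻ v := fun u v h => h.cfcₙ_real _
  have pp := CFC.posPart_nonneg (A := Q)
  have nn := CFC.negPart_nonneg (A := Q)
  have hs : Commute (x + y) x := (Commute.refl x).add_left hxy.symm
  have hs' : Commute (x + y) y := hxy.add_left (Commute.refl y)
  -- In this rearrangement both sides are sums of commuting positive elements.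
  have e : (x + y)⁺ + (x⁻ + y⁻) = (x + y)⁻ + (x⁺ + y⁺) := by
    have h1 := CFC.posPart_sub_negPart (x + y) (hx.add hy)
    have h2 := CFC.posPart_sub_negPart x hx
    have h3 := CFC.posPart_sub_negPart y hy
    have : (x + y)⁺ - (x + y)⁻ = (x⁺ - x⁻) + (y⁺ - y⁻) := by rw [h1, h2, h3]
    rw [sub_eq_iff_eq_add] at this
    rw [this]; abel
  have h := congrArg σ e
  rw [hσ.add_of_commute hQ (pp _) (add_nonneg (nn _) (nn _))
      ((hp _ _ (hn _ _ hs.symm).symm).add_right (hp _ _ (hn _ _ hs'.symm).symm)),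
    hσ.add_of_commute hQ (nn _) (nn _) (hn _ _ (hn _ _ hxy.symm).symm),
    hσ.add_of_commute hQ (nn _) (add_nonneg (pp _) (pp _))
      ((hn _ _ (hp _ _ hs.symm).symm).add_right (hn _ _ (hp _ _ hs'.symm).symm)),
    hσ.add_of_commute hQ (pp _) (pp _) (hp _ _ (hp _ _ hxy.symm).symm)] at h
  linarith

theorem sub_parts_smul (hσ : IsPositiveQuasitrace σ T) (r : ℝ) (x : Q) :
    σ (r • x)⁺ - σ (r • x)⁻ = r * (σ x⁺ - σ x⁻) := by
  have pp := CFC.posPart_nonneg (A := Q)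
  have nn := CFC.negPart_nonneg (A := Q)
  rcases le_total 0 r with h | h
  · rw [CFC.posPart_smul_of_nonneg h, CFC.negPart_smul_of_nonneg h, hσ.smul _ _ h (pp x),
      hσ.smul _ _ h (nn x)]
    ring
  · rw [CFC.posPart_smul_of_nonpos h, CFC.negPart_smul_of_nonpos h,
      hσ.smul _ _ (neg_nonneg.2 h) (pp x), hσ.smul _ _ (neg_nonneg.2 h) (nn x)]
    ring

end IsPositiveQuasitrace

/-- The extension of a function on the positive cone of a C⋆-algebra to the whole algebra. -/
noncomputable def extendPositive {Q : Type*} [CStarAlgebra Q] (σ : Q → ℝ) (x : Q) : ℂ :=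
  ((σ (realPart x : Q)⁺ - σ (realPart x : Q)⁻ : ℝ) : ℂ) +
    Complex.I * ((σ (imaginaryPart x : Q)⁺ - σ (imaginaryPart x : Q)⁻ : ℝ) : ℂ)

namespace IsPositiveQuasitrace

variable {Q : Type*} [CStarAlgebra Q] [PartialOrder Q] [StarOrderedRing Q] {σ : Q → ℝ} {T : ℝ}

theorem extendPositive_of_isSelfAdjoint {Q : Type*} [CStarAlgebra Q] [PartialOrder Q] {σ : Q → ℝ}
    {T : ℝ} (hσ : IsPositiveQuasitrace σ T) {a : Q}
    (ha : IsSelfAdjoint a) : extendPositive σ a = ((σ a⁺ - σ a⁻ : ℝ) : ℂ) := by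
  rw [extendPositive, ha.imaginaryPart, ha.coe_realPart]
  simp [hσ.map_zero]

theorem extendPositive_of_nonneg (hσ : IsPositiveQuasitrace σ T) {a : Q} (ha : 0 ≤ a) :
    extendPositive σ a = (σ a : ℂ) := by
  rw [hσ.extendPositive_of_isSelfAdjoint ha.isSelfAdjoint, (CFC.posPart_eq_self a).2 ha,
    (CFC.negPart_eq_zero_iff a ha.isSelfAdjoint).2 ha, hσ.map_zero, sub_zero]

/-- A quasitrace on the positive cone of a C⋆-algebra with supports extends to a quasitrace. -/
theorem isOneQuasitrace_extendPositive (hσ : IsPositiveQuasitrace σ T) (hQ : HasSupports Q) :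
    IsOneQuasitrace (extendPositive σ) where
  tracial x := by
    rw [hσ.extendPositive_of_nonneg (star_mul_self_nonneg x),
      hσ.extendPositive_of_nonneg (mul_star_self_nonneg x), hσ.tracial x]
  nonneg x := by
    rw [hσ.extendPositive_of_nonneg (star_mul_self_nonneg x)]
    exact_mod_cast hσ.nonneg _ (star_mul_self_nonneg x)
  map_add_I_smul a b ha hb := by
    rw [hσ.extendPositive_of_isSelfAdjoint ha, hσ.extendPositive_of_isSelfAdjoint hb,
      extendPositive, map_add, map_add, realPart_I_smul, imaginaryPart_I_smul, hb.imaginaryPart,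
      ha.imaginaryPart, neg_zero, add_zero, zero_add, ha.coe_realPart, hb.coe_realPart]
  linear C _ hC := by
    have comm : ∀ x ∈ C, ∀ y ∈ C, ∀ u ∈ ({(realPart x : Q), (imaginaryPart x : Q)} : Set Q),
        ∀ v ∈ ({(realPart y : Q), (imaginaryPart y : Q)} : Set Q), Commute u v := by
      intro x hx y hy u hu v hv
      have mem : ∀ z ∈ C, ∀ w ∈ ({(realPart z : Q), (imaginaryPart z : Q)} : Set Q), w ∈ C := by
        rintro z hz w (rfl | rfl)
        · rw [realPart_apply_coe, ← Complex.coe_smul]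
          exact SMulMemClass.smul_mem _ (add_mem hz (star_mem (s := C) hz))
        · rw [imaginaryPart_apply_coe, ← Complex.coe_smul]
          exact SMulMemClass.smul_mem _ (SMulMemClass.smul_mem _ (sub_mem hz (star_mem (s := C) hz)))
      exact hC u (mem x hx u hu) v (mem y hy v hv)
    refine ⟨fun x hx y hy => ?_, fun r x hx => ?_⟩
    · rw [extendPositive, map_add, map_add, AddSubgroup.coe_add, AddSubgroup.coe_add,
        hσ.sub_parts_add hQ (realPart x).2 (realPart y).2
          (comm x hx y hy _ (Or.inl rfl) _ (Or.inl rfl)),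
        hσ.sub_parts_add hQ (imaginaryPart x).2 (imaginaryPart y).2
          (comm x hx y hy _ (Or.inr rfl) _ (Or.inr rfl)), extendPositive, extendPositive]
      push_cast
      ring
    · have hc : Commute (realPart x : Q) (imaginaryPart x : Q) :=
        comm x hx x hx _ (Or.inl rfl) _ (Or.inr rfl)
      have e1 : (realPart (r • x) : Q) = r.re • (realPart x : Q) + (-r.im) • (imaginaryPart x : Q) := by
        rw [realPart_smul]; simp [sub_eq_add_neg]
      have e2 : (imaginaryPart (r • x) : Q) = r.re • (imaginaryPart x : Q) + r.im • (realPart x : Q) := by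
        rw [imaginaryPart_smul]; simp
      have sa : ∀ (t : ℝ) (z : selfAdjoint Q), IsSelfAdjoint (t • (z : Q)) := fun t z =>
        (IsSelfAdjoint.all t).smul z.2
      rw [extendPositive, e1, e2,
        hσ.sub_parts_add hQ (sa _ _) (sa _ _) ((hc.smul_left _).smul_right _),
        hσ.sub_parts_add hQ (sa _ _) (sa _ _) ((hc.symm.smul_left _).smul_right _),
        hσ.sub_parts_smul, hσ.sub_parts_smul, hσ.sub_parts_smul, hσ.sub_parts_smul, extendPositive]
      nth_rw 5 [← Complex.re_add_im r]
      push_cast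
      linear_combination (r.im * ((σ (imaginaryPart x : Q)⁺ : ℂ) - σ (imaginaryPart x : Q)⁻)) * (-Complex.I_mul_I)

end IsPositiveQuasitrace

section

open Filter

/-! ### C⋆-algebras whose bounded sets are complete for a second norm -/

/-- Bounded increasing sequences in the functional calculus are Cauchy with respect to `N`. -/
def CauchyCfc {Q : Type*} [CStarAlgebra Q] [PartialOrder Q] (N : Q → ℝ) : Prop :=
  ∀ a : Q, 0 ≤ a → ∀ f : ℕ → ℝ → ℝ, (∀ k, Continuous (f k)) →
    (∀ k t, 0 ≤ f k t ∧ f k t ≤ 1) → (∀ t, Monotone fun k => f k t) →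
      ∀ ε > 0, ∃ K, ∀ i, K ≤ i → ∀ j, K ≤ j → N (cfc (f i) a - cfc (f j) a) ≤ ε

/-- `N` behaves like the square of a `2`-norm for which norm-bounded sets are complete and bounded
increasing sequences in the functional calculus converge. -/
structure IsCompleteSqNorm {Q : Type*} [CStarAlgebra Q] [PartialOrder Q] (N : Q → ℝ) (C : ℝ) :
    Prop where
  nonneg : ∀ x, 0 ≤ N x
  eq_zero : ∀ x, N x = 0 → x = 0
  add_le : ∀ x y, N (x + y) ≤ C * (N x + N y)
  star_le : ∀ x, N (star x) ≤ C * N x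
  mul_left_le : ∀ a x, N (a * x) ≤ C * ‖a‖ ^ 2 * N x
  complete : ∀ x : ℕ → Q, (∃ R, ∀ k, ‖x k‖ ≤ R) →
    (∀ ε > 0, ∃ K, ∀ i, K ≤ i → ∀ j, K ≤ j → N (x i - x j) ≤ ε) →
      ∃ y, Tendsto (fun i => N (x i - y)) atTop (𝓝 0)
  cauchy_cfc : CauchyCfc N

namespace IsCompleteSqNorm

variable {Q : Type*} [CStarAlgebra Q] [PartialOrder Q] {N : Q → ℝ} {C : ℝ}

theorem map_zero (hN : IsCompleteSqNorm N C) : N 0 = 0 :=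
  le_antisymm (by simpa using hN.mul_left_le 0 0) (hN.nonneg 0)

theorem neg_le (hN : IsCompleteSqNorm N C) (x : Q) : N (-x) ≤ C * ‖(1 : Q)‖ ^ 2 * N x := by
  simpa using hN.mul_left_le (-1) x

theorem squeeze (hN : IsCompleteSqNorm N C) {u v : ℕ → Q} {c : ℝ}
    (h : ∀ i, N (u i) ≤ c * N (v i)) (hv : Tendsto (fun i => N (v i)) atTop (𝓝 0)) :
    Tendsto (fun i => N (u i)) atTop (𝓝 0) := by
  have := hv.const_mul c
  rw [mul_zero] at this
  exact squeeze_zero (fun i => hN.nonneg _) h this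

theorem eq_of_tendsto (hN : IsCompleteSqNorm N C) {x : ℕ → Q} {y z : Q}
    (hy : Tendsto (fun i => N (x i - y)) atTop (𝓝 0))
    (hz : Tendsto (fun i => N (x i - z)) atTop (𝓝 0)) : y = z := by
  have hy' : Tendsto (fun i => N (-(x i - y))) atTop (𝓝 0) :=
    hN.squeeze (fun i => hN.neg_le _) hy
  have h := (hy'.add hz).const_mul C
  rw [add_zero, mul_zero] at h
  have h0 : N (y - z) ≤ 0 := ge_of_tendsto h <| Eventually.of_forall fun i => by
    have := hN.add_le (-(x i - y)) (x i - z)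
    rwa [neg_sub, sub_add_sub_cancel, ← neg_sub (x i) y] at this
  exact sub_eq_zero.1 (hN.eq_zero _ (le_antisymm h0 (hN.nonneg _)))

theorem tendsto_mul_left (hN : IsCompleteSqNorm N C) {x : ℕ → Q} {y : Q} (a : Q)
    (hy : Tendsto (fun i => N (x i - y)) atTop (𝓝 0)) :
    Tendsto (fun i => N (a * x i - a * y)) atTop (𝓝 0) :=
  hN.squeeze (fun i => by rw [← mul_sub]; exact hN.mul_left_le a _) hy

theorem tendsto_star (hN : IsCompleteSqNorm N C) {x : ℕ → Q} {y : Q}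
    (hy : Tendsto (fun i => N (x i - y)) atTop (𝓝 0)) :
    Tendsto (fun i => N (star (x i) - star y)) atTop (𝓝 0) :=
  hN.squeeze (fun i => by rw [← star_sub]; exact hN.star_le _) hy

theorem tendsto_mul_right (hN : IsCompleteSqNorm N C) {x : ℕ → Q} {y : Q} (a : Q)
    (hy : Tendsto (fun i => N (x i - y)) atTop (𝓝 0)) :
    Tendsto (fun i => N (x i * a - y * a)) atTop (𝓝 0) := by
  simpa using hN.tendsto_star (hN.tendsto_mul_left (star a) (hN.tendsto_star hy))

theorem tendsto_of_norm (hN : IsCompleteSqNorm N C) {x : ℕ → Q} {y : Q}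
    (hy : Tendsto (fun i => ‖x i - y‖) atTop (𝓝 0)) :
    Tendsto (fun i => N (x i - y)) atTop (𝓝 0) := by
  have h := ((hy.pow 2).const_mul C).mul_const (N 1)
  simp only [ne_eq, OfNat.ofNat_ne_zero, not_false_eq_true, zero_pow, mul_zero, zero_mul] at h
  exact squeeze_zero (fun i => hN.nonneg _)
    (fun i => by simpa using hN.mul_left_le (x i - y) 1) h

theorem tendsto_const (hN : IsCompleteSqNorm N C) (y : Q) :
    Tendsto (fun _ : ℕ => N (y - y)) atTop (𝓝 0) := by
  rw [sub_self, hN.map_zero]; exact tendsto_const_nhds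

/-- The support `p` is the `N`-limit of `a (a + 1/(k+1))⁻¹`, an increasing sequence of contractions.
Multiplication by a fixed element is `N`-continuous, so `a p = a`, and `a y = 0` implies `p y = 0`;
the choice `y = 1 - p` makes `p` idempotent. -/
theorem hasSupports [StarOrderedRing Q] (hN : IsCompleteSqNorm N C) : HasSupports Q := by
  intro a ha
  -- `max t 0` makes the functions `f k` below continuous, `[0, 1]`-valued and increasing in `k` on
  -- the whole line, as `CauchyCfc` requires.
  set h : ℕ → ℝ → ℝ := fun k t => (max t 0 + 1 / (k + 1 : ℝ))⁻¹ with hh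
  have hk : ∀ k : ℕ, 0 < 1 / (k + 1 : ℝ) := fun k => by positivity
  have hpos : ∀ (k : ℕ) (t : ℝ), 0 < max t 0 + 1 / (k + 1 : ℝ) := fun k t =>
    add_pos_of_nonneg_of_pos (le_max_right _ _) (hk k)
  have hhc : ∀ k, Continuous (h k) := fun k =>
    Continuous.inv₀ (by fun_prop) fun t => (hpos k t).ne'
  set f : ℕ → ℝ → ℝ := fun k t => h k t * max t 0 with hf
  have hfc : ∀ k, Continuous (f k) := fun k => (hhc k).mul (by fun_prop)
  have hf01 : ∀ k t, 0 ≤ f k t ∧ f k t ≤ 1 := fun k t => by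
    have h1 := hpos k t
    have h2 := le_max_right t 0
    refine ⟨by simp only [hf, hh]; positivity, ?_⟩
    simp only [hf, hh]
    rw [inv_mul_le_one₀ h1]
    linarith [hk k]
  have hfm : ∀ t, Monotone fun k => f k t := fun t i j hij => by
    simp only [hf, hh]
    refine mul_le_mul_of_nonneg_right (inv_anti₀ (hpos j t) ?_) (le_max_right _ _)
    have := one_div_le_one_div_of_le (by positivity : (0 : ℝ) < i + 1)
      (by exact_mod_cast Nat.succ_le_succ hij : (i + 1 : ℝ) ≤ j + 1)
    linarith
  have hspec : ∀ t ∈ spectrum ℝ a, 0 ≤ t := fun t ht => spectrum_nonneg_of_nonneg ha ht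
  obtain ⟨p, hp⟩ := hN.complete (fun k => cfc (f k) a)
    ⟨1, fun k => norm_cfc_le zero_le_one fun t _ => by
      rw [Real.norm_of_nonneg (hf01 k t).1]; exact (hf01 k t).2⟩
    (hN.cauchy_cfc a ha f hfc hf01 hfm)
  have hpsa : star p = p := by
    refine hN.eq_of_tendsto (x := fun k => cfc (f k) a) ?_ hp
    have := hN.tendsto_star hp
    simpa only [(IsSelfAdjoint.cfc (f := f _) (a := a)).star_eq] using this
  have hap : a * p = a := by
    refine hN.eq_of_tendsto (hN.tendsto_mul_left a hp) (hN.tendsto_of_norm ?_)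
    refine squeeze_zero (fun _ => norm_nonneg _) (fun k => ?_)
      tendsto_one_div_add_atTop_nhds_zero_nat
    have : a * cfc (f k) a - a = cfc (fun t => t * f k t - t) a := by
      rw [cfc_sub (fun t => t * f k t) (fun t => t) a (continuous_id.mul (hfc k)).continuousOn
        continuousOn_id, cfc_mul (fun t => t) (f k) a continuousOn_id (hfc k).continuousOn,
        cfc_id' ℝ a]
    rw [this]
    refine norm_cfc_le (hk k).le fun t ht => ?_
    have h0 := hspec t ht
    have h1 := hpos k t
    have h2 : t * f k t - t = -(1 / (k + 1 : ℝ) * f k t) := by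
      have h3 : (max t 0 + 1 / (k + 1 : ℝ)) * f k t = max t 0 := by
        simp only [hf, hh]
        rw [mul_inv_cancel_left₀ h1.ne']
      rw [max_eq_left h0] at h3
      linarith
    rw [h2, norm_neg, Real.norm_of_nonneg (mul_nonneg (hk k).le (hf01 k t).1)]
    exact mul_le_of_le_one_right (hk k).le (hf01 k t).2
  have hay : ∀ y, a * y = 0 → p * y = 0 := fun y hy => by
    refine hN.eq_of_tendsto (hN.tendsto_mul_right y hp) ?_
    have : ∀ k, cfc (f k) a * y = 0 := fun k => by
      have : cfc (f k) a = cfc (h k) a * a := by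
        nth_rw 3 [← cfc_id' ℝ a]
        rw [← cfc_mul (h k) (fun t => t) a (hhc k).continuousOn continuousOn_id]
        exact cfc_congr fun t ht => by simp only [hf, max_eq_left (hspec t ht)]
      rw [this, mul_assoc, hy, mul_zero]
    simp only [this]
    exact hN.tendsto_const 0
  have hpp : p * p = p := by
    have := hay (1 - p) (by rw [mul_sub, mul_one, hap, sub_self])
    rw [mul_sub, mul_one, sub_eq_zero] at this
    exact this.symm
  exact ⟨p, ⟨hpp, hpsa⟩, fun y => ⟨hay y, fun hy => by rw [← hap, mul_assoc, hy, mul_zero]⟩⟩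

end IsCompleteSqNorm

/-! ### Finite AW⋆-algebras -/

section

variable {Q : Type*} [CStarAlgebra Q] [PartialOrder Q] [StarOrderedRing Q]

/-- A C⋆-algebra with supports in which orthogonal families of projections have least upper bounds
is an AW⋆-algebra. -/
theorem HasSupports.isAWStarAlgebra (hQ : HasSupports Q)
    (hlub : ∀ P : Set Q, (∀ q ∈ P, IsStarProjection q) → (P.Pairwise fun q r => q * r = 0) →
      ∃ p : Q, IsProjectionLUB P p) : IsAWStarAlgebra Q := by
  intro S
  -- The annihilator projection is the least upper bound of a maximal orthogonal family of nonzero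
  -- projections `q` with `S q = 0`.
  set F : Set (Set Q) := {P | (∀ q ∈ P, IsStarProjection q ∧ q ≠ 0 ∧ ∀ s ∈ S, s * q = 0) ∧
    P.Pairwise fun q r => q * r = 0} with hF
  obtain ⟨P, hP⟩ := zorn_subset F fun c hc hchain => by
    refine ⟨⋃₀ c, ⟨?_, ?_⟩, fun s hs => Set.subset_sUnion_of_mem hs⟩
    · rintro q ⟨P, hP, hq⟩
      exact (hc hP).1 q hq
    · exact (Set.pairwise_sUnion hchain.directedOn).2 fun P hP => (hc hP).2
  obtain ⟨⟨hP1, hP2⟩, hmax⟩ := hP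
  obtain ⟨p, hp⟩ := hlub P (fun q hq => (hP1 q hq).1) hP2
  have hpp := hp.isStarProjection
  have hzero : ∀ s z : Q, star s * s * z = 0 → s * z = 0 := fun s z h => by
    rw [← norm_eq_zero, ← mul_self_eq_zero, ← CStarRing.norm_star_mul_self, star_mul, mul_assoc,
      ← mul_assoc (star s), h, mul_zero, norm_zero]
  -- For `t` the support of `s⋆s`, each `q` in the family lies below `1 - t`, hence so does `p`.
  have hSp : ∀ s ∈ S, s * p = 0 := fun s hs => by
    obtain ⟨t, ht, hst⟩ := hQ (star s * s) (star_mul_self_nonneg s)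
    have h1 : p * (1 - t) = p := hp.least _ ht.one_sub fun q hq => by
      have h2 : t * q = 0 := by rw [← hst, mul_assoc, (hP1 q hq).2.2 s hs, mul_zero]
      have h3 := congrArg star h2
      rw [star_mul, (hP1 q hq).1.isSelfAdjoint.star_eq, ht.isSelfAdjoint.star_eq, star_zero] at h3
      rw [mul_sub, mul_one, h3, sub_zero]
    have h4 : p * t = 0 := by rwa [mul_sub, mul_one, sub_eq_self] at h1
    have h5 := congrArg star h4
    rw [star_mul, hpp.isSelfAdjoint.star_eq, ht.isSelfAdjoint.star_eq, star_zero] at h5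
    exact hzero s p ((hst p).2 h5)
  refine ⟨p, hpp, Set.ext fun x => ⟨fun hx => ⟨x, ?_⟩, ?_⟩⟩
  -- If `z ≠ 0`, the support of `z z⋆` is a nonzero projection annihilated by `S` and orthogonal to
  -- `P`, against maximality.
  · set z := (1 - p) * x with hz
    have hpz : p * z = 0 := by rw [hz, ← mul_assoc, hpp.mul_one_sub_self, zero_mul]
    have hSz : ∀ s ∈ S, s * z = 0 := fun s hs => by
      rw [hz, sub_mul, one_mul, mul_sub, ← mul_assoc, hSp s hs, zero_mul, sub_zero]
      exact hx s hs
    suffices z = 0 by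
      rw [hz, sub_mul, one_mul, sub_eq_zero] at this
      exact this
    by_contra hz0
    obtain ⟨r, hr, hrz⟩ := hQ (z * star z) (mul_star_self_nonneg z)
    have hann : ∀ s : Q, s * z = 0 → s * r = 0 := fun s hs => by
      have h1 : r * star s = 0 := by
        rw [← hrz, mul_assoc, ← star_mul, hs, star_zero, mul_zero]
      have h2 := congrArg star h1
      rwa [star_mul, star_star, hr.isSelfAdjoint.star_eq, star_zero] at h2
    have hpr := hann p hpz
    have hr0 : r ≠ 0 := fun h => hz0 <| by
      have h1 : z * star z = 0 := by
        have := (hrz 1).2 (by rw [h, zero_mul])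
        rwa [mul_one] at this
      rwa [CStarRing.mul_star_self_eq_zero_iff] at h1
    have hqr : ∀ q ∈ P, q * r = 0 := fun q hq => by
      rw [← hp.upper q hq, mul_assoc, hpr, mul_zero]
    have hmem : insert r P ∈ F := by
      refine ⟨?_, ?_⟩
      · rintro q (rfl | hq)
        · exact ⟨hr, hr0, fun s hs => hann s (hSz s hs)⟩
        · exact hP1 q hq
      · refine hP2.insert fun q hq _ => ⟨?_, hqr q hq⟩
        have h2 := congrArg star (hqr q hq)
        rwa [star_mul, (hP1 q hq).1.isSelfAdjoint.star_eq, hr.isSelfAdjoint.star_eq,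
          star_zero] at h2
    have hrP : r ∈ P := hmax hmem (Set.subset_insert r P) (Set.mem_insert r P)
    refine hr0 ?_
    rw [← hr.isIdempotentElem.eq]
    exact hqr r hrP
  · rintro ⟨y, rfl⟩ s hs
    rw [← mul_assoc, hSp s hs, zero_mul]

namespace IsOneQuasitrace

variable {τ : Q → ℂ}

/-- By traciality the projection `1 - v v⋆` has value `τ 1 - τ (v⋆v) = 0`, and faithfulness makes it
zero. -/
theorem isFiniteCStarAlgebra {Q : Type*} [CStarAlgebra Q] {τ : Q → ℂ} (hτ : IsOneQuasitrace τ)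
    (hf : IsFaithfulQuasitrace τ) : IsFiniteCStarAlgebra Q := by
  intro v hv
  have hvv : IsSelfAdjoint (v * star v) := IsSelfAdjoint.mul_star_self v
  have h := hτ.sub_of_commute (IsSelfAdjoint.one Q) hvv (Commute.one_left _)
  rw [← hτ.tracial v, hv, sub_self] at h
  have h2 : star (1 - v * star v) * (1 - v * star v) = 1 - v * star v := by
    rw [star_sub, star_one, hvv.star_eq, sub_mul, one_mul, mul_sub, mul_one, mul_assoc,
      ← mul_assoc (star v), hv, one_mul, sub_self, sub_zero]
  exact (sub_eq_zero.1 (hf _ (by rw [h2, h]))).symm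

/-- Finite partial sums are projections with `N (r - q) = τ r - τ q` for `q ≤ r`, and their traces
are bounded by `τ 1`. A sequence of partial sums whose traces tend to the supremum `s` is thus
Cauchy for `N`. Its limit dominates the whole family, even if uncountable, since what the sequence
omits has arbitrarily small trace. -/
theorem isNormalQuasitrace (hτ : IsOneQuasitrace τ) {C : ℝ}
    (hN : IsCompleteSqNorm (fun x => (τ (star x * x)).re) C) : IsNormalQuasitrace τ := by
  classical
  intro P hP hPP
  set N : Q → ℝ := fun x => (τ (star x * x)).re with hNdef
  have hproj : ∀ F : Finset P, IsStarProjection (∑ q ∈ F, (q : Q)) ∧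
      (∀ r : P, r ∉ F → (r : Q) * ∑ q ∈ F, (q : Q) = 0) ∧
      (∀ r : P, r ∈ F → (r : Q) * ∑ q ∈ F, (q : Q) = r) := by
    have horth : ∀ (F : Finset P) (r : P), r ∉ F → (r : Q) * ∑ q ∈ F, (q : Q) = 0 := by
      intro F r hr
      rw [Finset.mul_sum]
      exact Finset.sum_eq_zero fun q hq =>
        hPP r.2 q.2 fun h => hr (by rwa [Subtype.ext h])
    intro F
    refine ⟨?_, horth F, ?_⟩
    · induction F using Finset.induction_on with
      | empty => simp
      | insert r F hr ih =>
        rw [Finset.sum_insert hr]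
        refine (hP r r.2).add ih (horth F r hr)
    · intro r hr
      rw [← Finset.add_sum_erase _ _ hr, mul_add, horth _ r (Finset.notMem_erase r F),
        (hP r r.2).isIdempotentElem.eq, add_zero]
  set e : Finset P → Q := fun F => ∑ q ∈ F, (q : Q) with he
  have hNproj : ∀ q : Q, IsStarProjection q → N q = (τ q).re := fun q hq => by
    simp only [hNdef]; rw [hq.isSelfAdjoint.star_eq, hq.isIdempotentElem.eq]
  have hτe : ∀ F, (τ (e F)).re = ∑ q ∈ F, (τ (q : Q)).re := fun F => by
    simp only [he]
    rw [hτ.map_sum_of_commute F _ (fun q _ => (hP q q.2).isSelfAdjoint), Complex.re_sum]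
    intro q _ r _
    by_cases h : q = r
    · rw [h]
    · have h' : (q : Q) ≠ r := fun h'' => h (Subtype.ext h'')
      rw [commute_iff_eq, hPP q.2 r.2 h', hPP r.2 q.2 h'.symm]
  have hτ0 : ∀ q : P, 0 ≤ (τ (q : Q)).re := fun q => hτ.re_nonneg (hP q q.2).nonneg
  have hsum : Summable fun q : P => (τ (q : Q)).re :=
    summable_of_sum_le hτ0 (c := (τ 1).re) fun F => by
      rw [← hτe]
      exact hτ.re_mono (hproj F).1.isSelfAdjoint (IsSelfAdjoint.one Q) (hproj F).1.le_one
  set s := ∑' q : P, (τ (q : Q)).re with hs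
  have hle : ∀ F : Finset P, (τ (e F)).re ≤ s := fun F => by
    rw [hτe]; exact hsum.sum_le_tsum F fun q _ => hτ0 q
  have hmulF : ∀ F G : Finset P, F ⊆ G → e F * e G = e F := fun F G h => by
    simp only [he]
    rw [Finset.sum_mul]
    exact Finset.sum_congr rfl fun q hq => (hproj G).2.2 q (h hq)
  have hsubτ : ∀ q r : Q, IsStarProjection q → IsStarProjection r → q * r = q →
      N (r - q) = (τ r).re - (τ q).re := fun q r hq hr hqr => by
    have hrq : r * q = q := by
      have := congrArg star hqr
      rwa [star_mul, hq.isSelfAdjoint.star_eq, hr.isSelfAdjoint.star_eq] at this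
    rw [hNproj _ (hq.sub_of_mul_eq_left hr hqr), hτ.sub_of_commute hr.isSelfAdjoint
      hq.isSelfAdjoint (by rw [commute_iff_eq, hqr, hrq]), Complex.sub_re]
  have hsumF : Tendsto (fun F => (τ (e F)).re) atTop (𝓝 s) := by
    simp only [hτe]; exact hsum.hasSum
  have hex : ∀ k : ℕ, ∃ F : Finset P, ∀ G, F ⊆ G → s - 1 / (k + 1 : ℝ) ≤ (τ (e G)).re := fun k => by
    have h0 : 0 < 1 / (k + 1 : ℝ) := by positivity
    have := hsumF.eventually (eventually_ge_nhds (show s - 1 / (k + 1 : ℝ) < s by linarith))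
    exact eventually_atTop.1 this
  choose G hG using hex
  -- Unions make the sets increasing, so that the successive differences are projections.
  set F : ℕ → Finset P := fun k => (Finset.range (k + 1)).biUnion G with hF
  have hFm : Monotone F := fun i j hij =>
    Finset.biUnion_subset_biUnion_of_subset_left _ (Finset.range_mono (by omega))
  have hGF : ∀ k, G k ⊆ F k := fun k =>
    Finset.subset_biUnion_of_mem G (Finset.self_mem_range_succ k)
  have hFs : ∀ k : ℕ, s - 1 / (k + 1 : ℝ) ≤ (τ (e (F k))).re := fun k => hG k _ (hGF k)
  have hstar : ∀ i j, i ≤ j → N (e (F j) - e (F i)) ≤ 1 / (i + 1 : ℝ) := fun i j hij => by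
    rw [hsubτ _ _ (hproj _).1 (hproj _).1 (hmulF _ _ (hFm hij))]
    linarith [hFs i, hle (F j)]
  have hNneg : ∀ x y : Q, N (x - y) = N (y - x) := fun x y => by
    simp only [hNdef]; rw [← neg_sub x y, star_neg, neg_mul_neg]
  have hk0 : Tendsto (fun k : ℕ => 1 / (k + 1 : ℝ)) atTop (𝓝 0) :=
    tendsto_one_div_add_atTop_nhds_zero_nat
  obtain ⟨p, hp⟩ := hN.complete (fun k => e (F k)) ⟨1, fun k => (hproj _).1.norm_le⟩ (by
    intro ε hε
    obtain ⟨K, hK⟩ := eventually_atTop.1 (hk0.eventually (eventually_le_nhds hε))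
    refine ⟨K, fun i hi j hj => ?_⟩
    rcases le_total i j with hij | hij
    · rw [hNneg]; exact (hstar i j hij).trans (hK i hi)
    · exact (hstar j i hij).trans (hK j hj))
  have hpsa : star p = p := by
    refine hN.eq_of_tendsto (x := fun k => e (F k)) ?_ hp
    have := hN.tendsto_star hp
    have hs : ∀ k, star (e (F k)) = e (F k) := fun k => (hproj (F k)).1.isSelfAdjoint.star_eq
    simpa only [hs] using this
  have hmulr : ∀ r : Q, (∀ q ∈ P, q * r = q) → p * r = p := fun r hr => by
    refine hN.eq_of_tendsto (hN.tendsto_mul_right r hp) ?_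
    have : ∀ k, e (F k) * r = e (F k) := fun k => by
      simp only [he]
      rw [Finset.sum_mul]
      exact Finset.sum_congr rfl fun q _ => hr q q.2
    simpa only [this] using hp
  have hqp : ∀ q ∈ P, q * p = q := fun q hq => by
    refine hN.eq_of_tendsto (hN.tendsto_mul_left q hp) ?_
    refine squeeze_zero (fun k => hN.nonneg _) (fun k => ?_) hk0
    by_cases hqF : (⟨q, hq⟩ : P) ∈ F k
    · have := (hproj (F k)).2.2 _ hqF
      simp only at this
      rw [hNneg, this, sub_self, hN.map_zero]
      positivity
    -- Adding `q` to `F k` raises the trace to at most `s`, so `τ q ≤ 1 / (k + 1)`.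
    · have h1 := (hproj (F k)).2.1 _ hqF
      simp only at h1
      rw [hNneg, h1, sub_zero, hNproj q (hP q hq)]
      have h2 := hle (insert ⟨q, hq⟩ (F k))
      rw [hτe, Finset.sum_insert hqF, ← hτe] at h2
      linarith [hFs k]
  have hpproj : IsStarProjection p := ⟨hmulr p hqp, hpsa⟩
  have hFp : ∀ k, e (F k) * p = e (F k) := fun k => by
    simp only [he]
    rw [Finset.sum_mul]
    exact Finset.sum_congr rfl fun q _ => hqp q q.2
  refine ⟨p, ⟨hpproj, hqp, fun r _ hr => hmulr r hr⟩, ?_⟩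
  have hτp : (τ p).re = s := by
    have h1 : Tendsto (fun k => (τ (e (F k))).re) atTop (𝓝 s) := by
      refine tendsto_of_tendsto_of_tendsto_of_le_of_le (g := fun k : ℕ => s - 1 / (k + 1 : ℝ)) ?_
        tendsto_const_nhds hFs fun k => hle _
      simpa using hk0.const_sub s
    have h2 : Tendsto (fun k => (τ p).re - (τ (e (F k))).re) atTop (𝓝 0) := by
      refine hp.congr fun k => ?_
      rw [hNneg]
      exact hsubτ _ _ (hproj _).1 hpproj (hFp k)
    have h3 := tendsto_nhds_unique h2 (h1.const_sub _)
    linarith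
  rw [hτ.eq_re hpproj.isSelfAdjoint, hτp]
  have h4 : (fun q : P => τ (q : Q)) = fun q : P => (((τ (q : Q)).re : ℝ) : ℂ) :=
    funext fun q => hτ.eq_re (hP q q.2).isSelfAdjoint
  rw [h4, Complex.hasSum_ofReal]
  exact hsum.hasSum

end IsOneQuasitrace

end

/-- Unital `*`-homomorphisms between C⋆-algebras. -/
abbrev CStarHom (A B : Type*) [CStarAlgebra A] [CStarAlgebra B] := A →⋆ₐ[ℂ] B

section

variable {B : Type*} [CStarAlgebra B] [PartialOrder B] [StarOrderedRing B]

/-- Bounded increasing sequences in the functional calculus are Cauchy for the `2`-norm. -/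
theorem IsOneQuasitrace.cauchy_cfc {τ : B → ℂ} (hτ : IsOneQuasitrace τ) (h : B) {f : ℕ → ℝ → ℝ}
    (hf : ∀ k, Continuous (f k)) (hf01 : ∀ k t, 0 ≤ f k t ∧ f k t ≤ 1)
    (hm : ∀ t, Monotone fun k => f k t) {ε : ℝ} (hε : 0 < ε) :
    ∃ K, ∀ i, K ≤ i → ∀ j, K ≤ j →
      (τ (star (cfc (f i) h - cfc (f j) h) * (cfc (f i) h - cfc (f j) h))).re ≤ ε := by
  have hsa : ∀ k, IsSelfAdjoint (cfc (f k) h) := fun k => IsSelfAdjoint.cfc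
  set v : ℕ → ℝ := fun k => (τ (cfc (f k) h)).re with hv
  have hvm : Monotone v := fun i j hij => hτ.re_mono (hsa i) (hsa j)
    (cfc_mono (fun t _ => hm t hij) (hf i).continuousOn (hf j).continuousOn)
  have hvb : BddAbove (Set.range v) := ⟨(τ 1).re, by
    rintro _ ⟨k, rfl⟩
    exact hτ.re_mono (hsa k) (IsSelfAdjoint.one B) (cfc_le_one _ _ fun t _ => (hf01 k t).2)⟩
  obtain ⟨K, hK⟩ := Metric.cauchySeq_iff.1 (tendsto_atTop_ciSup hvm hvb).cauchySeq ε hε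
  -- The difference `d` of the two functions satisfies `0 ≤ d ≤ 1`, hence `d² ≤ d`.
  have key : ∀ i j, j ≤ i → (τ (star (cfc (f i) h - cfc (f j) h) *
      (cfc (f i) h - cfc (f j) h))).re ≤ v i - v j := fun i j hij => by
    have e1 : cfc (f i) h - cfc (f j) h = cfc (fun t => f i t - f j t) h :=
      (cfc_sub _ _ h (hf i).continuousOn (hf j).continuousOn).symm
    have e2 : τ (cfc (fun t => f i t - f j t) h) = τ (cfc (f i) h) - τ (cfc (f j) h) := by
      rw [← e1, hτ.sub_of_commute (hsa i) (hsa j) (cfc_commute_cfc _ _ _)]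
    rw [e1, (IsSelfAdjoint.cfc (f := fun t => f i t - f j t) (a := h)).star_eq,
      ← cfc_mul (fun t => f i t - f j t) (fun t => f i t - f j t) h ((hf i).sub (hf j)).continuousOn ((hf i).sub (hf j)).continuousOn]
    simp only [hv]
    rw [← Complex.sub_re, ← e2]
    refine hτ.re_mono IsSelfAdjoint.cfc IsSelfAdjoint.cfc (cfc_mono (fun t _ => ?_)
      (((hf i).sub (hf j)).mul ((hf i).sub (hf j))).continuousOn ((hf i).sub (hf j)).continuousOn)
    have h1 := hm t hij
    simp only at h1
    nlinarith [hf01 i t, hf01 j t]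
  refine ⟨K, fun i hi j hj => ?_⟩
  have hd := (hK i hi j hj).le
  rw [Real.dist_eq] at hd
  rcases le_total j i with hij | hij
  · exact (key i j hij).trans ((le_abs_self _).trans hd)
  · rw [← neg_sub (cfc (f j) h), star_neg, neg_mul_neg]
    refine (key j i hij).trans (le_trans ?_ hd)
    rw [← neg_sub]
    exact neg_le_abs _

theorem IsOneQuasitrace.extendPositive_re {τ : B → ℂ} (hτ : IsOneQuasitrace τ) (x : B) :
    extendPositive (fun a => (τ a).re) x = τ x := by
  have key : ∀ a : B, IsSelfAdjoint a → (((τ a⁺).re - (τ a⁻).re : ℝ) : ℂ) = τ a := by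
    intro a ha
    have hp := (CFC.posPart_nonneg a).isSelfAdjoint
    have hn := (CFC.negPart_nonneg a).isSelfAdjoint
    have hc : Commute (a⁺) (a⁻) := by
      rw [commute_iff_eq, CFC.posPart_mul_negPart, CFC.negPart_mul_posPart]
    conv_rhs => rw [← CFC.posPart_sub_negPart a ha]
    rw [hτ.sub_of_commute hp hn hc, hτ.eq_re hp, hτ.eq_re hn]
    simp
  rw [extendPositive, key _ (realPart x).2, key _ (imaginaryPart x).2,
    ← hτ.map_add_I_smul _ _ (realPart x).2 (imaginaryPart x).2, realPart_add_I_smul_imaginaryPart]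

/-- Such a map preserves positivity, hence positive and negative parts by uniqueness of the
orthogonal decomposition. No unit is required: besides quotient maps, the corner embedding `x ↦ x ⊗
e₁₁` is intended. -/
theorem extendPositive_map {A : Type*} [CStarAlgebra A] [PartialOrder A] [StarOrderedRing A]
    (φ : A → B) (hsub : ∀ x y, φ (x - y) = φ x - φ y) (hmul : ∀ x y, φ (x * y) = φ x * φ y)
    (hstar : ∀ x, φ (star x) = star (φ x)) (hsmul : ∀ (r : ℂ) x, φ (r • x) = r • φ x)
    {σ : A → ℝ} {ρ : B → ℝ} (h : ∀ a, 0 ≤ a → ρ (φ a) = σ a) (x : A) :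
    extendPositive ρ (φ x) = extendPositive σ x := by
  have hz : φ 0 = 0 := by simpa using hsub 0 0
  have hneg : ∀ x, φ (-x) = -φ x := fun x => by simpa [hz] using hsub 0 x
  have hadd : ∀ x y, φ (x + y) = φ x + φ y := fun x y => by
    have := hsub x (-y)
    rwa [hneg, sub_neg_eq_add, sub_neg_eq_add] at this
  have hpos : ∀ a, 0 ≤ a → 0 ≤ φ a := fun a ha => by
    obtain ⟨y, rfl⟩ := CStarAlgebra.nonneg_iff_eq_star_mul_self.1 ha
    rw [hmul, hstar]
    exact star_mul_self_nonneg _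
  have hre : (realPart (φ x) : B) = φ (realPart x : A) := by
    rw [realPart_apply_coe, realPart_apply_coe, ← Complex.coe_smul, ← Complex.coe_smul, hsmul, hadd,
      hstar]
  have him : (imaginaryPart (φ x) : B) = φ (imaginaryPart x : A) := by
    rw [imaginaryPart_apply_coe, imaginaryPart_apply_coe, ← Complex.coe_smul, ← Complex.coe_smul,
      hsmul, hsmul, hsub, hstar]
  have hparts : ∀ a : A, IsSelfAdjoint a → (φ a)⁺ = φ a⁺ ∧ (φ a)⁻ = φ a⁻ := fun a ha => by
    obtain ⟨h1, h2⟩ := CFC.posPart_negPart_unique (a := φ a) (b := φ a⁺) (c := φ a⁻)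
      (by rw [← hsub, CFC.posPart_sub_negPart a ha])
      (by rw [← hmul, CFC.posPart_mul_negPart, hz]) (hpos _ (CFC.posPart_nonneg a))
      (hpos _ (CFC.negPart_nonneg a))
    exact ⟨h1, h2⟩
  have pp := CFC.posPart_nonneg (A := A)
  have nn := CFC.negPart_nonneg (A := A)
  rw [extendPositive, extendPositive, hre, him, (hparts _ (realPart x).2).1,
    (hparts _ (realPart x).2).2, (hparts _ (imaginaryPart x).2).1, (hparts _ (imaginaryPart x).2).2,
    h _ (pp _), h _ (nn _), h _ (pp _), h _ (nn _)]

end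

/-! ### The quotient by the null elements -/

section Quotient

variable {E Q : Type*} [CStarAlgebra E] [PartialOrder E] [StarOrderedRing E]
  [CStarAlgebra Q] [PartialOrder Q] [StarOrderedRing Q] {π : CStarHom E Q} {τ : E → ℂ}

namespace IsQuasitrace

/-- All lifts compute `infLift` if the kernel consists of null elements. -/
theorem infLift_map (hτ : IsQuasitrace τ) (hker : ∀ x, π x = 0 → (τ (star x * x)).re = 0) {h : E}
    (hh : 0 ≤ π h) (hπ : Function.Surjective π) : infLift π τ (π h) = (τ h).re := by
  have key : ∀ k, π k = π h → (τ k).re = (τ h).re := fun k hk => by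
    rw [hτ.eq_of_null (x := k) (y := h)]
    rw [hτ.mem_nullIdeal]
    exact hker _ (by rw [map_sub, hk, sub_self])
  obtain ⟨k, hk, hkh⟩ := exists_nonneg_lift hπ hh
  have : {r : ℝ | ∃ k : E, 0 ≤ k ∧ π k = π h ∧ (τ k).re = r} = {(τ h).re} := by
    ext r
    refine ⟨?_, ?_⟩
    · rintro ⟨k, -, hk, rfl⟩
      exact key k hk
    · rintro rfl
      exact ⟨k, hk, hkh, key k hkh⟩
  rw [infLift, this, csInf_singleton]

theorem extendPositive_infLift (hτ : IsQuasitrace τ)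
    (hker : ∀ x, π x = 0 → (τ (star x * x)).re = 0) (hπ : Function.Surjective π) (x : E) :
    extendPositive (infLift π τ) (π x) = τ x := by
  rw [extendPositive_map π (map_sub π) (map_mul π) (map_star π) (map_smul π)
    (σ := fun a => (τ a).re)]
  · exact hτ.toIsOneQuasitrace.extendPositive_re x
  · intro a ha
    refine hτ.infLift_map hker ?_ hπ
    simpa using map_nonneg π ha

theorem infLift_star_mul_self (hτ : IsQuasitrace τ)
    (hker : ∀ x, π x = 0 → (τ (star x * x)).re = 0) (hπ : Function.Surjective π) (x : E) :
    infLift π τ (star (π x) * π x) = (τ (star x * x)).re := by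
  rw [← map_star, ← map_mul]
  refine hτ.infLift_map hker ?_ hπ
  rw [map_mul, map_star]
  exact star_mul_self_nonneg _

/-- The identity `N (π x) = τ (x⋆x)` transports estimates from `E`. Lifts of controlled norm turn
bounded Cauchy sequences in `Q` into bounded ones in `E`, to which `hc` applies. -/
theorem isCompleteSqNorm_infLift (hτ : IsQuasitrace τ)
    (hker : ∀ x, π x = 0 ↔ (τ (star x * x)).re = 0)
    (hπ : ∀ a : Q, ∃ x, π x = a ∧ ‖x‖ ≤ ‖a‖ + 1)
    (hc : ∀ x : ℕ → E, (∃ R, ∀ k, ‖x k‖ ≤ R) →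
      (∀ ε > 0, ∃ K, ∀ i, K ≤ i → ∀ j, K ≤ j →
        (τ (star (x i - x j) * (x i - x j))).re ≤ ε) →
      ∃ y, Tendsto (fun i => (τ (star (x i - y) * (x i - y))).re) atTop (𝓝 0)) :
    IsCompleteSqNorm (fun a : Q => infLift π τ (star a * a)) 4 := by
  have hs : Function.Surjective π := fun a => (hπ a).imp fun _ h => h.1
  have hN := hτ.infLift_star_mul_self (fun x => (hker x).1) hs
  have h1 := hτ.toIsOneQuasitrace
  have hσ := isPositiveQuasitrace_infLift h1 hs
  have hN0 : ∀ a : Q, 0 ≤ infLift π τ (star a * a) := fun a =>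
    hσ.nonneg _ (star_mul_self_nonneg a)
  refine ⟨hN0, fun a ha => ?_, fun a b => ?_, fun a => ?_,
    fun a b => ?_, fun a ⟨R, hR⟩ hac => ?_, fun a ha f hf hf01 hm ε hε => ?_⟩
  · obtain ⟨x, rfl⟩ := hs a
    rwa [hN, ← hker] at ha
  · obtain ⟨x, rfl⟩ := hs a
    obtain ⟨y, rfl⟩ := hs b
    rw [← map_add, hN, hN, hN]
    exact hτ.re_star_mul_self_add_le x y
  · rw [star_star, ← hσ.tracial]
    linarith [hN0 a]
  · have hle : star (a * b) * (a * b) ≤ ‖a‖ ^ 2 • (star b * b) := by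
      have h := star_left_conjugate_le_conjugate
        (CStarAlgebra.star_mul_le_algebraMap_norm_sq (a := a)) b
      rw [Algebra.algebraMap_eq_smul_one, mul_smul_comm, mul_one, smul_mul_assoc] at h
      calc star (a * b) * (a * b) = star b * (star a * a) * b := by
            rw [star_mul]; simp only [mul_assoc]
        _ ≤ _ := h
    have h2 := hσ.mono _ _ (star_mul_self_nonneg _) hle
    rw [hσ.smul _ _ (by positivity) (star_mul_self_nonneg b)] at h2
    have h3 : 0 ≤ ‖a‖ ^ 2 * infLift π τ (star b * b) := mul_nonneg (by positivity) (hN0 b)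
    linarith
  · choose x hx hxn using fun k => hπ (a k)
    obtain ⟨y, hy⟩ := hc x ⟨R + 1, fun k => (hxn k).trans (by linarith [hR k])⟩ (fun ε hε => by
      obtain ⟨K, hK⟩ := hac ε hε
      refine ⟨K, fun i hi j hj => ?_⟩
      have := hK i hi j hj
      rwa [← hx i, ← hx j, ← map_sub, hN] at this)
    refine ⟨π y, hy.congr fun i => ?_⟩
    rw [← hx i, ← map_sub, hN]
  · obtain ⟨h, hh, rfl⟩ := exists_nonneg_lift hs ha
    obtain ⟨K, hK⟩ := h1.cauchy_cfc h hf hf01 hm hε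
    refine ⟨K, fun i hi j hj => ?_⟩
    rw [← π.map_cfc_real hh.isSelfAdjoint (hf i), ← π.map_cfc_real hh.isSelfAdjoint (hf j),
      ← map_sub, hN]
    exact hK i hi j hj

end IsQuasitrace

end Quotient

/-! ### Passage to two-by-two matrices -/

open CStarMatrix in
/-- The amplification of a `*`-homomorphism to two-by-two matrices. -/
noncomputable def CStarMatrix.mapHom {E Q : Type*} [CStarAlgebra E] [PartialOrder E]
    [StarOrderedRing E] [CStarAlgebra Q] [PartialOrder Q] [StarOrderedRing Q] (π : CStarHom E Q) :
    CStarHom (CStarMatrix (Fin 2) (Fin 2) E) (CStarMatrix (Fin 2) (Fin 2) Q) where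
  toFun x := x.map π
  map_one' := by
    ext i j
    rw [CStarMatrix.map_apply, one_apply, one_apply]
    split_ifs <;> simp
  map_mul' x y := by
    ext i j
    simp only [CStarMatrix.map_apply, mul_apply, map_sum, map_mul]
  map_zero' := by
    ext i j
    exact map_zero π
  map_add' x y := by
    ext i j
    exact map_add π _ _
  commutes' r := by
    ext i j
    rw [CStarMatrix.map_apply, algebraMap_apply, algebraMap_apply]
    split_ifs
    · exact AlgHomClass.commutes π r
    · exact map_zero π
  map_star' x := by
    ext i j
    simp only [CStarMatrix.map_apply, star_apply, map_star]

section

open CStarMatrix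

variable {E Q : Type*} [CStarAlgebra E] [PartialOrder E] [StarOrderedRing E]
  [CStarAlgebra Q] [PartialOrder Q] [StarOrderedRing Q] {π : CStarHom E Q} {τ : E → ℂ}

theorem CStarMatrix.mapHom_apply (x : CStarMatrix (Fin 2) (Fin 2) E) (i j : Fin 2) :
    CStarMatrix.mapHom π x i j = π (x i j) := rfl

theorem CStarMatrix.mapHom_of2 (a b c d : E) :
    CStarMatrix.mapHom π (of2 a b c d) = of2 (π a) (π b) (π c) (π d) := by
  ext i j
  fin_cases i <;> fin_cases j <;> rfl

theorem CStarMatrix.mapHom_surjective (hπ : Function.Surjective π) :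
    Function.Surjective (CStarMatrix.mapHom π) := fun x => by
  choose f hf using hπ
  exact ⟨of2 (f (x 0 0)) (f (x 0 1)) (f (x 1 0)) (f (x 1 1)), by
    rw [mapHom_of2, hf, hf, hf, hf, ← eq_of2]⟩

/-- Completeness is checked entry by entry, hence the sum over entries. The functional calculus does
not act on entries, so its Cauchy property is a separate hypothesis. In a product, each entry costs
`4` for the sum and `4` for the factor, and two rows give `32`. -/
theorem IsCompleteSqNorm.matrix {N : Q → ℝ} (hN : IsCompleteSqNorm N 4)
    (hcfc : ∀ r s, CauchyCfc fun x : CStarMatrix (Fin 2) (Fin 2) Q => N (x r s)) :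
    IsCompleteSqNorm (fun x : CStarMatrix (Fin 2) (Fin 2) Q =>
      N (x 0 0) + N (x 0 1) + (N (x 1 0) + N (x 1 1))) 32 := by
  refine ⟨fun x => ?_, fun x hx => ?_, fun x y => ?_, fun x => ?_, fun a x => ?_,
    fun x ⟨R, hR⟩ hx => ?_, fun a ha f hf hf01 hm ε hε => ?_⟩
  · have := fun i j => hN.nonneg (x i j)
    linarith [this 0 0, this 0 1, this 1 0, this 1 1]
  · have h0 := fun i j => hN.nonneg (x i j)
    rw [eq_of2 x, hN.eq_zero (x 0 0) (by linarith [h0 0 0, h0 0 1, h0 1 0, h0 1 1]),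
      hN.eq_zero (x 0 1) (by linarith [h0 0 0, h0 0 1, h0 1 0, h0 1 1]),
      hN.eq_zero (x 1 0) (by linarith [h0 0 0, h0 0 1, h0 1 0, h0 1 1]),
      hN.eq_zero (x 1 1) (by linarith [h0 0 0, h0 0 1, h0 1 0, h0 1 1])]
    ext i j
    fin_cases i <;> fin_cases j <;> rfl
  · have h0 := fun i j => hN.nonneg (x i j)
    have h0' := fun i j => hN.nonneg (y i j)
    have h1 : ∀ i j, N ((x + y) i j) ≤ 4 * (N (x i j) + N (y i j)) := fun i j =>
      hN.add_le (x i j) (y i j)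
    linarith [h1 0 0, h1 0 1, h1 1 0, h1 1 1, h0 0 0, h0 0 1, h0 1 0, h0 1 1, h0' 0 0, h0' 0 1,
      h0' 1 0, h0' 1 1]
  · have h0 := fun i j => hN.nonneg (x i j)
    have h1 : ∀ i j, N ((star x) i j) ≤ 4 * N (x j i) := fun i j => hN.star_le (x j i)
    linarith [h1 0 0, h1 0 1, h1 1 0, h1 1 1, h0 0 0, h0 0 1, h0 1 0, h0 1 1]
  · have h0 := fun i j => hN.nonneg (x i j)
    have h1 : ∀ i j k, N (a i k * x k j) ≤ 4 * (‖a‖ ^ 2 * N (x k j)) := fun i j k => by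
      refine (hN.mul_left_le _ _).trans ?_
      rw [mul_assoc]
      gcongr
      · exact hN.nonneg _
      · exact norm_entry_le_norm
    have h2 : ∀ i j, N ((a * x) i j) ≤
        16 * (‖a‖ ^ 2 * N (x 0 j)) + 16 * (‖a‖ ^ 2 * N (x 1 j)) := fun i j => by
      rw [CStarMatrix.mul_apply, Fin.sum_univ_two]
      refine (hN.add_le _ _).trans ?_
      linarith [h1 i j 0, h1 i j 1]
    linarith [h2 0 0, h2 0 1, h2 1 0, h2 1 1]
  · have h0 := fun (z : CStarMatrix (Fin 2) (Fin 2) Q) i j => hN.nonneg (z i j)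
    have hent : ∀ (z : CStarMatrix (Fin 2) (Fin 2) Q) i j,
        N (z i j) ≤ N (z 0 0) + N (z 0 1) + (N (z 1 0) + N (z 1 1)) := fun z i j => by
      fin_cases i <;> fin_cases j <;> simp <;>
        linarith [h0 z 0 0, h0 z 0 1, h0 z 1 0, h0 z 1 1]
    have hy : ∀ i j, ∃ y, Tendsto (fun k => N (x k i j - y)) atTop (𝓝 0) := fun i j => by
      refine hN.complete _ ⟨R, fun k => norm_entry_le_norm.trans (hR k)⟩ fun ε hε => ?_
      obtain ⟨K, hK⟩ := hx ε hε
      exact ⟨K, fun k hk l hl => (hent (x k - x l) i j).trans (hK k hk l hl)⟩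
    choose y hy using hy
    refine ⟨ofMatrix y, ?_⟩
    have := ((hy 0 0).add (hy 0 1)).add ((hy 1 0).add (hy 1 1))
    simp only [add_zero] at this
    exact this
  · choose K hK using fun r s => hcfc r s a ha f hf hf01 hm (ε / 4) (by positivity)
    refine ⟨max (max (K 0 0) (K 0 1)) (max (K 1 0) (K 1 1)), fun i hi j hj => ?_⟩
    simp only [max_le_iff] at hi hj
    linarith [hK 0 0 i hi.1.1 j hj.1.1, hK 0 1 i hi.1.2 j hj.1.2, hK 1 0 i hi.2.1 j hj.2.1,
      hK 1 1 i hi.2.2 j hj.2.2]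

namespace IsQuasitrace

/-- A quasitrace on a C⋆-algebra whose bounded sets are complete for the `2`-norm induces a faithful
normal quasitrace on the quotient by the null elements, which is a finite AW⋆-algebra. -/
theorem exists_quotient (hτ : IsQuasitrace τ)
    (hker : ∀ x, π x = 0 ↔ (τ (star x * x)).re = 0)
    (hπ : ∀ a : Q, ∃ x, π x = a ∧ ‖x‖ ≤ ‖a‖ + 1)
    (hc : ∀ x : ℕ → E, (∃ R, ∀ k, ‖x k‖ ≤ R) →
      (∀ ε > 0, ∃ K, ∀ i, K ≤ i → ∀ j, K ≤ j →
        (τ (star (x i - x j) * (x i - x j))).re ≤ ε) →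
      ∃ y, Tendsto (fun i => (τ (star (x i - y) * (x i - y))).re) atTop (𝓝 0)) :
    IsAWStarAlgebra Q ∧ IsFiniteCStarAlgebra Q ∧ ∃ ρ : Q → ℂ, (∀ x, ρ (π x) = τ x) ∧
      IsQuasitrace ρ ∧ IsFaithfulQuasitrace ρ ∧ IsNormalQuasitrace ρ := by
  have hs : Function.Surjective π := fun a => (hπ a).imp fun _ h => h.1
  have hker' := fun x => (hker x).1
  have h1 := hτ.toIsOneQuasitrace
  have hσ := isPositiveQuasitrace_infLift h1 hs
  have hN := hτ.isCompleteSqNorm_infLift hker hπ hc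
  have hQ := hN.hasSupports
  set ρ : Q → ℂ := extendPositive (infLift π τ) with hρ
  have hρ1 : IsOneQuasitrace ρ := hσ.isOneQuasitrace_extendPositive hQ
  have hρN : (fun a : Q => (ρ (star a * a)).re) = fun a => infLift π τ (star a * a) :=
    funext fun a => by
      rw [hρ, hσ.extendPositive_of_nonneg (star_mul_self_nonneg a), Complex.ofReal_re]
  have hnormal : IsNormalQuasitrace ρ := hρ1.isNormalQuasitrace (C := 4) (by rw [hρN]; exact hN)
  have hfaith : IsFaithfulQuasitrace ρ := fun a ha => by
    refine hN.eq_zero a ?_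
    rw [← congrFun hρN a]
    simp only [ha, Complex.zero_re]
  refine ⟨hQ.isAWStarAlgebra fun P h h' => (hnormal P h h').imp fun _ hp => hp.1,
    hρ1.isFiniteCStarAlgebra hfaith, ρ, hτ.extendPositive_infLift hker' hs, ⟨hρ1, ?_⟩, hfaith,
    hnormal⟩
  obtain ⟨τ₂, h₂, h12⟩ := hτ.exists_of2
  have hs₂ := CStarMatrix.mapHom_surjective hs
  have hσ₂ := isPositiveQuasitrace_infLift (π := CStarMatrix.mapHom π) h₂ hs₂
  -- Functional calculus sequences lift to matrices over `E`, where they are Cauchy for `τ₂`; the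
  -- `2`-norm for `τ₂` dominates that of each entry for `τ`.
  have hQ₂ : HasSupports (CStarMatrix (Fin 2) (Fin 2) Q) := by
    refine (hN.matrix fun r s a ha f hf hf01 hm ε hε => ?_).hasSupports
    obtain ⟨h, hh, rfl⟩ := exists_nonneg_lift hs₂ ha
    obtain ⟨K, hK⟩ := h₂.cauchy_cfc h hf hf01 hm hε
    refine ⟨K, fun i hi j hj => ?_⟩
    rw [← StarAlgHom.map_cfc_real _ hh.isSelfAdjoint (hf i),
      ← StarAlgHom.map_cfc_real _ hh.isSelfAdjoint (hf j), ← map_sub]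
    exact (hτ.infLift_star_mul_self hker' hs _).trans_le
      ((re_entry_le h₂ h12 _ r s).trans (hK i hi j hj))
  refine ⟨extendPositive (infLift (CStarMatrix.mapHom π) τ₂),
    hσ₂.isOneQuasitrace_extendPositive hQ₂, fun x => ?_⟩
  have hz : (0 : Q) = π 0 := (map_zero π).symm
  refine (extendPositive_map (fun x : Q => of2 x 0 0 0) (fun x y => ?_) (fun x y => ?_)
    (fun x => ?_) (fun r x => ?_) (fun a ha => ?_) x).symm
  · rw [of2_sub]; simp
  · rw [of2_mul]; simp
  · rw [star_of2]; simp
  · ext i j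
    fin_cases i <;> fin_cases j
    · rfl
    all_goals exact (smul_zero r).symm
  · obtain ⟨h, hh, rfl⟩ := exists_nonneg_lift hs ha
    rw [hτ.infLift_map hker' ha hs]
    have hlift : of2 (π h) 0 0 0 = CStarMatrix.mapHom π (of2 h 0 0 0) := by
      rw [mapHom_of2, map_zero]
    have hh2 : 0 ≤ of2 h 0 0 0 := by
      obtain ⟨y, rfl⟩ := CStarAlgebra.nonneg_iff_eq_star_mul_self.1 hh
      have : of2 (star y * y) 0 0 0 = star (of2 y 0 0 0) * of2 y 0 0 0 := by
        rw [star_of2, of2_mul]; simp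
      rw [this]
      exact star_mul_self_nonneg _
    refine le_antisymm ?_ (le_csInf ⟨_, _, hh2, hlift.symm, rfl⟩ ?_)
    · rw [hlift, h12]
      exact infLift_le h₂ hh2
    -- Compression to the upper left corner does not increase `τ₂`, and the corner of `H` has the
    -- same value under `τ` as `h`, as they differ by a null element.
    · rintro r ⟨H, hH, hHh, rfl⟩
      have e1 : π (H 0 0) = π h := by
        rw [← mapHom_apply, hHh]; rfl
      have e2 : τ (H 0 0) = τ h := hτ.eq_of_null <| by
        rw [hτ.mem_nullIdeal]
        exact hker' _ (by rw [map_sub, e1, sub_self])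
      have e3 : star (of2 1 0 0 0 : CStarMatrix (Fin 2) (Fin 2) E) * H * of2 1 0 0 0 =
          of2 (H 0 0) 0 0 0 := by
        nth_rw 1 [eq_of2 H]
        rw [star_of2, of2_mul, of2_mul]; simp
      have e4 : ‖(of2 1 0 0 0 : CStarMatrix (Fin 2) (Fin 2) E)‖ ≤ 1 := by
        refine norm_of2_le_one_of_star_mul_self ⟨?_, IsSelfAdjoint.star_mul_self _⟩
        rw [IsIdempotentElem, star_of2, of2_mul, of2_mul]; simp
      have e5 := h₂.re_conj_le hH (of2 1 0 0 0)
      rw [e3, ← h12, e2] at e5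
      have e6 := h₂.re_nonneg hH
      have e7 := pow_le_one₀ (n := 2) (norm_nonneg _) e4
      nlinarith

end IsQuasitrace

end

/-! ### Ultraproducts of quasitraces -/

section Ultralimit

variable {ι : Type*} {E : Type*} [CStarAlgebra E] {B : ι → Type*} [∀ i, CStarAlgebra (B i)]
  [∀ i, PartialOrder (B i)] [∀ i, StarOrderedRing (B i)] {φ : ∀ i, CStarHom E (B i)}
  {τ : ∀ i, B i → ℂ} (U : Ultrafilter ι)

/-- The limit along an ultrafilter of the pull-backs of uniformly bounded quasitraces is a
quasitrace. -/
theorem exists_isOneQuasitrace_ultralimit (φ : ∀ i, CStarHom E (B i))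
    (hτ : ∀ i, IsOneQuasitrace (τ i)) {M : ℝ} (hM : ∀ i, (τ i 1).re ≤ M) :
    ∃ ρ : E → ℂ, (∀ x, Tendsto (fun i => τ i (φ i x)) U (𝓝 (ρ x))) ∧ IsOneQuasitrace ρ := by
  have hlim : ∀ x : E, ∃ c : ℂ, Tendsto (fun i => τ i (φ i x)) U (𝓝 c) := fun x => by
    -- The values lie in a fixed compact disc, by `norm_le`.
    obtain ⟨c, -, hc⟩ := (isCompact_closedBall (0 : ℂ) (2 * ‖x‖ * M)).ultrafilter_le_nhds
      (U.map fun i => τ i (φ i x)) (by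
        rw [le_principal_iff, Ultrafilter.coe_map, Filter.mem_map]
        refine Filter.univ_mem' fun i => ?_
        simp only [Set.mem_preimage, Metric.mem_closedBall, dist_zero_right]
        refine ((hτ i).norm_le _).trans ?_
        have h1 : ‖φ i x‖ ≤ ‖x‖ := NonUnitalStarAlgHom.norm_apply_le (φ i) x
        have h2 := (hτ i).re_one_nonneg
        have h3 := hM i
        gcongr)
    exact ⟨c, hc⟩
  choose ρ hρ using hlim
  refine ⟨ρ, hρ, ⟨fun x => ?_, fun x => ?_, fun a b ha hb => ?_, fun C _ hC => ?_⟩⟩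
  · refine tendsto_nhds_unique (hρ _) ((hρ _).congr fun i => ?_)
    rw [map_mul, map_mul, map_star, (hτ i).tracial]
  · refine ge_of_tendsto' (hρ _) fun i => ?_
    rw [map_mul, map_star]
    exact (hτ i).nonneg _
  · refine tendsto_nhds_unique (hρ _) (((hρ a).add ((hρ b).const_mul Complex.I)).congr fun i => ?_)
    rw [map_add, map_smul, (hτ i).map_add_I_smul _ _ (ha.map (φ i)) (hb.map (φ i))]
  -- The image of `C` is only used as a commutative selfadjoint set; its closedness plays no role.
  · have hlin := fun i => (hτ i).linear_of_commuting (S := φ i '' C)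
      (by
        rintro _ ⟨x, hx, rfl⟩
        exact ⟨star x, star_mem (s := C) hx, map_star _ _⟩)
      (by
        rintro _ ⟨x, hx, rfl⟩ _ ⟨y, hy, rfl⟩
        rw [← map_mul, hC x hx y hy, map_mul])
    refine ⟨fun x hx y hy => tendsto_nhds_unique (hρ _) (((hρ x).add (hρ y)).congr fun i => ?_),
      fun r x hx => tendsto_nhds_unique (hρ _) (((hρ x).const_mul r).congr fun i => ?_)⟩
    · rw [map_add, (hlin i).1 _ ⟨x, hx, rfl⟩ _ ⟨y, hy, rfl⟩]
    · rw [map_smul, (hlin i).2 r _ ⟨x, hx, rfl⟩]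

/-- The limit of the functions on matrices is the required witness. It exists because `1 = e₁₁ +
e₂₂` and traciality give `τ₂ 1 = 2 τ 1`. -/
theorem exists_isQuasitrace_ultralimit [PartialOrder E] [StarOrderedRing E]
    (φ : ∀ i, CStarHom E (B i)) (hτ : ∀ i, IsQuasitrace (τ i)) {M : ℝ}
    (hM : ∀ i, (τ i 1).re ≤ M) :
    ∃ ρ : E → ℂ, (∀ x, Tendsto (fun i => τ i (φ i x)) U (𝓝 (ρ x))) ∧ IsQuasitrace ρ := by
  obtain ⟨ρ, hρ, hρ1⟩ := exists_isOneQuasitrace_ultralimit U φ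
    (fun i => (hτ i).toIsOneQuasitrace) hM
  choose τ₂ h₂ h12 using fun i => (hτ i).exists_of2
  have hbound : ∀ i, (τ₂ i 1).re ≤ 2 * M := fun i => by
    have e1 : (1 : CStarMatrix (Fin 2) (Fin 2) (B i)) =
        CStarMatrix.of2 1 0 0 0 + CStarMatrix.of2 0 0 0 1 := by
      rw [CStarMatrix.of2_add]
      ext r s
      fin_cases r <;> fin_cases s <;> simp [CStarMatrix.of2]
    have e2 : star (CStarMatrix.of2 0 (1 : B i) 0 0) * CStarMatrix.of2 0 1 0 0 =
        CStarMatrix.of2 0 0 0 1 := by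
      rw [CStarMatrix.star_of2, CStarMatrix.of2_mul]; simp
    have e3 : CStarMatrix.of2 0 (1 : B i) 0 0 * star (CStarMatrix.of2 0 1 0 0) =
        CStarMatrix.of2 1 0 0 0 := by
      rw [CStarMatrix.star_of2, CStarMatrix.of2_mul]; simp
    have e4 : Commute (CStarMatrix.of2 (1 : B i) 0 0 0) (CStarMatrix.of2 0 0 0 1) := by
      rw [commute_iff_eq, CStarMatrix.of2_mul, CStarMatrix.of2_mul]; simp
    have e5 := (h₂ i).add_of_commute
      (CStarMatrix.isSelfAdjoint_of2_left (IsSelfAdjoint.one (B i)))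
      (CStarMatrix.isSelfAdjoint_of2_right (IsSelfAdjoint.one (B i))) e4
    have e6 := (h₂ i).tracial (CStarMatrix.of2 0 1 0 0)
    rw [e2, e3] at e6
    rw [← e1, e6, ← h12] at e5
    rw [e5, Complex.add_re]
    linarith [hM i]
  obtain ⟨ρ₂, hρ₂, hρ21⟩ := exists_isOneQuasitrace_ultralimit U
    (fun i => CStarMatrix.mapHom (φ i)) h₂ hbound
  refine ⟨ρ, hρ, hρ1, ρ₂, hρ21, fun x => tendsto_nhds_unique (hρ x) ((hρ₂ _).congr fun i => ?_)⟩
  change τ₂ i (CStarMatrix.mapHom (φ i) (CStarMatrix.of2 x 0 0 0)) = _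
  rw [CStarMatrix.mapHom_of2, map_zero, ← h12]

end Ultralimit

/-! ### Bounded sequences and the diagonal argument -/

section BoundedSequences

variable {A : ℕ → Type*} [∀ n, CStarAlgebra (A n)]

/-- Evaluation of a bounded sequence. -/
noncomputable def lpEval {ι : Type*} (A : ι → Type*) [∀ i, CStarAlgebra (A i)]
    [∀ i, Nontrivial (A i)] (i : ι) : CStarHom (lp A ∞) (A i) where
  toFun x := x i
  map_one' := rfl
  map_mul' _ _ := rfl
  map_zero' := rfl
  map_add' _ _ := rfl
  commutes' _ := rfl
  map_star' _ := rfl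

/-- The limit along a free ultrafilter of a sequence of functions `N n` on the algebras `A n` makes
norm-bounded sets in `ℓ^∞{A_n}` complete. -/
theorem exists_limit_of_cauchy {U : Ultrafilter ℕ} (hU : (U : Filter ℕ) ≤ cofinite)
    {N : ∀ n, A n → ℝ} {L : lp A ∞ → ℝ}
    (hL : ∀ x : lp A ∞, Tendsto (fun n => N n (x n)) U (𝓝 (L x))) (hL0 : ∀ x, 0 ≤ L x)
    {x : ℕ → lp A ∞} {R : ℝ} (hR : ∀ k, ‖x k‖ ≤ R)
    (hx : ∀ ε > 0, ∃ K, ∀ i, K ≤ i → ∀ j, K ≤ j → L (x i - x j) ≤ ε) :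
    ∃ y, Tendsto (fun i => L (x i - y)) atTop (𝓝 0) := by
  classical
  -- At coordinate `n`, the terms up to `k` satisfy the limiting estimates within `1 / (k + 1)`. For
  -- fixed `k` this holds along the ultrafilter; freeness is used for `k ≤ n`.
  set D : ℕ → ℕ → Prop := fun k n =>
    k ≤ n ∧ ∀ i ≤ k, ∀ j ≤ k, N n (x i n - x j n) ≤ L (x i - x j) + 1 / (k + 1 : ℝ) with hD
  have hDU : ∀ k, ∀ᶠ n in (U : Filter ℕ), D k n := fun k => by
    refine Eventually.and ?_ ?_
    · rw [Nat.cofinite_eq_atTop] at hU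
      exact hU (eventually_ge_atTop k)
    · refine (eventually_all_finite (Set.finite_Iic k)).2 fun i _ =>
        (eventually_all_finite (Set.finite_Iic k)).2 fun j _ => ?_
      have h0 : 0 < 1 / (k + 1 : ℝ) := by positivity
      exact (hL (x i - x j)).eventually (eventually_le_nhds (by linarith))
  -- The limit takes at coordinate `n` the term of largest index `κ n` for which the estimates hold
  -- there.
  set κ : ℕ → ℕ := fun n => Nat.findGreatest (fun k => D k n) n with hκ
  have hκD : ∀ k n, D k n → k ≤ κ n ∧ D (κ n) n := fun k n h =>
    ⟨Nat.le_findGreatest h.1 h, Nat.findGreatest_spec (P := fun k => D k n) h.1 h⟩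
  have hmem : Memℓp (fun n => x (κ n) n) ∞ := by
    refine memℓp_infty ⟨R, ?_⟩
    rintro _ ⟨n, rfl⟩
    exact (lp.norm_apply_le_norm ENNReal.top_ne_zero (x (κ n)) n).trans (hR _)
  set y : lp A ∞ := ⟨fun n => x (κ n) n, hmem⟩ with hy
  refine ⟨y, tendsto_order.2 ⟨fun a ha => Eventually.of_forall fun i => ha.trans_le (hL0 _),
    fun a ha => ?_⟩⟩
  obtain ⟨K, hK⟩ := hx (a / 3) (by positivity)
  filter_upwards [eventually_ge_atTop K] with i hi
  obtain ⟨m, hm⟩ := exists_nat_one_div_lt (show 0 < a / 3 by positivity)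
  have : L (x i - y) ≤ a / 3 + a / 3 := by
    -- On this set of `n`, `κ n` is at least `i`, `K` and `m`, so the estimate for the pair `(i, κ
    -- n)` applies with both errors at most `a / 3`.
    refine le_of_tendsto (hL _) ((hDU (max i (max K m))).mono fun n hn => ?_)
    obtain ⟨h1, h2⟩ := hκD _ n hn
    simp only [max_le_iff] at h1
    refine (h2.2 i h1.1 (κ n) le_rfl).trans (add_le_add (hK i hi _ h1.2.1) ?_)
    refine le_trans ?_ hm.le
    have : (m : ℝ) ≤ κ n := by exact_mod_cast h1.2.2
    gcongr
  linarith

end BoundedSequences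

end

/-! ### The quotient of the algebra of bounded sequences -/

theorem proposition4p2
    (A : ℕ → Type*) [∀ n, CStarAlgebra (A n)] [∀ n, Nontrivial (A n)]
    (τ : ∀ n, A n → ℂ) (hτ : ∀ n, IsQuasitrace (τ n)) (hτ_one : ∀ n, τ n 1 = 1)
    (U : Ultrafilter ℕ) (hU : (U : Filter ℕ) ≤ Filter.cofinite) :
    ∃ (J : Ideal (lp A ∞)) (_ : J.IsTwoSided) (_ : IsClosed (J : Set (lp A ∞))),
      (J : Set (lp A ∞)) =
        {x | Filter.Tendsto (fun n => τ n (star (x n) * x n)) (U : Filter ℕ) (𝓝 0)} ∧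
      IsAWStarAlgebra (lp A ∞ ⧸ J) ∧
      IsFiniteCStarAlgebra (lp A ∞ ⧸ J) ∧
      ∃ τU : (lp A ∞ ⧸ J) → ℂ,
        (∀ x : lp A ∞, Filter.Tendsto (fun n => τ n (x n)) (U : Filter ℕ)
          (𝓝 (τU (Ideal.Quotient.mk J x)))) ∧
        IsQuasitrace τU ∧ IsFaithfulQuasitrace τU ∧ IsNormalQuasitrace τU := by
  let _ : ∀ n, PartialOrder (A n) := fun n => CStarAlgebra.spectralOrder (A n)
  have _ : ∀ n, StarOrderedRing (A n) := fun n => CStarAlgebra.spectralOrderedRing (A n)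
  let _ : PartialOrder (lp A ∞) := CStarAlgebra.spectralOrder (lp A ∞)
  have _ : StarOrderedRing (lp A ∞) := CStarAlgebra.spectralOrderedRing (lp A ∞)
  obtain ⟨ρ, hρ, hρq⟩ := exists_isQuasitrace_ultralimit U (lpEval A) hτ (M := 1)
    fun n => by rw [hτ_one, Complex.one_re]
  have hts := hρq.isTwoSided_nullIdeal
  have hcl := hρq.isClosed_nullIdeal
  let _ : PartialOrder (lp A ∞ ⧸ hρq.nullIdeal) := CStarAlgebra.spectralOrder _
  have _ : StarOrderedRing (lp A ∞ ⧸ hρq.nullIdeal) := CStarAlgebra.spectralOrderedRing _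
  let π : CStarHom (lp A ∞) (lp A ∞ ⧸ hρq.nullIdeal) :=
    { toFun := Ideal.Quotient.mk hρq.nullIdeal
      map_one' := rfl
      map_mul' := fun _ _ => rfl
      map_zero' := rfl
      map_add' := fun _ _ => rfl
      commutes' := fun _ => rfl
      map_star' := fun _ => rfl }
  have hρsq : ∀ x : lp A ∞, Filter.Tendsto (fun n => τ n (star (x n) * x n)) (U : Filter ℕ)
      (𝓝 (ρ (star x * x))) := fun x => hρ (star x * x)
  obtain ⟨hAW, hfin, τU, hτU, hq, hf, hn⟩ := hρq.exists_quotient (π := π)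
    (fun x => by
      change Ideal.Quotient.mk hρq.nullIdeal x = 0 ↔ _
      rw [Ideal.Quotient.eq_zero_iff_mem, hρq.mem_nullIdeal])
    (fun a => by
      obtain ⟨x, hx, hxn⟩ := CStarQuotient.exists_rep hρq.nullIdeal a one_pos
      exact ⟨x, hx, hxn.le⟩)
    (fun x ⟨R, hR⟩ hx => exists_limit_of_cauchy hU
      (N := fun n a => (τ n (star a * a)).re) (L := fun x => (ρ (star x * x)).re)
      (fun x => (Complex.continuous_re.tendsto _).comp (hρsq x)) hρq.re_star_mul_self_nonneg hR hx)
  refine ⟨hρq.nullIdeal, hts, hcl, Set.ext fun x => ?_, hAW, hfin, τU, fun x => ?_, hq, hf, hn⟩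
  -- The null ideal is defined by a real part; `ρ (x⋆x)` is real, so this agrees with the vanishing
  -- of the complex limit.
  · have hre := hρq.toIsOneQuasitrace.eq_re (IsSelfAdjoint.star_mul_self x)
    rw [SetLike.mem_coe, hρq.mem_nullIdeal, Set.mem_ofPred_eq]
    refine ⟨fun h => ?_, fun h => ?_⟩
    · have := hρsq x
      rwa [hre, h, Complex.ofReal_zero] at this
    · rw [tendsto_nhds_unique (hρsq x) h, Complex.zero_re]
  · have := hρ x
    rw [← hτU x] at this
    exact this
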